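/- **Setting.** Let $M\ge 1$ systems $x_{t+1}=A^{(i)}x_t+B^{(i)}u_t$ with state dimension $n_x\ge1$ and input dimension $n_u\ge1$ and cost matrices $Q^{(i)}\succ0$, $R^{(i)}\succ0$ be given. The initial state is drawn from a distribution $\mathcal X_0$ with zero mean and finite covariance $\Sigma_0\succ\mu I$, $\mu>0$. For $K\in\mathbb R^{n_u\times n_x}$ let $$\mathcal J^{(i)}(K)=\mathbb E\sum_{t\ge0}x_t^\top\big(Q^{(i)}+K^\top R^{(i)}K\big)x_t\qquad\text{under } u_t=-Kx_t,$$ let $\mathcal K^{(i)}=\{K:\rho(A^{(i)}-B^{(i)}K)<1\}$, and let $K_i^\star$ minimize $\mathcal J^{(i)}$ over $\mathcal K^{(i)}$. Norms $\|\cdot\|$ of system matrices are spectral; gradients are taken with respect to the Frobenius inner product. Given $\bar K_0\in\bigcap_i\mathcal K^{(i)}$ and $\gamma\ge1$, put $\Delta^{(i)}_0=\mathcal J^{(i)}(\bar K_0)-\mathcal J^{(i)}(K_i^\star)$ and $$\mathcal S=\bigcap_i\big\{K\in\mathcal K^{(i)}:\ \mathcal J^{(i)}(K)-\mathcal J^{(i)}(K_i^\star)\le\gamma\Delta_0^{(i)}\big\}.$$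 Assume bounded heterogeneity: $\|A^{(i)}-A^{(j)}\|\le\epsilon_A$, $\|B^{(i)}-B^{(j)}\|\le\epsilon_B$, $\|Q^{(i)}-Q^{(j)}\|\le\epsilon_Q$, $\|R^{(i)}-R^{(j)}\|\le\epsilon_R$ for $i\ne j$, with $\epsilon_A,\epsilon_B,\epsilon_Q,\epsilon_R>0$. Let $$\lambda=4\mu^2\min_i\frac{\sigma_{\min}(R^{(i)})}{\|\Sigma_{K_i^\star}\|},\qquad \Sigma_{K_i^\star}=\sum_{t\ge0}\mathbb E[x_tx_t^\top]\ \text{ for system $i$ under } K_i^\star .$$ **Algorithm.** Let $b_s,m\ge1$ be integers, $r>0$, $\eta>0$, $\tau_{\max}\ge1$. At iteration $n$ a batch $\mathcal B_n\subseteq\{1,\dots,M\}$ with $|\mathcal B_n|=b_s$ is aggregated, $$\bar K_{n+1}=\bar K_n-\frac{\eta}{b_s}\sum_{s\in\mathcal B_n}\widehat\nabla\mathcal J^{(s)}\big(\bar K_{n-\tau_s(n)}\big),\qquad \widehat\nabla\mathcal J(K)=\frac{n_xn_u}{2r^2m}\sum_{l=1}^m\big(\mathcal J(K+U_l)-\mathcal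 J(K-U_l)\big)U_l ,$$ where all the $U_l$ are independent (across samples, systems and iterations) and uniform on the sphere $\|U\|_F=r$. The batches and delays are arbitrary, do not depend on the random perturbations, and satisfy $\tau_s(n)\le\min(n,\tau_{\max})$. **Theorem (optimality gap).** There are absolute constants $c_1,c_2,c_3>0$, and constants $h_{\rm grad},C_{\rm het},r_0>0$ that depend only on $n_x,n_u$ and on a bound $\kappa$ of the problem parameters (that is, $\|A^{(i)}\|,\|B^{(i)}\|,\|Q^{(i)}\|,\|R^{(i)}\|,\gamma\mathcal J^{(i)}(\bar K_0)\le\kappa$ and $\sigma_{\min}(Q^{(i)}),\sigma_{\min}(R^{(i)}),\mu\ge\kappa^{-1}$), such that the following holds with $$\epsilon_{\rm het}=C_{\rm het}(\epsilon_A+\epsilon_B+\epsilon_Q+\epsilon_R)^2,\quad c_{\rm step}=c_1\Big(n_x^2+\frac{n_x^2}{b_s}\Big),\quad c_{\rm dim}=c_2n_x^2,\quad c_{\rm bias}=c_3h_{\rm grad}^2r^2 .$$ 1. On $\mathcal S$ every $\nabla\mathcal J^{(i)}$ is $h_{\rm grad}$-Lipschitz, and $\|\nabla\mathcal J^{(i)}(K)-\nabla\mathcal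 J^{(j)}(K)\|_F^2\le\epsilon_{\rm het}$ for all $K\in\mathcal S$ and $i\ne j$. 2. Suppose that $r\le r_0$ and $\eta\le\eta_{\rm gap}$, where $$\eta_{\rm gap}=\min\Big\{\frac{\eta_{\rm ergodic}}{h_{\rm grad}},\ \frac1{h_{\rm grad}\max\{8\tau_{\max},\sqrt2\,\tau_{\max}^{3/2}\}},\ \frac1{\tau_{\max}\sqrt{2c_{\rm bias}}}\Big\},$$ $$\eta_{\rm ergodic}=\min\Big\{\frac18,\ \frac{\sqrt{b_s}}{\sqrt6\,\tau_{\max}},\ \frac1{\max\{\sqrt{32c_{\rm step}}\,\tau_{\max},\,2c_{\rm step}\}}\Big\}.$$ Then $1-\frac{\eta\lambda}4\in(0,1)$. For every $N\ge0$ let $E_N$ be the event that $\bar K_0,\dots,\bar K_{N-1}\in\mathcal S$. Almost surely on $E_N$, $\bar K_N\in\bigcap_i\mathcal K^{(i)}$, and for every $i$ the gap is integrable on $E_N$ and $$\mathbb E\Big[\mathbf 1_{E_N}\big(\mathcal J^{(i)}(\bar K_N)-\mathcal J^{(i)}(K_i^\star)\big)\Big]\ \le\ \Big(1-\frac{\eta\lambda}4\Big)^N\Delta_0^{(i)}+\lambda^{-1}\big(c_{\rm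 dim}\,\epsilon_{\rm het}+c_{\rm bias}\big).$$ In particular, if the iterates stay in $\mathcal S$ almost surely up to iteration $N-1$, then $\Delta_N^{(i)}=\mathbb E\big[\mathcal J^{(i)}(\bar K_N)-\mathcal J^{(i)}(K_i^\star)\big]$ satisfies this bound. -/

import Mathlib

open MeasureTheory ProbabilityTheory
open scoped ENNReal Matrix Matrix.Norms.L2Operator

noncomputable section

namespace AsyncLQR

/-- Data `(A, B, Q, R)` of a discrete-time linear system with a quadratic cost. -/
structure LQRSystem (nx nu : ℕ) where
  /-- state matrix -/
  A : Matrix (Fin nx) (Fin nx) ℝ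
  /-- input matrix -/
  B : Matrix (Fin nx) (Fin nu) ℝ
  /-- state cost matrix -/
  Q : Matrix (Fin nx) (Fin nx) ℝ
  /-- input cost matrix -/
  R : Matrix (Fin nu) (Fin nu) ℝ

/-- The space of `nu × nx` feedback gains with the Frobenius inner product and norm. -/
abbrev Gain (nx nu : ℕ) := EuclideanSpace ℝ (Fin nu × Fin nx)

/-- A gain as a matrix. -/
def Gain.toMat {nx nu : ℕ} (K : Gain nx nu) : Matrix (Fin nu) (Fin nx) ℝ :=
  Matrix.of fun i j => K (i, j)

/-- The minimum singular value of a square matrix, `min {‖T v‖₂ : ‖v‖₂ = 1}`. -/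
def sigmaMin {n : ℕ} (T : Matrix (Fin n) (Fin n) ℝ) : ℝ :=
  ⨅ v : Metric.sphere (0 : EuclideanSpace ℝ (Fin n)) 1,
    ‖Matrix.toEuclideanCLM (𝕜 := ℝ) T (v : EuclideanSpace ℝ (Fin n))‖

/-- The second moment matrix `E[x xᵀ]` of a distribution of the initial state. -/
def secondMoment {nx : ℕ} (X₀ : Measure (Fin nx → ℝ)) : Matrix (Fin nx) (Fin nx) ℝ :=
  Matrix.of fun a b => ∫ x, x a * x b ∂X₀

/-- Zero mean, finite second moments and covariance `E[x xᵀ] ≻ μ I`. -/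
structure IsInitialDistribution {nx : ℕ} (X₀ : Measure (Fin nx → ℝ)) (μ : ℝ) : Prop where
  isProbabilityMeasure : IsProbabilityMeasure X₀
  memLp : ∀ a, MemLp (fun x : Fin nx → ℝ => x a) 2 X₀
  mean_zero : ∀ a, ∫ x, x a ∂X₀ = 0
  cov_pos : (secondMoment X₀ - μ • (1 : Matrix (Fin nx) (Fin nx) ℝ)).PosDef

namespace LQRSystem

variable {nx nu : ℕ} (S : LQRSystem nx nu)

/-- The closed-loop matrix `A - B K`. -/
def closedLoop (K : Gain nx nu) : Matrix (Fin nx) (Fin nx) ℝ := S.A - S.B * K.toMat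

/-- The set `{K | ρ(A - B K) < 1}` of stabilizing gains. -/
def stabilizing : Set (Gain nx nu) :=
  {K | spectralRadius ℂ ((S.closedLoop K).map (algebraMap ℝ ℂ)) < 1}

/-- The state at time `t` of `x_{t+1} = A x_t + B u_t` under `u_t = -K x_t` from `x₀`. -/
def state (K : Gain nx nu) (x₀ : Fin nx → ℝ) : ℕ → Fin nx → ℝ
  | 0 => x₀
  | t + 1 => S.A *ᵥ state K x₀ t + S.B *ᵥ (-(K.toMat *ᵥ state K x₀ t))

/-- The cost `E[∑ₜ xₜᵀ (Q + Kᵀ R K) xₜ]` with values in `[0, ∞]`. -/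
def eCost (X₀ : Measure (Fin nx → ℝ)) (K : Gain nx nu) : ℝ≥0∞ :=
  ∫⁻ x₀, ∑' t, ENNReal.ofReal
    (S.state K x₀ t ⬝ᵥ ((S.Q + K.toMatᵀ * S.R * K.toMat) *ᵥ S.state K x₀ t)) ∂X₀

/-- The cost as a real number (used where it is finite, in particular at stabilizing gains). -/
def cost (X₀ : Measure (Fin nx → ℝ)) (K : Gain nx nu) : ℝ := (S.eCost X₀ K).toReal

/-- The state covariance `Σ_K = ∑ₜ E[xₜ xₜᵀ]` accumulated along the closed loop. -/
def stateCov (X₀ : Measure (Fin nx → ℝ)) (K : Gain nx nu) : Matrix (Fin nx) (Fin nx) ℝ :=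
  Matrix.of fun a b => ∑' t, ∫ x₀, S.state K x₀ t a * S.state K x₀ t b ∂X₀

/-- `K` minimizes the cost among the stabilizing gains. -/
def IsOptimal (X₀ : Measure (Fin nx → ℝ)) (K : Gain nx nu) : Prop :=
  K ∈ S.stabilizing ∧ ∀ K' ∈ S.stabilizing, S.cost X₀ K ≤ S.cost X₀ K'

end LQRSystem

variable {nx nu M : ℕ}

/-- The gains that stabilize every system and whose optimality gap, for every system, is at most
`γ` times the gap of the initial gain `K₀`. -/
def sublevel (sys : Fin M → LQRSystem nx nu) (X₀ : Measure (Fin nx → ℝ))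
    (Kstar : Fin M → Gain nx nu) (K₀ : Gain nx nu) (γ : ℝ) : Set (Gain nx nu) :=
  {K | ∀ i, K ∈ (sys i).stabilizing ∧
    (sys i).cost X₀ K - (sys i).cost X₀ (Kstar i)
      ≤ γ * ((sys i).cost X₀ K₀ - (sys i).cost X₀ (Kstar i))}

/-- The gradient dominance constant `4 μ² minᵢ σ_min(Rᵢ) / ‖Σ_{Kᵢ*}‖`. -/
def gradDom (sys : Fin M → LQRSystem nx nu) (X₀ : Measure (Fin nx → ℝ))
    (Kstar : Fin M → Gain nx nu) (μ : ℝ) : ℝ :=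
  4 * μ ^ 2 * ⨅ i, sigmaMin (sys i).R / ‖(sys i).stateCov X₀ (Kstar i)‖

/-- `κ` bounds the parameters of the problem. -/
structure ParamBound (κ : ℝ) (sys : Fin M → LQRSystem nx nu) (X₀ : Measure (Fin nx → ℝ))
    (K₀ : Gain nx nu) (γ μ : ℝ) : Prop where
  norm_A : ∀ i, ‖(sys i).A‖ ≤ κ
  norm_B : ∀ i, ‖(sys i).B‖ ≤ κ
  norm_Q : ∀ i, ‖(sys i).Q‖ ≤ κ
  norm_R : ∀ i, ‖(sys i).R‖ ≤ κ
  sigmaMin_Q : ∀ i, κ⁻¹ ≤ sigmaMin (sys i).Q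
  sigmaMin_R : ∀ i, κ⁻¹ ≤ sigmaMin (sys i).R
  init_cov : κ⁻¹ ≤ μ
  init_cost : ∀ i, γ * (sys i).cost X₀ K₀ ≤ κ

/-- Pairwise heterogeneity bounds in spectral norm. -/
structure HetBound (sys : Fin M → LQRSystem nx nu) (εA εB εQ εR : ℝ) : Prop where
  A : ∀ i j, i ≠ j → ‖(sys i).A - (sys j).A‖ ≤ εA
  B : ∀ i j, i ≠ j → ‖(sys i).B - (sys j).B‖ ≤ εB
  Q : ∀ i j, i ≠ j → ‖(sys i).Q - (sys j).Q‖ ≤ εQ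
  R : ∀ i j, i ≠ j → ‖(sys i).R - (sys j).R‖ ≤ εR

/-- The uniform distribution on the Frobenius unit sphere of gains. -/
def uniformSphere (nx nu : ℕ) : Measure (Gain nx nu) :=
  (((volume : Measure (Gain nx nu)).toSphere Set.univ)⁻¹ •
    (volume : Measure (Gain nx nu)).toSphere).map Subtype.val

/-- The two-point zeroth-order gradient estimate
`nx nu / (2 r² m) ∑ₗ (J(K + Uₗ) - J(K - Uₗ)) Uₗ` with `Uₗ = r uₗ`. -/
def zoEstimate {m : ℕ} (J : Gain nx nu → ℝ) (r : ℝ) (K : Gain nx nu) (u : Fin m → Gain nx nu) :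
    Gain nx nu :=
  ((nx * nu : ℝ) / (2 * r ^ 2 * m)) •
    ∑ l, (J (K + r • u l) - J (K - r • u l)) • (r • u l)

/-- An asynchronous schedule: at iteration `n` the server aggregates the estimates of the `bs`
systems in `batch n`, and that of system `s` was computed at the iterate `n - delay s n`, where
delays are bounded by `τmax`. -/
structure Schedule (M bs : ℕ) (τmax : ℝ) where
  /-- systems whose estimates are aggregated at iteration `n` -/
  batch : ℕ → Finset (Fin M)
  /-- staleness -/
  delay : Fin M → ℕ → ℕ
  card_batch : ∀ n, (batch n).card = bs
  delay_le : ∀ s n, delay s n ≤ n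
  delay_le_max : ∀ s n, (delay s n : ℝ) ≤ τmax

/-- `K` is the sequence of iterates of the asynchronous policy gradient method from `K₀` with step
size `η`. An estimate is aggregated exactly once, so its `m` random directions `u n s l` can be
labelled by the iteration `n` at which it is aggregated (not computed) and by its system `s`. -/
def IsRun {bs m : ℕ} {τmax : ℝ} {Ω : Type*} (sys : Fin M → LQRSystem nx nu)
    (X₀ : Measure (Fin nx → ℝ)) (sched : Schedule M bs τmax) (η r : ℝ) (K₀ : Gain nx nu)
    (u : ℕ → Fin M → Fin m → Ω → Gain nx nu) (K : ℕ → Ω → Gain nx nu) : Prop :=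
  (∀ ω, K 0 ω = K₀) ∧
  ∀ n ω, K (n + 1) ω = K n ω - (η / bs) • ∑ s ∈ sched.batch n,
    zoEstimate ((sys s).cost X₀) r (K (n - sched.delay s n) ω) (fun l => u n s l ω)

/-- The random directions are independent and uniform on the unit sphere. -/
structure IsUniformDirections {m : ℕ} {Ω : Type*} [MeasurableSpace Ω] (P : Measure Ω)
    (u : ℕ → Fin M → Fin m → Ω → Gain nx nu) : Prop where
  measurable : ∀ n s l, Measurable (u n s l)
  law : ∀ n s l, P.map (u n s l) = uniformSphere nx nu
  indep : iIndepFun (fun j : ℕ × Fin M × Fin m => u j.1 j.2.1 j.2.2) P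

/-- `η_ergodic`, without the factor `1 / h_grad`. -/
def etaErgodic (bs : ℕ) (τmax cstep : ℝ) : ℝ :=
  min (1 / 8) (min (√bs / (√6 * τmax)) (1 / max (√(32 * cstep) * τmax) (2 * cstep)))

/-- The step size threshold `η_gap`. -/
def etaGap (bs : ℕ) (τmax h cstep cbias : ℝ) : ℝ :=
  min (etaErgodic bs τmax cstep / h)
    (min (1 / (h * max (8 * τmax) (√2 * τmax ^ (3 / 2 : ℝ)))) (1 / (τmax * √(2 * cbias))))

end AsyncLQR

end

/-! The proof separates a deterministic study of the LQR landscape from a perturbed descent argument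
that uses only a few constants of that landscape.

Landscape. Let P_K and Σ_K solve the two dual Lyapunov equations of A - BK. The cost is tr(P_K Σ₀) =
tr((Q + KᵀRK) Σ_K), where Σ₀ is the second moment matrix. Since Q, R and Σ₀ are at least κ⁻¹, a
bound on the cost bounds K, P_K, Σ_K and the Lyapunov sums (`exists_bdd`). Moreover P_K remains a
Lyapunov function for nearby gains, so a ball of fixed radius δ around any point of the sublevel set
is stabilizing with bounded cost (`exists_nbhd`). The identity `cost_sub_cost` expands J(K') - J(K)
exactly against Σ_{K'}. Combined with Lipschitz perturbation of Lyapunov equations it gives a second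
order expansion with gradient 2 E_K Σ_K; completing the square in it gives gradient dominance. The
same perturbation calculus, applied to two systems at one gain, bounds the gradient heterogeneity.

Method. Put D = nx nu. The two-point estimate equals D times an average of ⟨∇J, u⟩ u, up to an error
D L r. On the sphere E[u uᵀ] = I/D, and the directions aggregated at iteration n are independent of
all earlier ones; so the main part is unbiased given the past, even at a stale iterate. No variance
analysis is needed: the estimate is bounded pathwise by D(‖∇J‖ + L r). Staleness and second order
terms therefore cost at most ζ times the sum of ‖∇J‖² over the last 2τ iterations, plus
heterogeneity and bias (`SmoothFamily.descent`). Of the decrease (3/4) η ‖∇J‖², a quarter η ‖∇J‖²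
yields the contraction through gradient dominance, and the remaining half pays for the window sums
(`le_of_window_recursion`). The events E_n decrease and the gap is nonnegative on them, so
restricting from E_n to E_{n+1} only lowers the expected gap.

Constants. `h` only has to be some Lipschitz constant that depends on the dimensions and κ. It is
taken so large that the step size condition absorbs D²L, the step length and λ; then c₁ = c₂ = c₃ =
1 suffice. -/

namespace AsyncLQR

/-! ### Loewner order, traces and spectral norms of real matrices. -/

section MatrixFacts

open scoped MatrixOrder

variable {n m k : ℕ}

lemma norm_transpose (C : Matrix (Fin m) (Fin n) ℝ) : ‖Cᵀ‖ = ‖C‖ := by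
  rw [← Matrix.conjTranspose_eq_transpose_of_trivial, Matrix.l2_opNorm_conjTranspose]

lemma le_iff_quadForm {A B : Matrix (Fin n) (Fin n) ℝ} (hA : Aᵀ = A) (hB : Bᵀ = B) :
    A ≤ B ↔ ∀ x, x ⬝ᵥ (A *ᵥ x) ≤ x ⬝ᵥ (B *ᵥ x) := by
  rw [Matrix.le_iff, Matrix.posSemidef_iff_dotProduct_mulVec]
  constructor
  · intro h x
    have := h.2 x
    simpa [Matrix.sub_mulVec, dotProduct_sub] using this
  · intro h
    refine ⟨?_, fun x => ?_⟩
    · rw [Matrix.IsHermitian, Matrix.conjTranspose_eq_transpose_of_trivial, Matrix.transpose_sub,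
        hA, hB]
    · simpa [Matrix.sub_mulVec, dotProduct_sub] using h x

lemma transpose_of_nonneg {A : Matrix (Fin n) (Fin n) ℝ} (hA : 0 ≤ A) : Aᵀ = A := by
  have := (Matrix.nonneg_iff_posSemidef.mp hA).isHermitian
  rwa [Matrix.IsHermitian, Matrix.conjTranspose_eq_transpose_of_trivial] at this

lemma exists_factor {A : Matrix (Fin n) (Fin n) ℝ} (hA : 0 ≤ A) :
    ∃ C : Matrix (Fin n) (Fin n) ℝ, A = Cᵀ * C := by
  obtain ⟨B, rfl⟩ := CStarAlgebra.nonneg_iff_eq_star_mul_self.mp hA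
  exact ⟨B, by rw [Matrix.star_eq_conjTranspose, Matrix.conjTranspose_eq_transpose_of_trivial]⟩

lemma conj_nonneg {A : Matrix (Fin n) (Fin n) ℝ} (hA : 0 ≤ A) (C : Matrix (Fin m) (Fin n) ℝ) :
    0 ≤ C * A * Cᵀ := by
  have := Matrix.nonneg_iff_posSemidef.mpr
    ((Matrix.nonneg_iff_posSemidef.mp hA).mul_mul_conjTranspose_same C)
  rwa [Matrix.conjTranspose_eq_transpose_of_trivial] at this

lemma conj_nonneg' {A : Matrix (Fin n) (Fin n) ℝ} (hA : 0 ≤ A) (C : Matrix (Fin n) (Fin m) ℝ) :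
    0 ≤ Cᵀ * A * C := by
  simpa using conj_nonneg hA Cᵀ

lemma conj_mono {A B : Matrix (Fin n) (Fin n) ℝ} (h : A ≤ B) (C : Matrix (Fin m) (Fin n) ℝ) :
    C * A * Cᵀ ≤ C * B * Cᵀ := by
  have := conj_nonneg (sub_nonneg.mpr h) C
  rwa [Matrix.mul_sub, Matrix.sub_mul, sub_nonneg] at this

lemma conj_mono' {A B : Matrix (Fin n) (Fin n) ℝ} (h : A ≤ B) (C : Matrix (Fin n) (Fin m) ℝ) :
    Cᵀ * A * C ≤ Cᵀ * B * C := by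
  simpa using conj_mono h Cᵀ

lemma transpose_mul_self_nonneg (C : Matrix (Fin m) (Fin n) ℝ) : 0 ≤ Cᵀ * C := by
  have := Matrix.nonneg_iff_posSemidef.mpr (Matrix.posSemidef_conjTranspose_mul_self C)
  rwa [Matrix.conjTranspose_eq_transpose_of_trivial] at this

lemma trace_nonneg' {A : Matrix (Fin n) (Fin n) ℝ} (hA : 0 ≤ A) : 0 ≤ A.trace :=
  (Matrix.nonneg_iff_posSemidef.mp hA).trace_nonneg

lemma trace_mono {A B : Matrix (Fin n) (Fin n) ℝ} (h : A ≤ B) : A.trace ≤ B.trace := by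
  have := trace_nonneg' (sub_nonneg.mpr h)
  rwa [Matrix.trace_sub, sub_nonneg] at this

lemma trace_mul_nonneg' {A B : Matrix (Fin n) (Fin n) ℝ} (hA : 0 ≤ A) (hB : 0 ≤ B) :
    0 ≤ (A * B).trace := by
  obtain ⟨C, rfl⟩ := exists_factor hA
  rw [Matrix.mul_assoc, Matrix.trace_mul_comm]
  exact trace_nonneg' (conj_nonneg hB C)

lemma trace_mul_mono_left {A B C : Matrix (Fin n) (Fin n) ℝ} (h : A ≤ B) (hC : 0 ≤ C) :
    (A * C).trace ≤ (B * C).trace := by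
  have := trace_mul_nonneg' (sub_nonneg.mpr h) hC
  rwa [Matrix.sub_mul, Matrix.trace_sub, sub_nonneg] at this

lemma trace_mul_mono_right {A B C : Matrix (Fin n) (Fin n) ℝ} (h : A ≤ B) (hC : 0 ≤ C) :
    (C * A).trace ≤ (C * B).trace := by
  rw [Matrix.trace_mul_comm, Matrix.trace_mul_comm C]
  exact trace_mul_mono_left h hC

lemma dotProduct_eq_inner (x y : Fin n → ℝ) :
    x ⬝ᵥ y = inner ℝ (WithLp.toLp 2 x) (WithLp.toLp 2 y) := by
  simp [PiLp.inner_apply, dotProduct, mul_comm]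

lemma norm_toLp_mulVec_le (A : Matrix (Fin m) (Fin n) ℝ) (x : Fin n → ℝ) :
    ‖WithLp.toLp 2 (A *ᵥ x)‖ ≤ ‖A‖ * ‖WithLp.toLp 2 x‖ :=
  Matrix.l2_opNorm_mulVec A (WithLp.toLp 2 x)

lemma abs_dotProduct_mulVec_le (A : Matrix (Fin m) (Fin n) ℝ) (x : Fin m → ℝ) (y : Fin n → ℝ) :
    |x ⬝ᵥ (A *ᵥ y)| ≤ ‖A‖ * (‖WithLp.toLp 2 x‖ * ‖WithLp.toLp 2 y‖) := by
  rw [dotProduct_eq_inner]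
  refine (abs_real_inner_le_norm _ _).trans ?_
  calc _ ≤ ‖WithLp.toLp 2 x‖ * (‖A‖ * ‖WithLp.toLp 2 y‖) := by
        gcongr; exact norm_toLp_mulVec_le A y
    _ = _ := by ring

lemma le_norm_smul_one {W : Matrix (Fin n) (Fin n) ℝ} (hW : Wᵀ = W) : W ≤ ‖W‖ • 1 := by
  rw [le_iff_quadForm hW (by simp)]
  intro x
  have h := (le_abs_self _).trans (abs_dotProduct_mulVec_le W x x)
  rw [Matrix.smul_mulVec, Matrix.one_mulVec, dotProduct_smul, dotProduct_eq_inner x x,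
    real_inner_self_eq_norm_mul_norm]
  exact h

lemma abs_entry_le (A : Matrix (Fin m) (Fin n) ℝ) (i : Fin m) (j : Fin n) : |A i j| ≤ ‖A‖ := by
  have := abs_dotProduct_mulVec_le A (Pi.single i 1) (Pi.single j 1)
  simpa using this

lemma abs_trace_le (Z : Matrix (Fin n) (Fin n) ℝ) : |Z.trace| ≤ n * ‖Z‖ := by
  refine (Finset.abs_sum_le_sum_abs _ _).trans ?_
  calc _ ≤ ∑ _i : Fin n, ‖Z‖ := Finset.sum_le_sum fun i _ => abs_entry_le Z i i
    _ = _ := by simp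

lemma trace_transpose_mul_self (C : Matrix (Fin m) (Fin n) ℝ) :
    (Cᵀ * C).trace = ∑ i, ∑ j, C i j ^ 2 := by
  simp only [Matrix.trace, Matrix.diag, Matrix.mul_apply, Matrix.transpose_apply]
  rw [Finset.sum_comm]
  simp [sq]

lemma norm_sq_le_trace (C : Matrix (Fin m) (Fin n) ℝ) : ‖C‖ ^ 2 ≤ (Cᵀ * C).trace := by
  have h0 : 0 ≤ (Cᵀ * C).trace := trace_nonneg' (transpose_mul_self_nonneg C)
  have : ‖C‖ ≤ √((Cᵀ * C).trace) := by
    rw [Matrix.l2_opNorm_def]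
    refine ContinuousLinearMap.opNorm_le_bound _ (Real.sqrt_nonneg _) fun x => ?_
    have hx : (0:ℝ) ≤ ‖x‖ := norm_nonneg x
    rw [← Real.sqrt_sq hx, ← Real.sqrt_mul h0, EuclideanSpace.norm_eq]
    refine Real.sqrt_le_sqrt ?_
    rw [trace_transpose_mul_self, Finset.sum_mul]
    refine Finset.sum_le_sum fun i _ => ?_
    rw [EuclideanSpace.norm_eq, Real.sq_sqrt (Finset.sum_nonneg fun _ _ => sq_nonneg _)]
    simp only [Real.norm_eq_abs, sq_abs]
    exact Finset.sum_mul_sq_le_sq_mul_sq Finset.univ (fun j => C i j) (fun j => x j)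
  calc _ ≤ √((Cᵀ * C).trace) ^ 2 := by gcongr
    _ = _ := Real.sq_sqrt h0

lemma norm_le_trace {A : Matrix (Fin n) (Fin n) ℝ} (hA : 0 ≤ A) : ‖A‖ ≤ A.trace := by
  obtain ⟨C, rfl⟩ := exists_factor hA
  calc ‖Cᵀ * C‖ ≤ ‖Cᵀ‖ * ‖C‖ := Matrix.l2_opNorm_mul _ _
    _ = ‖C‖ ^ 2 := by rw [norm_transpose, sq]
    _ ≤ _ := norm_sq_le_trace C

/-- Write A as (A + B) - B, a difference of positive semidefinite matrices, whose norms are at most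
their traces. The factor 3 is crude but only enters constants. -/
lemma norm_le_three_mul_trace {A B : Matrix (Fin n) (Fin n) ℝ} (h1 : A ≤ B) (h2 : -B ≤ A) :
    ‖A‖ ≤ 3 * B.trace := by
  have hB : 0 ≤ B := by
    have h3 : 0 ≤ B + B := by
      have := add_le_add h1 (neg_le.mp h2)
      simpa using this
    have : (0 : Matrix (Fin n) (Fin n) ℝ) ≤ (2⁻¹ : ℝ) • (B + B) := smul_nonneg (by norm_num) h3
    rwa [← two_smul ℝ B, smul_smul, inv_mul_cancel₀ (by norm_num), one_smul] at this
  have hAB : 0 ≤ A + B := by simpa [neg_le_iff_add_nonneg] using h2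
  calc ‖A‖ = ‖(A + B) - B‖ := by simp
    _ ≤ ‖A + B‖ + ‖B‖ := norm_sub_le _ _
    _ ≤ (A + B).trace + B.trace := add_le_add (norm_le_trace hAB) (norm_le_trace hB)
    _ ≤ _ := by
      rw [Matrix.trace_add]
      linarith [trace_mono h1]

lemma abs_trace_mul_le (X : Matrix (Fin m) (Fin n) ℝ) (Y : Matrix (Fin n) (Fin m) ℝ) :
    |(X * Y).trace| ≤ m * (‖X‖ * ‖Y‖) :=
  (abs_trace_le _).trans (by gcongr; exact Matrix.l2_opNorm_mul _ _)

end MatrixFacts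

/-! ### Discrete Lyapunov equations. -/

section Lyapunov

open scoped MatrixOrder

variable {n : ℕ}

/-- Square summability of the powers of `M`; for a real matrix it says that the spectral radius
is less than one. -/
def PowerSummable (M : Matrix (Fin n) (Fin n) ℝ) : Prop := Summable fun t : ℕ => ‖M ^ t‖ ^ 2

/-- The solution `∑ₜ Mᵗ W (Mᵀ)ᵗ` of the Lyapunov equation `X = W + M X Mᵀ`. -/
noncomputable def lyap (M W : Matrix (Fin n) (Fin n) ℝ) : Matrix (Fin n) (Fin n) ℝ :=
  ∑' t : ℕ, M ^ t * W * Mᵀ ^ t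

variable {M : Matrix (Fin n) (Fin n) ℝ}

lemma PowerSummable.transpose (h : PowerSummable M) : PowerSummable Mᵀ := by
  simpa only [PowerSummable, ← Matrix.transpose_pow, norm_transpose] using h

lemma norm_conj_pow_le (M W : Matrix (Fin n) (Fin n) ℝ) (t : ℕ) :
    ‖M ^ t * W * Mᵀ ^ t‖ ≤ ‖M ^ t‖ ^ 2 * ‖W‖ :=
  calc _ ≤ ‖M ^ t‖ * ‖W‖ * ‖Mᵀ ^ t‖ := by
        refine (norm_mul_le _ _).trans ?_
        gcongr
        exact norm_mul_le _ _
    _ = _ := by rw [← Matrix.transpose_pow, norm_transpose]; ring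

lemma PowerSummable.summable_conj (h : PowerSummable M) (W : Matrix (Fin n) (Fin n) ℝ) :
    Summable fun t : ℕ => M ^ t * W * Mᵀ ^ t :=
  Summable.of_norm_bounded (h.mul_right ‖W‖) (norm_conj_pow_le M W)

lemma PowerSummable.lyap_eq (h : PowerSummable M) (W : Matrix (Fin n) (Fin n) ℝ) :
    lyap M W = W + M * lyap M W * Mᵀ := by
  have hs := h.summable_conj W
  rw [lyap, ← hs.tsum_mul_left, ← (hs.mul_left M).tsum_mul_right, hs.tsum_eq_zero_add]
  simp only [pow_zero, Matrix.one_mul, Matrix.mul_one]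
  congr 2
  funext t
  rw [pow_succ', pow_succ]
  simp only [Matrix.mul_assoc]

/-- The difference D of two solutions satisfies D = M D Mᵀ, hence D = Mᵗ D (Mᵀ)ᵗ for all t, which
tends to 0. -/
lemma PowerSummable.lyap_unique (h : PowerSummable M) {W X : Matrix (Fin n) (Fin n) ℝ}
    (hX : X = W + M * X * Mᵀ) : X = lyap M W := by
  set D := X - lyap M W with hD
  have h1 : D = M * D * Mᵀ := by
    rw [hD, Matrix.mul_sub, Matrix.sub_mul]
    nth_rewrite 1 [hX, h.lyap_eq W]
    abel
  have h2 (t : ℕ) : D = M ^ t * D * Mᵀ ^ t := by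
    induction t with
    | zero => simp
    | succ t ih =>
      calc D = M ^ t * (M * D * Mᵀ) * Mᵀ ^ t := by rw [← h1]; exact ih
        _ = _ := by rw [pow_succ, pow_succ']; simp only [Matrix.mul_assoc]
  have h3 : Filter.Tendsto (fun t : ℕ => M ^ t * D * Mᵀ ^ t) Filter.atTop (nhds 0) :=
    (h.summable_conj D).tendsto_atTop_zero
  have h4 : D = 0 := tendsto_nhds_unique (tendsto_const_nhds.congr h2) h3
  exact sub_eq_zero.mp h4

lemma PowerSummable.lyap_smul (h : PowerSummable M) (c : ℝ) (W : Matrix (Fin n) (Fin n) ℝ) :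
    lyap M (c • W) = c • lyap M W := by
  rw [lyap, lyap, ← (h.summable_conj W).tsum_const_smul]
  simp only [Matrix.mul_smul, Matrix.smul_mul]

lemma PowerSummable.lyap_sub (h : PowerSummable M) (V W : Matrix (Fin n) (Fin n) ℝ) :
    lyap M (V - W) = lyap M V - lyap M W := by
  rw [lyap, lyap, lyap, ← (h.summable_conj V).tsum_sub (h.summable_conj W)]
  simp only [Matrix.mul_sub, Matrix.sub_mul]

lemma PowerSummable.lyap_transpose (h : PowerSummable M) {W : Matrix (Fin n) (Fin n) ℝ}
    (hW : Wᵀ = W) : (lyap M W)ᵀ = lyap M W := by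
  apply h.lyap_unique
  conv_lhs => rw [h.lyap_eq W]
  simp only [Matrix.transpose_add, Matrix.transpose_mul, Matrix.transpose_transpose, hW,
    Matrix.mul_assoc]

lemma PowerSummable.hasSum_quadForm (h : PowerSummable M) (W : Matrix (Fin n) (Fin n) ℝ)
    (x : Fin n → ℝ) :
    HasSum (fun t : ℕ => x ⬝ᵥ ((M ^ t * W * Mᵀ ^ t) *ᵥ x)) (x ⬝ᵥ (lyap M W *ᵥ x)) := by
  let f : Matrix (Fin n) (Fin n) ℝ →+ ℝ :=
    { toFun := fun A => x ⬝ᵥ (A *ᵥ x)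
      map_zero' := by simp
      map_add' := fun A B => by simp [Matrix.add_mulVec, dotProduct_add] }
  have hf : Continuous f := by
    change Continuous fun A : Matrix (Fin n) (Fin n) ℝ => x ⬝ᵥ (A *ᵥ x)
    fun_prop
  exact (h.summable_conj W).hasSum.map f hf

lemma PowerSummable.lyap_nonneg (h : PowerSummable M) {W : Matrix (Fin n) (Fin n) ℝ}
    (hW : 0 ≤ W) : 0 ≤ lyap M W := by
  rw [le_iff_quadForm (by simp) (h.lyap_transpose (transpose_of_nonneg hW))]
  intro x
  rw [Matrix.zero_mulVec, dotProduct_zero]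
  refine (h.hasSum_quadForm W x).nonneg fun t => ?_
  have := conj_nonneg hW (M ^ t)
  rw [Matrix.transpose_pow] at this
  simpa using (Matrix.nonneg_iff_posSemidef.mp this).dotProduct_mulVec_nonneg x

lemma PowerSummable.lyap_mono (h : PowerSummable M) {V W : Matrix (Fin n) (Fin n) ℝ}
    (hVW : V ≤ W) : lyap M V ≤ lyap M W := by
  have := h.lyap_nonneg (sub_nonneg.mpr hVW)
  rwa [h.lyap_sub, sub_nonneg] at this

lemma PowerSummable.le_lyap (h : PowerSummable M) {W : Matrix (Fin n) (Fin n) ℝ}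
    (hW : 0 ≤ W) : W ≤ lyap M W := by
  have := conj_nonneg (h.lyap_nonneg hW) M
  rw [h.lyap_eq W]
  simpa using this

/-- The solution operators for M and Mᵀ are adjoint for the trace pairing. This is what exchanges
the value matrix and the state covariance in the cost. -/
lemma PowerSummable.trace_lyap_mul (h : PowerSummable M) (V W : Matrix (Fin n) (Fin n) ℝ) :
    (lyap M W * V).trace = (W * lyap Mᵀ V).trace := by
  have h1 := h.lyap_eq W
  have h2 := h.transpose.lyap_eq V
  set X := lyap M W
  set Y := lyap Mᵀ V
  have e1 : V = Y - Mᵀ * Y * M := by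
    rw [Matrix.transpose_transpose] at h2
    exact eq_sub_of_add_eq h2.symm
  have e2 : W = X - M * X * Mᵀ := eq_sub_of_add_eq h1.symm
  rw [e1, e2, Matrix.mul_sub, Matrix.sub_mul, Matrix.trace_sub, Matrix.trace_sub]
  congr 1
  rw [← Matrix.mul_assoc, Matrix.trace_mul_comm]
  simp only [Matrix.mul_assoc]

/-- Monotonicity reduces everything to W = 1: from -‖W‖ ≤ W ≤ ‖W‖ the solution lies between ∓‖W‖
`lyap M 1`. -/
lemma PowerSummable.norm_lyap_le (h : PowerSummable M) {W : Matrix (Fin n) (Fin n) ℝ}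
    (hW : Wᵀ = W) : ‖lyap M W‖ ≤ 3 * (lyap M 1).trace * ‖W‖ := by
  have h1 : lyap M W ≤ ‖W‖ • lyap M 1 := by
    rw [← h.lyap_smul]
    exact h.lyap_mono (le_norm_smul_one hW)
  have h2 : -(‖W‖ • lyap M 1) ≤ lyap M W := by
    have h3 : -W ≤ ‖W‖ • 1 := by
      simpa using le_norm_smul_one (W := -W) (by simp [hW])
    have h4 := h.lyap_mono h3
    rw [h.lyap_smul, ← neg_one_smul ℝ W, h.lyap_smul, neg_one_smul] at h4
    exact neg_le.mp h4
  refine (norm_le_three_mul_trace h1 h2).trans_eq ?_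
  rw [Matrix.trace_smul, smul_eq_mul]
  ring

/-- The Lyapunov criterion. -/
lemma powerSummable_of_lyapunov {P : Matrix (Fin n) (Fin n) ℝ} {c : ℝ} (hc : 0 < c)
    (hP : 0 ≤ P) (h : Mᵀ * P * M + c • 1 ≤ P) : PowerSummable M := by
  -- Conjugating the hypothesis by the powers of M and telescoping; taking traces then bounds all
  -- partial sums of ‖Mᵗ‖² by tr P / c.
  have key (N : ℕ) : Mᵀ ^ N * P * M ^ N +
      c • ∑ t ∈ Finset.range N, (M ^ t)ᵀ * M ^ t ≤ P := by
    induction N with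
    | zero => simp
    | succ N ih =>
      refine le_trans ?_ ih
      have := conj_mono' h (M ^ N)
      rw [Matrix.mul_add, Matrix.add_mul, Matrix.transpose_pow] at this
      rw [Finset.sum_range_succ, smul_add, ← add_assoc, add_right_comm]
      gcongr
      refine le_trans (le_of_eq ?_) this
      rw [pow_succ, pow_succ']
      simp [Matrix.mul_assoc]
  refine summable_of_sum_range_le (c := P.trace / c) (fun _ => by positivity) fun N => ?_
  rw [le_div_iff₀ hc]
  have h1 := trace_mono (key N)
  rw [Matrix.trace_add, Matrix.trace_smul, Matrix.trace_sum, smul_eq_mul] at h1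
  have h2 : 0 ≤ (Mᵀ ^ N * P * M ^ N).trace := by
    have := trace_nonneg' (conj_nonneg' hP (M ^ N))
    rwa [Matrix.transpose_pow] at this
  have h3 : ∑ t ∈ Finset.range N, ‖M ^ t‖ ^ 2
      ≤ ∑ t ∈ Finset.range N, ((M ^ t)ᵀ * M ^ t).trace :=
    Finset.sum_le_sum fun t _ => norm_sq_le_trace _
  nlinarith

/-- P itself solves the Lyapunov equation with source P - MᵀPM ≥ c, so monotonicity in the source
applies. -/
lemma PowerSummable.smul_lyap_one_le (h : PowerSummable M) {P : Matrix (Fin n) (Fin n) ℝ} {c : ℝ}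
    (hP : Mᵀ * P * M + c • 1 ≤ P) : c • lyap Mᵀ 1 ≤ P := by
  have h1 : P = lyap Mᵀ (P - Mᵀ * P * M) := by
    apply h.transpose.lyap_unique
    rw [Matrix.transpose_transpose]
    abel
  rw [h1, ← h.transpose.lyap_smul]
  exact h.transpose.lyap_mono (le_sub_iff_add_le'.mpr hP)

end Lyapunov

/-! ### Spectral radius below one versus square summable powers. -/

section Spectral

variable {n : ℕ}

lemma norm_le_norm_map_ofReal (M : Matrix (Fin n) (Fin n) ℝ) :
    ‖M‖ ≤ ‖M.map (algebraMap ℝ ℂ)‖ := by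
  rw [Matrix.l2_opNorm_def M]
  refine ContinuousLinearMap.opNorm_le_bound _ (norm_nonneg _) fun x => ?_
  have h := Matrix.l2_opNorm_mulVec (M.map (algebraMap ℝ ℂ))
    (WithLp.toLp 2 (fun i => (x i : ℂ)))
  have e1 : ‖(WithLp.toLp 2 (fun i => (x i : ℂ)) : EuclideanSpace ℂ (Fin n))‖ = ‖x‖ := by
    simp [EuclideanSpace.norm_eq]
  have e2 : (M.map (algebraMap ℝ ℂ)) *ᵥ (fun i => (x i : ℂ)) =
      fun i => (((M *ᵥ x.ofLp) i : ℝ) : ℂ) := by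
    funext i
    simp [Matrix.mulVec, dotProduct]
  rw [e1] at h
  refine le_trans (le_of_eq ?_) h
  simp only [e2]
  simp [EuclideanSpace.norm_eq, Matrix.toLpLin_apply]

lemma map_ofReal_pow (M : Matrix (Fin n) (Fin n) ℝ) (t : ℕ) :
    (M ^ t).map (algebraMap ℝ ℂ) = (M.map (algebraMap ℝ ℂ)) ^ t :=
  map_pow (algebraMap ℝ ℂ).mapMatrix M t

/-- Gelfand's formula: for q strictly between the spectral radius and 1, eventually ‖Mᵗ‖ ≤ qᵗ, first
for the complexification and hence for M. -/
lemma powerSummable_of_spectralRadius_lt_one {M : Matrix (Fin n) (Fin n) ℝ}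
    (h : spectralRadius ℂ (M.map (algebraMap ℝ ℂ)) < 1) : PowerSummable M := by
  obtain ⟨q, hq1, hq2⟩ := ENNReal.lt_iff_exists_nnreal_btwn.mp h
  have hq : (q : ℝ) < 1 := by exact_mod_cast hq2
  have ht := spectrum.pow_nnnorm_pow_one_div_tendsto_nhds_spectralRadius (M.map (algebraMap ℝ ℂ))
  have ev := (ht.eventually (gt_mem_nhds hq1)).and (Filter.eventually_ge_atTop 1)
  refine Summable.of_norm_bounded_eventually_nat (g := fun t => ((q : ℝ) ^ 2) ^ t)
    (summable_geometric_of_lt_one (by positivity) (by nlinarith [q.coe_nonneg])) ?_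
  filter_upwards [ev] with t ⟨h1, h2⟩
  have h3 : ‖(M.map (algebraMap ℝ ℂ)) ^ t‖ ≤ (q : ℝ) ^ t := by
    have ht0 : (0 : ℝ) < t := by exact_mod_cast h2
    have h4 := ENNReal.rpow_le_rpow h1.le ht0.le
    rw [← ENNReal.rpow_mul, one_div, inv_mul_cancel₀ ht0.ne', ENNReal.rpow_one,
      ENNReal.rpow_natCast] at h4
    exact_mod_cast h4
  rw [Real.norm_of_nonneg (by positivity), ← pow_mul, mul_comm, pow_mul]
  gcongr
  refine (norm_le_norm_map_ofReal _).trans ?_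
  rw [map_ofReal_pow]
  exact h3

/-- Powers tend to 0, so some power of the complexification has norm below 1, and the spectral
radius is at most the corresponding root. -/
lemma PowerSummable.spectralRadius_lt_one {M : Matrix (Fin n) (Fin n) ℝ} (h : PowerSummable M) :
    spectralRadius ℂ (M.map (algebraMap ℝ ℂ)) < 1 := by
  set A := M.map (algebraMap ℝ ℂ)
  have h1 : Filter.Tendsto (fun t : ℕ => M ^ t) Filter.atTop (nhds 0) := by
    rw [tendsto_zero_iff_norm_tendsto_zero]
    have := (Summable.tendsto_atTop_zero h).sqrt
    simpa [Real.sqrt_sq] using this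
  have h2 : Filter.Tendsto (fun t : ℕ => A ^ t) Filter.atTop (nhds 0) := by
    have hc : Continuous fun B : Matrix (Fin n) (Fin n) ℝ => B.map (algebraMap ℝ ℂ) :=
      continuous_id.matrix_map Complex.continuous_ofReal
    have := (hc.tendsto 0).comp h1
    simp only [Function.comp_def, map_ofReal_pow] at this
    simpa [A] using this
  have h3 : Filter.Tendsto (fun t : ℕ => ‖A ^ (t + 1)‖ * ‖(1 : Matrix (Fin n) (Fin n) ℂ)‖)
      Filter.atTop (nhds 0) := by
    have := ((Filter.tendsto_add_atTop_iff_nat 1).mpr h2).norm.mul_const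
      ‖(1 : Matrix (Fin n) (Fin n) ℂ)‖
    simpa using this
  obtain ⟨t, ht⟩ := (h3.eventually (gt_mem_nhds one_pos)).exists
  refine (spectrum.spectralRadius_le_pow_nnnorm_pow_one_div ℂ A t).trans_lt ?_
  have hp : (0 : ℝ) < 1 / ((t : ℝ) + 1) := by positivity
  rw [← ENNReal.mul_rpow_of_nonneg _ _ hp.le]
  refine ENNReal.rpow_lt_one ?_ hp
  exact_mod_cast ht

end Spectral

end AsyncLQR

namespace AsyncLQR

open scoped MatrixOrder

variable {nx nu : ℕ}

/-! ### Frobenius geometry of gains, and moments of the initial state. -/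

section Gains

/-- A matrix as a gain. -/
noncomputable def Gain.ofMat (X : Matrix (Fin nu) (Fin nx) ℝ) : Gain nx nu :=
  WithLp.toLp 2 fun p => X p.1 p.2

@[simp] lemma Gain.toMat_ofMat (X : Matrix (Fin nu) (Fin nx) ℝ) : (Gain.ofMat X).toMat = X := rfl

lemma Gain.toMat_sub (K L : Gain nx nu) : (K - L).toMat = K.toMat - L.toMat := rfl

lemma Gain.ofMat_sub (X Y : Matrix (Fin nu) (Fin nx) ℝ) :
    Gain.ofMat (X - Y) = Gain.ofMat X - Gain.ofMat Y := rfl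

lemma Gain.inner_eq (K L : Gain nx nu) : inner ℝ K L = (K.toMatᵀ * L.toMat).trace := by
  simp only [PiLp.inner_apply, Matrix.trace, Matrix.diag, Matrix.mul_apply, Matrix.transpose_apply,
    Gain.toMat, Matrix.of_apply, RCLike.inner_apply, conj_trivial]
  rw [Fintype.sum_prod_type_right]
  simp only [mul_comm]

lemma Gain.norm_sq_eq (K : Gain nx nu) : ‖K‖ ^ 2 = (K.toMatᵀ * K.toMat).trace := by
  rw [← real_inner_self_eq_norm_sq, Gain.inner_eq]

lemma Gain.norm_toMat_le (K : Gain nx nu) : ‖K.toMat‖ ≤ ‖K‖ := by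
  refine (sq_le_sq₀ (norm_nonneg _) (norm_nonneg _)).mp ?_
  rw [Gain.norm_sq_eq]
  exact norm_sq_le_trace _

lemma Gain.norm_le_of_toMat (hx : 1 ≤ nx) (K : Gain nx nu) : ‖K‖ ≤ nx * ‖K.toMat‖ := by
  have hx' : (1 : ℝ) ≤ nx := by exact_mod_cast hx
  refine (sq_le_sq₀ (norm_nonneg _) (by positivity)).mp ?_
  rw [Gain.norm_sq_eq]
  refine (le_abs_self _).trans ((abs_trace_mul_le _ _).trans ?_)
  rw [norm_transpose]
  nlinarith [mul_nonneg (norm_nonneg K.toMat) (norm_nonneg K.toMat)]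

end Gains

section InitialDistribution

variable {X₀ : Measure (Fin nx → ℝ)} {μ : ℝ}

lemma IsInitialDistribution.integrable_mul (h : IsInitialDistribution X₀ μ) (a b : Fin nx) :
    Integrable (fun x : Fin nx → ℝ => x a * x b) X₀ :=
  (h.memLp a).integrable_mul (h.memLp b)

lemma secondMoment_transpose (X₀ : Measure (Fin nx → ℝ)) : (secondMoment X₀)ᵀ = secondMoment X₀ := by
  ext a b
  simp [secondMoment, mul_comm]

lemma IsInitialDistribution.integral_mulVec_mul_mulVec (h : IsInitialDistribution X₀ μ)
    {m k : ℕ} (C : Matrix (Fin m) (Fin nx) ℝ) (D : Matrix (Fin k) (Fin nx) ℝ)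
    (a : Fin m) (b : Fin k) :
    ∫ x, (C *ᵥ x) a * (D *ᵥ x) b ∂X₀ = (C * secondMoment X₀ * Dᵀ) a b := by
  have e (x : Fin nx → ℝ) : (C *ᵥ x) a * (D *ᵥ x) b =
      ∑ j, ∑ i, C a i * D b j * (x i * x j) := by
    simp only [Matrix.mulVec, dotProduct, Finset.sum_mul_sum]
    rw [Finset.sum_comm]
    refine Finset.sum_congr rfl fun i _ => Finset.sum_congr rfl fun j _ => by ring
  simp only [e]
  rw [integral_finsetSum _ fun j _ => integrable_finsetSum _ fun i _ =>
    (h.integrable_mul i j).const_mul _]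
  simp only [Matrix.mul_apply, Matrix.transpose_apply, Finset.sum_mul]
  refine Finset.sum_congr rfl fun j _ => ?_
  rw [integral_finsetSum _ fun i _ => (h.integrable_mul i j).const_mul _]
  refine Finset.sum_congr rfl fun i _ => ?_
  rw [integral_const_mul, secondMoment, Matrix.of_apply]
  ring

lemma IsInitialDistribution.integral_quadForm (h : IsInitialDistribution X₀ μ)
    (P : Matrix (Fin nx) (Fin nx) ℝ) :
    ∫ x, x ⬝ᵥ (P *ᵥ x) ∂X₀ = (P * secondMoment X₀).trace := by
  have e (x : Fin nx → ℝ) : x ⬝ᵥ (P *ᵥ x) = ∑ a, ∑ b, P a b * (x a * x b) := by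
    simp only [Matrix.mulVec, dotProduct, Finset.mul_sum]
    refine Finset.sum_congr rfl fun i _ => Finset.sum_congr rfl fun j _ => by ring
  simp only [e]
  rw [integral_finsetSum Finset.univ (f := fun a (x : Fin nx → ℝ) => ∑ b, P a b * (x a * x b))
    fun j _ => integrable_finsetSum _ fun i _ => (h.integrable_mul j i).const_mul _]
  simp only [Matrix.trace, Matrix.diag, Matrix.mul_apply]
  refine Finset.sum_congr rfl fun j _ => ?_
  rw [integral_finsetSum _ fun i _ => (h.integrable_mul j i).const_mul _]
  refine Finset.sum_congr rfl fun i _ => ?_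
  rw [integral_const_mul, secondMoment, Matrix.of_apply]
  simp only [mul_comm]

end InitialDistribution

/-! ### The cost through the value matrix and the state covariance. -/

namespace LQRSystem

variable (S : LQRSystem nx nu)

/-- The stage cost matrix `Q + Kᵀ R K`. -/
def costMat (K : Gain nx nu) : Matrix (Fin nx) (Fin nx) ℝ := S.Q + K.toMatᵀ * S.R * K.toMat

/-- The value matrix `P_K` of a gain. -/
noncomputable def valueMat (K : Gain nx nu) : Matrix (Fin nx) (Fin nx) ℝ :=
  lyap (S.closedLoop K)ᵀ (S.costMat K)

/-- The matrix `E_K = R K - Bᵀ P_K (A - B K)`. -/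
noncomputable def gradFactor (K : Gain nx nu) : Matrix (Fin nu) (Fin nx) ℝ :=
  S.R * K.toMat - S.Bᵀ * S.valueMat K * S.closedLoop K

/-- The curvature matrix `R + Bᵀ P_K B`. -/
noncomputable def curvMat (K : Gain nx nu) : Matrix (Fin nu) (Fin nu) ℝ :=
  S.R + S.Bᵀ * S.valueMat K * S.B

/-- The gradient `2 E_K Σ_K` of the cost. -/
noncomputable def policyGrad (X₀ : Measure (Fin nx → ℝ)) (K : Gain nx nu) : Gain nx nu :=
  (2 : ℝ) • Gain.ofMat (S.gradFactor K * S.stateCov X₀ K)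

variable {S} {X₀ : Measure (Fin nx → ℝ)} {μ : ℝ} {K K' : Gain nx nu}

lemma mem_stabilizing_iff : K ∈ S.stabilizing ↔ PowerSummable (S.closedLoop K) :=
  ⟨powerSummable_of_spectralRadius_lt_one, fun h => h.spectralRadius_lt_one⟩

lemma state_eq (S : LQRSystem nx nu) (K : Gain nx nu) (x : Fin nx → ℝ) (t : ℕ) :
    S.state K x t = (S.closedLoop K ^ t) *ᵥ x := by
  induction t with
  | zero => simp [state]
  | succ t ih =>
    rw [state, ih, pow_succ', ← Matrix.mulVec_mulVec]
    generalize (S.closedLoop K ^ t) *ᵥ x = y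
    rw [closedLoop, Matrix.sub_mulVec, Matrix.mulVec_neg, Matrix.mulVec_mulVec, sub_eq_add_neg]

lemma costMat_nonneg (hQ : 0 ≤ S.Q) (hR : 0 ≤ S.R) (K : Gain nx nu) : 0 ≤ S.costMat K :=
  add_nonneg hQ (conj_nonneg' hR _)

lemma le_costMat (hR : 0 ≤ S.R) (K : Gain nx nu) : S.Q ≤ S.costMat K :=
  le_add_of_nonneg_right (conj_nonneg' hR _)

lemma valueMat_nonneg (hQ : 0 ≤ S.Q) (hR : 0 ≤ S.R) (hK : K ∈ S.stabilizing) :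
    0 ≤ S.valueMat K :=
  (mem_stabilizing_iff.mp hK).transpose.lyap_nonneg (costMat_nonneg hQ hR K)

lemma valueMat_eq (hK : K ∈ S.stabilizing) :
    S.valueMat K = S.costMat K + (S.closedLoop K)ᵀ * S.valueMat K * S.closedLoop K := by
  have := (mem_stabilizing_iff.mp hK).transpose.lyap_eq (S.costMat K)
  rwa [Matrix.transpose_transpose] at this

lemma cost_eq_trace_valueMat (h : IsInitialDistribution X₀ μ) (hQ : 0 ≤ S.Q) (hR : 0 ≤ S.R)
    (hK : K ∈ S.stabilizing) : S.cost X₀ K = (S.valueMat K * secondMoment X₀).trace := by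
  have hP := valueMat_nonneg hQ hR hK
  have hs := mem_stabilizing_iff.mp hK
  have hquad {A : Matrix (Fin nx) (Fin nx) ℝ} (hA : 0 ≤ A) (x : Fin nx → ℝ) :
      0 ≤ x ⬝ᵥ (A *ᵥ x) := by
    simpa using (Matrix.nonneg_iff_posSemidef.mp hA).dotProduct_mulVec_nonneg x
  have hcont : Continuous fun x : Fin nx → ℝ => x ⬝ᵥ (S.valueMat K *ᵥ x) := by fun_prop
  rw [← h.integral_quadForm, integral_eq_lintegral_of_nonneg_ae
    (Filter.Eventually.of_forall fun x => hquad hP x) hcont.aestronglyMeasurable, cost, eCost]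
  congr 1
  refine lintegral_congr fun x => ?_
  have hsum := hs.transpose.hasSum_quadForm (S.costMat K) x
  have e (t : ℕ) : S.state K x t ⬝ᵥ ((S.Q + K.toMatᵀ * S.R * K.toMat) *ᵥ S.state K x t) =
      x ⬝ᵥ (((S.closedLoop K)ᵀ ^ t * S.costMat K * (S.closedLoop K)ᵀᵀ ^ t) *ᵥ x) := by
    rw [← costMat, state_eq, Matrix.transpose_transpose, Matrix.mul_assoc, ← Matrix.mulVec_mulVec,
      ← Matrix.mulVec_mulVec, Matrix.dotProduct_mulVec x, ← Matrix.transpose_pow,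
      Matrix.vecMul_transpose]
  have hnn (t : ℕ) : 0 ≤
      x ⬝ᵥ (((S.closedLoop K)ᵀ ^ t * S.costMat K * (S.closedLoop K)ᵀᵀ ^ t) *ᵥ x) := by
    rw [← e, ← costMat]
    exact hquad (costMat_nonneg hQ hR K) _
  simp only [e]
  rw [← ENNReal.ofReal_tsum_of_nonneg hnn hsum.summable, hsum.tsum_eq]
  rfl

lemma stateCov_eq_lyap (h : IsInitialDistribution X₀ μ) (hK : K ∈ S.stabilizing) :
    S.stateCov X₀ K = lyap (S.closedLoop K) (secondMoment X₀) := by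
  have hs := (mem_stabilizing_iff.mp hK).summable_conj (secondMoment X₀)
  ext a b
  have e : (lyap (S.closedLoop K) (secondMoment X₀)) a b = ∑' t : ℕ,
      (S.closedLoop K ^ t * secondMoment X₀ * (S.closedLoop K)ᵀ ^ t) a b := by
    have h1 := Pi.hasSum.mp (Pi.hasSum.mp hs.hasSum a) b
    exact h1.tsum_eq.symm
  rw [e, stateCov, Matrix.of_apply]
  refine tsum_congr fun t => ?_
  simp only [state_eq]
  rw [h.integral_mulVec_mul_mulVec, Matrix.transpose_pow]

lemma cost_eq_trace_stateCov (h : IsInitialDistribution X₀ μ) (hQ : 0 ≤ S.Q) (hR : 0 ≤ S.R)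
    (hK : K ∈ S.stabilizing) : S.cost X₀ K = (S.costMat K * S.stateCov X₀ K).trace := by
  rw [cost_eq_trace_valueMat h hQ hR hK, stateCov_eq_lyap h hK, valueMat,
    (mem_stabilizing_iff.mp hK).transpose.trace_lyap_mul, Matrix.transpose_transpose]

lemma stateCov_eq (h : IsInitialDistribution X₀ μ) (hK : K ∈ S.stabilizing) :
    S.stateCov X₀ K =
      secondMoment X₀ + S.closedLoop K * S.stateCov X₀ K * (S.closedLoop K)ᵀ := by
  rw [stateCov_eq_lyap h hK]
  exact (mem_stabilizing_iff.mp hK).lyap_eq _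

lemma closedLoop_eq_sub (S : LQRSystem nx nu) (K K' : Gain nx nu) :
    S.closedLoop K' = S.closedLoop K - S.B * (K' - K).toMat := by
  rw [closedLoop, closedLoop, Gain.toMat_sub, Matrix.mul_sub]
  abel

/-- Exact expansion of the cost around a gain. -/
lemma cost_sub_cost (h : IsInitialDistribution X₀ μ) (hQ : 0 ≤ S.Q) (hR : 0 ≤ S.R)
    (hK : K ∈ S.stabilizing) (hK' : K' ∈ S.stabilizing) :
    S.cost X₀ K' - S.cost X₀ K =
      (((K' - K).toMatᵀ * S.gradFactor K + (S.gradFactor K)ᵀ * (K' - K).toMat +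
        (K' - K).toMatᵀ * S.curvMat K * (K' - K).toMat) * S.stateCov X₀ K').trace := by
  have hPt := transpose_of_nonneg (valueMat_nonneg hQ hR hK)
  have hRt := transpose_of_nonneg hR
  have hPe := valueMat_eq hK
  -- Eliminating the second moment through the equation of Σ_{K'} turns both costs into traces
  -- against the same matrix Σ_{K'}; what remains is an algebraic identity in K' - K.
  have hSe : secondMoment X₀ = S.stateCov X₀ K' -
      S.closedLoop K' * S.stateCov X₀ K' * (S.closedLoop K')ᵀ :=
    eq_sub_of_add_eq (stateCov_eq h hK').symm
  rw [cost_eq_trace_stateCov h hQ hR hK', cost_eq_trace_valueMat h hQ hR hK, hSe]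
  set P := S.valueMat K with hP
  set V := S.stateCov X₀ K'
  have e1 : (P * (V - S.closedLoop K' * V * (S.closedLoop K')ᵀ)).trace =
      ((P - (S.closedLoop K')ᵀ * P * S.closedLoop K') * V).trace := by
    rw [Matrix.mul_sub, Matrix.sub_mul, Matrix.trace_sub, Matrix.trace_sub, ← Matrix.mul_assoc,
      Matrix.trace_mul_comm _ (S.closedLoop K')ᵀ]
    simp only [Matrix.mul_assoc]
  rw [e1, ← Matrix.trace_sub, ← Matrix.sub_mul]
  congr 2
  have hW : S.costMat K = P - (S.closedLoop K)ᵀ * P * S.closedLoop K :=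
    eq_sub_of_add_eq hPe.symm
  have hQe : S.Q = P - (S.closedLoop K)ᵀ * P * S.closedLoop K - K.toMatᵀ * S.R * K.toMat := by
    rw [← hW, costMat]; abel
  have hK2 : K'.toMat = K.toMat + (K' - K).toMat := by rw [Gain.toMat_sub]; abel
  rw [costMat, hQe, gradFactor, curvMat, closedLoop_eq_sub S K K', hK2, ← hP]
  generalize (K' - K).toMat = D
  simp only [Matrix.transpose_add, Matrix.transpose_sub, Matrix.transpose_mul,
    Matrix.transpose_transpose, hRt, hPt, Matrix.mul_add, Matrix.mul_sub, Matrix.add_mul,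
    Matrix.sub_mul, Matrix.mul_assoc]
  abel

/-- Measurability is needed at every gain, not only at stabilizing ones: off the good event the
algorithm may evaluate the cost anywhere. -/
lemma measurable_eCost [SFinite X₀] (S : LQRSystem nx nu) : Measurable (S.eCost X₀) := by
  have hst (t : ℕ) : Continuous fun p : Gain nx nu × (Fin nx → ℝ) => S.state p.1 p.2 t := by
    have hm : Continuous fun p : Gain nx nu × (Fin nx → ℝ) => p.1.toMat :=
      continuous_matrix fun i j => by
        have : Continuous fun K : Gain nx nu => K (i, j) := by fun_prop
        exact this.comp continuous_fst
    induction t with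
    | zero => exact continuous_snd
    | succ t ih =>
      exact (continuous_const.matrix_mulVec ih).add
        (continuous_const.matrix_mulVec (hm.matrix_mulVec ih).neg)
  have hm : Continuous fun p : Gain nx nu × (Fin nx → ℝ) => p.1.toMat :=
    continuous_matrix fun i j => by
      have : Continuous fun K : Gain nx nu => K (i, j) := by fun_prop
      exact this.comp continuous_fst
  refine Measurable.lintegral_prod_right' (f := fun p : Gain nx nu × (Fin nx → ℝ) =>
    ∑' t, ENNReal.ofReal (S.state p.1 p.2 t ⬝ᵥ
      ((S.Q + p.1.toMatᵀ * S.R * p.1.toMat) *ᵥ S.state p.1 p.2 t))) ?_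
  refine Measurable.tsum fun t => ENNReal.measurable_ofReal.comp (Continuous.measurable ?_)
  refine (hst t).dotProduct (Continuous.matrix_mulVec ?_ (hst t))
  exact continuous_const.add ((hm.matrix_transpose.matrix_mul continuous_const).matrix_mul hm)

lemma measurable_cost [SFinite X₀] (S : LQRSystem nx nu) : Measurable (S.cost X₀) :=
  (measurable_eCost S).ennreal_toReal

end LQRSystem

end AsyncLQR

namespace AsyncLQR

open scoped MatrixOrder

variable {nx nu : ℕ}

namespace LQRSystem

/-- Quantitative assumptions on a system and an initial distribution. -/
structure Params (κ : ℝ) (S : LQRSystem nx nu) (X₀ : Measure (Fin nx → ℝ)) : Prop where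
  pos : 0 < κ
  norm_A : ‖S.A‖ ≤ κ
  norm_B : ‖S.B‖ ≤ κ
  norm_Q : ‖S.Q‖ ≤ κ
  norm_R : ‖S.R‖ ≤ κ
  Q_ge : κ⁻¹ • (1 : Matrix (Fin nx) (Fin nx) ℝ) ≤ S.Q
  R_ge : κ⁻¹ • (1 : Matrix (Fin nu) (Fin nu) ℝ) ≤ S.R
  cov_ge : κ⁻¹ • (1 : Matrix (Fin nx) (Fin nx) ℝ) ≤ secondMoment X₀
  init : ∃ μ, IsInitialDistribution X₀ μ

/-- A stabilizing gain all of whose associated matrices are bounded by `β`. -/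
structure Bdd (β : ℝ) (S : LQRSystem nx nu) (X₀ : Measure (Fin nx → ℝ)) (K : Gain nx nu) :
    Prop where
  norm_A : ‖S.A‖ ≤ β
  norm_B : ‖S.B‖ ≤ β
  norm_Q : ‖S.Q‖ ≤ β
  norm_R : ‖S.R‖ ≤ β
  norm_K : ‖K.toMat‖ ≤ β
  norm_value : ‖S.valueMat K‖ ≤ β
  norm_cov : ‖S.stateCov X₀ K‖ ≤ β
  trace_lyap : (lyap (S.closedLoop K) 1).trace ≤ β
  trace_lyap' : (lyap (S.closedLoop K)ᵀ 1).trace ≤ β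
  stab : K ∈ S.stabilizing
  Q_nonneg : 0 ≤ S.Q
  R_nonneg : 0 ≤ S.R
  init : ∃ μ, IsInitialDistribution X₀ μ

lemma zero_le_one_matrix {n : ℕ} : (0 : Matrix (Fin n) (Fin n) ℝ) ≤ 1 :=
  Matrix.nonneg_iff_posSemidef.mpr Matrix.PosSemidef.one

lemma smul_one_mul_trace {n : ℕ} (c : ℝ) (X : Matrix (Fin n) (Fin n) ℝ) :
    ((c • (1 : Matrix (Fin n) (Fin n) ℝ)) * X).trace = c * X.trace := by
  rw [Matrix.smul_mul, Matrix.one_mul, Matrix.trace_smul, smul_eq_mul]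

/-! ### A bound on the cost controls all matrices, also at nearby gains. -/

section Bounds

variable {κ : ℝ} {S : LQRSystem nx nu} {X₀ : Measure (Fin nx → ℝ)} {K : Gain nx nu}

lemma Params.Q_nonneg (h : Params κ S X₀) : 0 ≤ S.Q :=
  (smul_nonneg (inv_nonneg.mpr h.pos.le) zero_le_one_matrix).trans h.Q_ge

lemma Params.R_nonneg (h : Params κ S X₀) : 0 ≤ S.R :=
  (smul_nonneg (inv_nonneg.mpr h.pos.le) zero_le_one_matrix).trans h.R_ge

lemma Params.cov_nonneg (h : Params κ S X₀) : 0 ≤ secondMoment X₀ :=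
  (smul_nonneg (inv_nonneg.mpr h.pos.le) zero_le_one_matrix).trans h.cov_ge

lemma Params.cov_le_stateCov (h : Params κ S X₀) (hK : K ∈ S.stabilizing) :
    secondMoment X₀ ≤ S.stateCov X₀ K := by
  obtain ⟨μ, hμ⟩ := h.init
  rw [stateCov_eq_lyap hμ hK]
  exact (mem_stabilizing_iff.mp hK).le_lyap h.cov_nonneg

lemma Params.stateCov_nonneg (h : Params κ S X₀) (hK : K ∈ S.stabilizing) :
    0 ≤ S.stateCov X₀ K := h.cov_nonneg.trans (h.cov_le_stateCov hK)

lemma Params.trace_stateCov_le (h : Params κ S X₀) (hK : K ∈ S.stabilizing) :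
    (S.stateCov X₀ K).trace ≤ κ * S.cost X₀ K := by
  obtain ⟨μ, hμ⟩ := h.init
  have h1 := trace_mul_mono_left (h.Q_ge.trans (le_costMat h.R_nonneg K)) (h.stateCov_nonneg hK)
  rw [smul_one_mul_trace, ← cost_eq_trace_stateCov hμ h.Q_nonneg h.R_nonneg hK,
    inv_mul_le_iff₀ h.pos] at h1
  exact h1

lemma Params.trace_valueMat_le (h : Params κ S X₀) (hK : K ∈ S.stabilizing) :
    (S.valueMat K).trace ≤ κ * S.cost X₀ K := by
  obtain ⟨μ, hμ⟩ := h.init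
  have h1 := trace_mul_mono_left h.cov_ge (valueMat_nonneg h.Q_nonneg h.R_nonneg hK)
  rw [smul_one_mul_trace, Matrix.trace_mul_comm, ← cost_eq_trace_valueMat hμ h.Q_nonneg
    h.R_nonneg hK, inv_mul_le_iff₀ h.pos] at h1
  exact h1

lemma Params.trace_lyap_le (h : Params κ S X₀) (hK : K ∈ S.stabilizing) :
    (lyap (S.closedLoop K) 1).trace ≤ κ * (κ * S.cost X₀ K) := by
  obtain ⟨μ, hμ⟩ := h.init
  have hs := mem_stabilizing_iff.mp hK
  have h1 := trace_mono (hs.lyap_mono h.cov_ge)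
  rw [hs.lyap_smul, Matrix.trace_smul, smul_eq_mul, inv_mul_le_iff₀ h.pos,
    ← stateCov_eq_lyap hμ hK] at h1
  exact h1.trans (mul_le_mul_of_nonneg_left (h.trace_stateCov_le hK) h.pos.le)

lemma Params.trace_lyap_le' (h : Params κ S X₀) (hK : K ∈ S.stabilizing) :
    (lyap (S.closedLoop K)ᵀ 1).trace ≤ κ * (κ * S.cost X₀ K) := by
  have hs := (mem_stabilizing_iff.mp hK).transpose
  have h1 := trace_mono (hs.lyap_mono (h.Q_ge.trans (le_costMat h.R_nonneg K)))
  rw [hs.lyap_smul, Matrix.trace_smul, smul_eq_mul, inv_mul_le_iff₀ h.pos] at h1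
  exact h1.trans (mul_le_mul_of_nonneg_left (h.trace_valueMat_le hK) h.pos.le)

/-- The input part tr(KᵀRK Σ_K) of the cost dominates κ⁻² ‖K‖², by R ≥ κ⁻¹ and Σ_K ≥ Σ₀ ≥ κ⁻¹. -/
lemma Params.norm_sq_le (h : Params κ S X₀) (hK : K ∈ S.stabilizing) :
    ‖K‖ ^ 2 ≤ κ * (κ * S.cost X₀ K) := by
  obtain ⟨μ, hμ⟩ := h.init
  have h1 : κ⁻¹ • (K.toMatᵀ * K.toMat) ≤ S.costMat K := by
    have := conj_mono' h.R_ge K.toMat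
    rw [Matrix.mul_smul, Matrix.smul_mul, Matrix.mul_one] at this
    exact this.trans (le_add_of_nonneg_left h.Q_nonneg)
  have h2 := trace_mul_mono_left h1 (h.stateCov_nonneg hK)
  rw [← cost_eq_trace_stateCov hμ h.Q_nonneg h.R_nonneg hK, Matrix.smul_mul, Matrix.trace_smul,
    smul_eq_mul, inv_mul_le_iff₀ h.pos] at h2
  have h3 := trace_mul_mono_right (h.cov_ge.trans (h.cov_le_stateCov hK))
    (transpose_mul_self_nonneg K.toMat)
  rw [Matrix.trace_mul_comm, smul_one_mul_trace, ← Gain.norm_sq_eq, inv_mul_le_iff₀ h.pos] at h3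
  exact h3.trans (mul_le_mul_of_nonneg_left h2 h.pos.le)

lemma cost_nonneg (S : LQRSystem nx nu) (X₀ : Measure (Fin nx → ℝ)) (K : Gain nx nu) :
    0 ≤ S.cost X₀ K := ENNReal.toReal_nonneg

lemma exists_bdd (κ c : ℝ) : ∃ β, 0 < β ∧ ∀ (S : LQRSystem nx nu) (X₀ : Measure (Fin nx → ℝ))
    (K : Gain nx nu), Params κ S X₀ → K ∈ S.stabilizing → S.cost X₀ K ≤ c → Bdd β S X₀ K := by
  -- The sum of all bounds that occur; the 1 serves ‖K‖ ≤ 1 + ‖K‖². Absolute values make it positive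
  -- before the signs of κ and c are known.
  refine ⟨1 + |κ| + |κ| * |c| + |κ| * (|κ| * |c|), by positivity, fun S X₀ K h hK hc => ?_⟩
  have hκ := h.pos
  have hc0 := (cost_nonneg S X₀ K).trans hc
  rw [abs_of_pos hκ, abs_of_nonneg hc0]
  have e1 : κ * S.cost X₀ K ≤ κ * c := mul_le_mul_of_nonneg_left hc hκ.le
  have e2 : κ * (κ * S.cost X₀ K) ≤ κ * (κ * c) := mul_le_mul_of_nonneg_left e1 hκ.le
  have p1 : 0 ≤ κ * c := by positivity
  have p2 : 0 ≤ κ * (κ * c) := by positivity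
  have hP := norm_le_trace (valueMat_nonneg h.Q_nonneg h.R_nonneg hK)
  have hV := norm_le_trace (h.stateCov_nonneg hK)
  have hK2 := h.norm_sq_le hK
  have hK1 := Gain.norm_toMat_le K
  exact
    { norm_A := by linarith [h.norm_A]
      norm_B := by linarith [h.norm_B]
      norm_Q := by linarith [h.norm_Q]
      norm_R := by linarith [h.norm_R]
      norm_K := by nlinarith [sq_nonneg (‖K‖ - 1)]
      norm_value := by linarith [h.trace_valueMat_le hK]
      norm_cov := by linarith [h.trace_stateCov_le hK]
      trace_lyap := by linarith [h.trace_lyap_le hK]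
      trace_lyap' := by linarith [h.trace_lyap_le' hK]
      stab := hK
      Q_nonneg := h.Q_nonneg
      R_nonneg := h.R_nonneg
      init := h.init }

lemma norm_mul_mul_le {a b c d : ℕ} (X : Matrix (Fin a) (Fin b) ℝ) (Y : Matrix (Fin b) (Fin c) ℝ)
    (Z : Matrix (Fin c) (Fin d) ℝ) : ‖X * Y * Z‖ ≤ ‖X‖ * ‖Y‖ * ‖Z‖ :=
  (Matrix.l2_opNorm_mul _ _).trans (by gcongr; exact Matrix.l2_opNorm_mul _ _)

/-- Gains close to a stabilizing gain with bounded cost are stabilizing with bounded cost. -/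
lemma exists_nbhd (κ c : ℝ) (hκ : 0 < κ) : ∃ δ c', 0 < δ ∧ ∀ (S : LQRSystem nx nu)
    (X₀ : Measure (Fin nx → ℝ)) (K K' : Gain nx nu), Params κ S X₀ → K ∈ S.stabilizing →
    S.cost X₀ K ≤ c → ‖K' - K‖ ≤ δ → K' ∈ S.stabilizing ∧ S.cost X₀ K' ≤ c' := by
  obtain ⟨β, hβ, hbdd⟩ := exists_bdd (nx := nx) (nu := nu) κ c
  let m := β + β * (β + 1)
  have hm : 0 < m := by positivity
  -- The radius keeps ‖K'‖ ≤ β + 1 and makes (A - BK)ᵀP(A - BK) move by at most (2κ)⁻¹, half of the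
  -- margin κ⁻¹ that Q provides; `m` bounds both closed loops.
  refine ⟨min 1 ((2 * κ)⁻¹ / (2 * (β * β * m))), 2 * κ * (β + (β + 1) * β * (β + 1)) * c,
    by positivity, fun S X₀ K K' h hK hc hd => ?_⟩
  have hb := hbdd S X₀ K h hK hc
  have hd1 := hd.trans (min_le_left _ _)
  have hd2 := hd.trans (min_le_right _ _)
  rw [le_div_iff₀ (by positivity)] at hd2
  have hD := Gain.norm_toMat_le (K' - K)
  have hK' : ‖K'.toMat‖ ≤ β + 1 := by
    have : K'.toMat = K.toMat + (K' - K).toMat := by rw [Gain.toMat_sub]; abel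
    rw [this]
    exact (norm_add_le _ _).trans (add_le_add hb.norm_K (hD.trans hd1))
  have hM (L : Gain nx nu) (hL : ‖L.toMat‖ ≤ β + 1) : ‖S.closedLoop L‖ ≤ m := by
    refine (norm_sub_le _ _).trans (add_le_add hb.norm_A ((Matrix.l2_opNorm_mul _ _).trans ?_))
    exact mul_le_mul hb.norm_B hL (norm_nonneg _) hβ.le
  have hM1 := hM K (hb.norm_K.trans (by linarith))
  have hM2 := hM K' hK'
  have hBD : ‖S.B * (K' - K).toMat‖ ≤ β * ‖K' - K‖ :=
    (Matrix.l2_opNorm_mul _ _).trans (mul_le_mul hb.norm_B hD (norm_nonneg _) hβ.le)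
  set P := S.valueMat K with hP
  have hP0 : 0 ≤ P := valueMat_nonneg h.Q_nonneg h.R_nonneg hK
  have hdiff : (S.closedLoop K')ᵀ * P * S.closedLoop K' - (S.closedLoop K)ᵀ * P * S.closedLoop K
      ≤ (2 * κ)⁻¹ • 1 := by
    have e : (S.closedLoop K')ᵀ * P * S.closedLoop K' - (S.closedLoop K)ᵀ * P * S.closedLoop K =
        -((S.B * (K' - K).toMat)ᵀ * P * S.closedLoop K') -
          (S.closedLoop K)ᵀ * P * (S.B * (K' - K).toMat) := by
      rw [closedLoop_eq_sub S K K']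
      generalize S.B * (K' - K).toMat = Z
      simp only [Matrix.transpose_sub, Matrix.sub_mul, Matrix.mul_sub]
      abel
    have ht : ((S.closedLoop K')ᵀ * P * S.closedLoop K' -
        (S.closedLoop K)ᵀ * P * S.closedLoop K)ᵀ =
        (S.closedLoop K')ᵀ * P * S.closedLoop K' - (S.closedLoop K)ᵀ * P * S.closedLoop K := by
      simp only [Matrix.transpose_sub, Matrix.transpose_mul, Matrix.transpose_transpose,
        transpose_of_nonneg hP0, Matrix.mul_assoc]
    refine (le_norm_smul_one ht).trans (smul_le_smul_of_nonneg_right ?_ zero_le_one_matrix)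
    rw [e]
    have n1 := norm_mul_mul_le (S.B * (K' - K).toMat)ᵀ P (S.closedLoop K')
    have n2 := norm_mul_mul_le (S.closedLoop K)ᵀ P (S.B * (K' - K).toMat)
    rw [norm_transpose] at n1 n2
    have b1 : ‖S.B * (K' - K).toMat‖ * ‖P‖ * ‖S.closedLoop K'‖ ≤ (β * ‖K' - K‖) * β * m := by
      gcongr
      exact hb.norm_value
    have b2 : ‖S.closedLoop K‖ * ‖P‖ * ‖S.B * (K' - K).toMat‖ ≤ m * β * (β * ‖K' - K‖) := by
      gcongr
      exact hb.norm_value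
    have n3 := norm_sub_le (-((S.B * (K' - K).toMat)ᵀ * P * S.closedLoop K'))
      ((S.closedLoop K)ᵀ * P * (S.B * (K' - K).toMat))
    rw [norm_neg] at n3
    linarith
  -- P_K is still a Lyapunov function for K', with the other half of the margin. This gives
  -- stability, and P_{K'} ≤ w `lyap` 1 ≤ 2κ w P_K with w the bound on ‖Q + K'ᵀRK'‖.
  have hlyap : (S.closedLoop K')ᵀ * P * S.closedLoop K' + (2 * κ)⁻¹ • 1 ≤ P := by
    have e1 : (2 * κ)⁻¹ • (1 : Matrix (Fin nx) (Fin nx) ℝ) + (2 * κ)⁻¹ • 1 ≤ S.costMat K := by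
      rw [← add_smul]
      convert! h.Q_ge.trans (le_costMat h.R_nonneg K) using 2
      field_simp
      norm_num
    calc _ ≤ ((S.closedLoop K)ᵀ * P * S.closedLoop K + (2 * κ)⁻¹ • 1) + (2 * κ)⁻¹ • 1 := by
          gcongr
          exact sub_le_iff_le_add'.mp hdiff
      _ ≤ (S.closedLoop K)ᵀ * P * S.closedLoop K + S.costMat K := by
          rw [add_assoc]
          gcongr
      _ = P := by rw [add_comm]; exact (valueMat_eq hK).symm
  have hs : PowerSummable (S.closedLoop K') := powerSummable_of_lyapunov (by positivity) hP0 hlyap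
  have hstab : K' ∈ S.stabilizing := mem_stabilizing_iff.mpr hs
  refine ⟨hstab, ?_⟩
  obtain ⟨μ, hμ⟩ := h.init
  have hW : ‖S.costMat K'‖ ≤ β + (β + 1) * β * (β + 1) := by
    refine (norm_add_le _ _).trans (add_le_add hb.norm_Q ((norm_mul_mul_le _ _ _).trans ?_))
    rw [norm_transpose]
    gcongr
    exact hb.norm_R
  have hWt := transpose_of_nonneg (costMat_nonneg h.Q_nonneg h.R_nonneg K')
  have hlp := hs.smul_lyap_one_le hlyap
  have hP' : S.valueMat K' ≤ (β + (β + 1) * β * (β + 1)) • lyap (S.closedLoop K')ᵀ 1 := by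
    rw [← hs.transpose.lyap_smul]
    refine hs.transpose.lyap_mono ((le_norm_smul_one hWt).trans ?_)
    exact smul_le_smul_of_nonneg_right hW zero_le_one_matrix
  have t1 := trace_mul_mono_left hP' h.cov_nonneg
  have t2 := trace_mul_mono_left hlp h.cov_nonneg
  rw [← cost_eq_trace_valueMat hμ h.Q_nonneg h.R_nonneg hstab, Matrix.smul_mul, Matrix.trace_smul,
    smul_eq_mul] at t1
  rw [hP, ← cost_eq_trace_valueMat hμ h.Q_nonneg h.R_nonneg hK, Matrix.smul_mul,
    Matrix.trace_smul, smul_eq_mul, inv_mul_le_iff₀ (by positivity)] at t2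
  calc _ ≤ _ := t1
    _ ≤ (β + (β + 1) * β * (β + 1)) * (2 * κ * c) := by
      gcongr
      exact t2.trans (by gcongr)
    _ = _ := by ring

end Bounds

/-! ### A perturbation calculus in gains and systems simultaneously. -/

section Lipschitz

/-- Two families of matrices are uniformly bounded, and their distance is at most a multiple
of `d`. -/
def UnifClose {ι : Type*} (d : ι → ℝ) {m n : ℕ} (X Y : ι → Matrix (Fin m) (Fin n) ℝ) : Prop :=
  ∃ p, 0 ≤ p ∧ ∀ i, ‖X i‖ ≤ p ∧ ‖Y i‖ ≤ p ∧ ‖X i - Y i‖ ≤ p * d i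

variable {ι : Type*} {d : ι → ℝ} {m n k : ℕ}

lemma UnifClose.add {X Y X' Y' : ι → Matrix (Fin m) (Fin n) ℝ} (h : UnifClose d X Y)
    (h' : UnifClose d X' Y') : UnifClose d (fun i => X i + X' i) (fun i => Y i + Y' i) := by
  obtain ⟨p, hp, h⟩ := h
  obtain ⟨q, hq, h'⟩ := h'
  refine ⟨p + q, by positivity, fun i => ?_⟩
  obtain ⟨h1, h2, h3⟩ := h i
  obtain ⟨h1', h2', h3'⟩ := h' i
  refine ⟨(norm_add_le _ _).trans (add_le_add h1 h1'),
    (norm_add_le _ _).trans (add_le_add h2 h2'), ?_⟩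
  rw [add_sub_add_comm, add_mul]
  exact (norm_add_le _ _).trans (add_le_add h3 h3')

lemma UnifClose.neg {X Y : ι → Matrix (Fin m) (Fin n) ℝ} (h : UnifClose d X Y) :
    UnifClose d (fun i => -X i) (fun i => -Y i) := by
  obtain ⟨p, hp, h⟩ := h
  refine ⟨p, hp, fun i => ?_⟩
  rw [← neg_sub', norm_neg, norm_neg, norm_neg]
  exact h i

lemma UnifClose.sub {X Y X' Y' : ι → Matrix (Fin m) (Fin n) ℝ} (h : UnifClose d X Y)
    (h' : UnifClose d X' Y') : UnifClose d (fun i => X i - X' i) (fun i => Y i - Y' i) := by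
  simpa only [sub_eq_add_neg] using h.add h'.neg

lemma UnifClose.transpose {X Y : ι → Matrix (Fin m) (Fin n) ℝ} (h : UnifClose d X Y) :
    UnifClose d (fun i => (X i)ᵀ) (fun i => (Y i)ᵀ) := by
  obtain ⟨p, hp, h⟩ := h
  refine ⟨p, hp, fun i => ?_⟩
  rw [← Matrix.transpose_sub, norm_transpose, norm_transpose, norm_transpose]
  exact h i

lemma UnifClose.mul {X Y : ι → Matrix (Fin m) (Fin n) ℝ} {X' Y' : ι → Matrix (Fin n) (Fin k) ℝ}
    (h : UnifClose d X Y) (h' : UnifClose d X' Y') :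
    UnifClose d (fun i => X i * X' i) (fun i => Y i * Y' i) := by
  obtain ⟨p, hp, h⟩ := h
  obtain ⟨q, hq, h'⟩ := h'
  refine ⟨2 * (p * q), by positivity, fun i => ?_⟩
  obtain ⟨h1, h2, h3⟩ := h i
  obtain ⟨h1', h2', h3'⟩ := h' i
  have hpq : p * q ≤ 2 * (p * q) := by nlinarith [mul_nonneg hp hq]
  refine ⟨((Matrix.l2_opNorm_mul _ _).trans (mul_le_mul h1 h1' (norm_nonneg _) hp)).trans hpq,
    ((Matrix.l2_opNorm_mul _ _).trans (mul_le_mul h2 h2' (norm_nonneg _) hp)).trans hpq, ?_⟩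
  have e : X i * X' i - Y i * Y' i = (X i - Y i) * X' i + Y i * (X' i - Y' i) := by
    rw [Matrix.sub_mul, Matrix.mul_sub]; abel
  rw [e]
  calc _ ≤ ‖X i - Y i‖ * ‖X' i‖ + ‖Y i‖ * ‖X' i - Y' i‖ :=
        (norm_add_le _ _).trans (add_le_add (Matrix.l2_opNorm_mul _ _) (Matrix.l2_opNorm_mul _ _))
    _ ≤ (p * d i) * q + p * (q * d i) :=
        add_le_add (mul_le_mul h3 h1' (norm_nonneg _) ((norm_nonneg _).trans h3))
          (mul_le_mul h2 h3' (norm_nonneg _) hp)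
    _ = _ := by ring

lemma UnifClose.self (hd : ∀ i, 0 ≤ d i) {X : ι → Matrix (Fin m) (Fin n) ℝ} {b : ℝ} (hb : 0 ≤ b)
    (h : ∀ i, ‖X i‖ ≤ b) : UnifClose d X X :=
  ⟨b, hb, fun i => ⟨h i, h i, by simpa using mul_nonneg hb (hd i)⟩⟩

/-- The difference X - Y of the two solutions solves the equation of M with source V - W + MYMᵀ -
NYNᵀ. The product rule makes this source of order d, and `norm_lyap_le` inverts the equation at the
cost of 3b. -/
lemma UnifClose.lyap (hd : ∀ i, 0 ≤ d i) {M N V W : ι → Matrix (Fin n) (Fin n) ℝ} {b : ℝ}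
    (hb : 0 ≤ b) (hM : ∀ i, PowerSummable (M i)) (hN : ∀ i, PowerSummable (N i))
    (hV : ∀ i, (V i)ᵀ = V i) (hW : ∀ i, (W i)ᵀ = W i) (hMb : ∀ i, (lyap (M i) 1).trace ≤ b)
    (h1 : ∀ i, ‖lyap (M i) (V i)‖ ≤ b) (h2 : ∀ i, ‖lyap (N i) (W i)‖ ≤ b)
    (hMN : UnifClose d M N) (hVW : UnifClose d V W) :
    UnifClose d (fun i => lyap (M i) (V i)) (fun i => lyap (N i) (W i)) := by
  obtain ⟨p, hp, h⟩ := hVW.add ((hMN.mul (.self hd hb h2)).mul hMN.transpose)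
  refine ⟨b + 3 * b * p, by positivity, fun i => ?_⟩
  have hbp : 0 ≤ 3 * b * p := by positivity
  refine ⟨(h1 i).trans (by linarith), (h2 i).trans (by linarith), ?_⟩
  set X := AsyncLQR.lyap (M i) (V i) with hX
  set Y := AsyncLQR.lyap (N i) (W i) with hY
  have hXe : X = V i + M i * X * (M i)ᵀ := (hM i).lyap_eq _
  have hYe : Y = W i + N i * Y * (N i)ᵀ := (hN i).lyap_eq _
  have hYt : Yᵀ = Y := (hN i).lyap_transpose (hW i)
  have hD : X - Y = AsyncLQR.lyap (M i)
      (V i + M i * Y * (M i)ᵀ - (W i + N i * Y * (N i)ᵀ)) := by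
    apply (hM i).lyap_unique
    rw [← hYe, Matrix.mul_sub, Matrix.sub_mul]
    nth_rewrite 1 [hXe]
    abel
  rw [hD]
  refine ((hM i).norm_lyap_le ?_).trans ?_
  · simp only [Matrix.transpose_sub, Matrix.transpose_add, Matrix.transpose_mul,
      Matrix.transpose_transpose, hYt, hV i, hW i, Matrix.mul_assoc]
  · calc _ ≤ 3 * b * (p * d i) := by
          refine mul_le_mul (by linarith [hMb i]) (h i).2.2 (norm_nonneg _) (by positivity)
      _ ≤ _ := by nlinarith [mul_nonneg hb (hd i)]

/-- Two systems with gains, all bounded by `β`, at distance at most `d`. -/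
structure BddPair (nx nu : ℕ) (β : ℝ) where
  /-- first system -/
  S : LQRSystem nx nu
  /-- second system -/
  T : LQRSystem nx nu
  /-- first gain -/
  K : Gain nx nu
  /-- second gain -/
  L : Gain nx nu
  /-- initial distribution -/
  X₀ : Measure (Fin nx → ℝ)
  /-- distance -/
  d : ℝ
  bdd₁ : Bdd β S X₀ K
  bdd₂ : Bdd β T X₀ L
  A : ‖S.A - T.A‖ ≤ d
  B : ‖S.B - T.B‖ ≤ d
  Q : ‖S.Q - T.Q‖ ≤ d
  R : ‖S.R - T.R‖ ≤ d
  gain : ‖K - L‖ ≤ d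

variable (nx nu)

/-- Indexing by all bounded pairs makes the resulting constants depend on the dimensions and β only.
Pairs with one system give Lipschitz continuity in the gain, pairs with one gain give heterogeneity.
-/
lemma exists_unifClose (β : ℝ) (hβ : 0 < β) :
    UnifClose (fun i : BddPair nx nu β => i.d) (fun i => i.S.gradFactor i.K)
      (fun i => i.T.gradFactor i.L) ∧
    UnifClose (fun i : BddPair nx nu β => i.d) (fun i => i.S.stateCov i.X₀ i.K)
      (fun i => i.T.stateCov i.X₀ i.L) ∧
    UnifClose (fun i : BddPair nx nu β => i.d) (fun i => i.S.curvMat i.K)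
      (fun i => i.T.curvMat i.L) := by
  have hd (i : BddPair nx nu β) : 0 ≤ i.d := (norm_nonneg _).trans i.A
  have base {m n : ℕ} {X Y : BddPair nx nu β → Matrix (Fin m) (Fin n) ℝ}
      (h1 : ∀ i, ‖X i‖ ≤ β) (h2 : ∀ i, ‖Y i‖ ≤ β) (h3 : ∀ i, ‖X i - Y i‖ ≤ i.d) :
      UnifClose (fun i : BddPair nx nu β => i.d) X Y := by
    refine ⟨β + 1, by positivity, fun i => ⟨(h1 i).trans (by linarith), (h2 i).trans (by linarith),
      (h3 i).trans ?_⟩⟩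
    nlinarith [hd i]
  have hA := base (fun i => i.bdd₁.norm_A) (fun i => i.bdd₂.norm_A) (fun i => i.A)
  have hB := base (fun i => i.bdd₁.norm_B) (fun i => i.bdd₂.norm_B) (fun i => i.B)
  have hQ := base (fun i => i.bdd₁.norm_Q) (fun i => i.bdd₂.norm_Q) (fun i => i.Q)
  have hR := base (fun i => i.bdd₁.norm_R) (fun i => i.bdd₂.norm_R) (fun i => i.R)
  have hK := base (fun i => i.bdd₁.norm_K) (fun i => i.bdd₂.norm_K)
    (fun i => (Gain.norm_toMat_le (i.K - i.L)).trans i.gain)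
  have hM : UnifClose (fun i : BddPair nx nu β => i.d) (fun i => i.S.closedLoop i.K)
      (fun i => i.T.closedLoop i.L) := hA.sub (hB.mul hK)
  have hW : UnifClose (fun i : BddPair nx nu β => i.d) (fun i => i.S.costMat i.K)
      (fun i => i.T.costMat i.L) := hQ.add ((hK.transpose.mul hR).mul hK)
  have hP : UnifClose (fun i : BddPair nx nu β => i.d) (fun i => i.S.valueMat i.K)
      (fun i => i.T.valueMat i.L) :=
    UnifClose.lyap hd hβ.le (fun i => (mem_stabilizing_iff.mp i.bdd₁.stab).transpose)
      (fun i => (mem_stabilizing_iff.mp i.bdd₂.stab).transpose)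
      (fun i => transpose_of_nonneg (costMat_nonneg i.bdd₁.Q_nonneg i.bdd₁.R_nonneg _))
      (fun i => transpose_of_nonneg (costMat_nonneg i.bdd₂.Q_nonneg i.bdd₂.R_nonneg _))
      (fun i => i.bdd₁.trace_lyap') (fun i => i.bdd₁.norm_value) (fun i => i.bdd₂.norm_value)
      hM.transpose hW
  have hcov₁ (i : BddPair nx nu β) :
      i.S.stateCov i.X₀ i.K = AsyncLQR.lyap (i.S.closedLoop i.K) (secondMoment i.X₀) :=
    i.bdd₁.init.elim fun _ h => stateCov_eq_lyap h i.bdd₁.stab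
  have hcov₂ (i : BddPair nx nu β) :
      i.T.stateCov i.X₀ i.L = AsyncLQR.lyap (i.T.closedLoop i.L) (secondMoment i.X₀) :=
    i.bdd₁.init.elim fun _ h => stateCov_eq_lyap h i.bdd₂.stab
  -- `Bdd` does not bound the second moment; the bound is read off from Σ₀ = Σ_K - (A - BK) Σ_K (A -
  -- BK)ᵀ.
  have hsm : UnifClose (fun i : BddPair nx nu β => i.d) (fun i => secondMoment i.X₀)
      (fun i => secondMoment i.X₀) := by
    obtain ⟨p, hp, h⟩ := hM
    refine .self hd (b := β + p * β * p) (by positivity) fun i => ?_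
    obtain ⟨μ, hμ⟩ := i.bdd₁.init
    rw [eq_sub_of_add_eq (stateCov_eq hμ i.bdd₁.stab).symm]
    refine (norm_sub_le _ _).trans (add_le_add i.bdd₁.norm_cov ((norm_mul_mul_le _ _ _).trans ?_))
    rw [norm_transpose]
    have := (h i).1
    gcongr
    exact i.bdd₁.norm_cov
  have hV : UnifClose (fun i : BddPair nx nu β => i.d) (fun i => i.S.stateCov i.X₀ i.K)
      (fun i => i.T.stateCov i.X₀ i.L) := by
    have b1 (i : BddPair nx nu β) := i.bdd₁.norm_cov
    have b2 (i : BddPair nx nu β) := i.bdd₂.norm_cov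
    simp only [hcov₁, hcov₂] at b1 b2 ⊢
    exact UnifClose.lyap hd hβ.le (fun i => mem_stabilizing_iff.mp i.bdd₁.stab)
      (fun i => mem_stabilizing_iff.mp i.bdd₂.stab) (fun i => secondMoment_transpose _)
      (fun i => secondMoment_transpose _) (fun i => i.bdd₁.trace_lyap) b1 b2 hM hsm
  exact ⟨(hR.mul hK).sub ((hB.transpose.mul hP).mul hM), hV,
    hR.add ((hB.transpose.mul hP).mul hB)⟩

lemma exists_policyGrad_lipschitz (hx : 1 ≤ nx) (β : ℝ) (hβ : 0 < β) :
    ∃ L, 0 < L ∧ ∀ i : BddPair nx nu β, ‖i.S.policyGrad i.X₀ i.K‖ ≤ L ∧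
      ‖i.S.policyGrad i.X₀ i.K - i.T.policyGrad i.X₀ i.L‖ ≤ L * i.d := by
  obtain ⟨hE, hV, -⟩ := exists_unifClose nx nu β hβ
  obtain ⟨p, hp, h⟩ := hE.mul hV
  refine ⟨2 * (nx * p) + 1, by positivity, fun i => ?_⟩
  have hd : 0 ≤ i.d := (norm_nonneg _).trans i.A
  obtain ⟨h1, -, h3⟩ := h i
  constructor
  · rw [policyGrad, norm_smul, Real.norm_ofNat]
    have h4 := Gain.norm_le_of_toMat hx (Gain.ofMat (i.S.gradFactor i.K * i.S.stateCov i.X₀ i.K))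
    rw [Gain.toMat_ofMat] at h4
    nlinarith [mul_le_mul_of_nonneg_left h1 (Nat.cast_nonneg (α := ℝ) nx)]
  · rw [policyGrad, policyGrad, ← smul_sub, norm_smul, Real.norm_ofNat, ← Gain.ofMat_sub]
    have h4 := Gain.norm_le_of_toMat hx (Gain.ofMat (i.S.gradFactor i.K * i.S.stateCov i.X₀ i.K -
      i.T.gradFactor i.L * i.T.stateCov i.X₀ i.L))
    rw [Gain.toMat_ofMat] at h4
    nlinarith [mul_le_mul_of_nonneg_left h3 (Nat.cast_nonneg (α := ℝ) nx)]

/-- In the exact expansion the first order term carries Σ_{K'} instead of Σ_K; as Σ is Lipschitz in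
the gain, the exchange costs only a second order term. -/
lemma exists_cost_expansion (β : ℝ) (hβ : 0 < β) :
    ∃ L, 0 < L ∧ ∀ (S : LQRSystem nx nu) (X₀ : Measure (Fin nx → ℝ)) (K K' : Gain nx nu),
      Bdd β S X₀ K → Bdd β S X₀ K' →
      |S.cost X₀ K' - S.cost X₀ K - inner ℝ (S.policyGrad X₀ K) (K' - K)| ≤ L * ‖K' - K‖ ^ 2 := by
  obtain ⟨⟨p, hp, hE⟩, ⟨q, hq, hV⟩, ⟨s, hs, hG⟩⟩ := exists_unifClose nx nu β hβ
  refine ⟨2 * (nx * (p * q)) + nx * (s * q) + 1, by positivity, fun S X₀ K K' hK hK' => ?_⟩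
  obtain ⟨μ, hμ⟩ := hK.init
  let i : BddPair nx nu β := ⟨S, S, K', K, X₀, ‖K' - K‖, hK', hK, by simp, by simp, by simp,
    by simp, le_rfl⟩
  have hEi : ‖S.gradFactor K‖ ≤ p := (hE i).2.1
  have hVi : ‖S.stateCov X₀ K'‖ ≤ q := (hV i).1
  have hVd : ‖S.stateCov X₀ K' - S.stateCov X₀ K‖ ≤ q * ‖K' - K‖ := (hV i).2.2
  have hGi : ‖S.curvMat K‖ ≤ s := (hG i).2.1
  have hD := Gain.norm_toMat_le (K' - K)
  have hVt : (S.stateCov X₀ K')ᵀ = S.stateCov X₀ K' := by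
    rw [stateCov_eq_lyap hμ hK'.stab]
    exact (mem_stabilizing_iff.mp hK'.stab).lyap_transpose (secondMoment_transpose X₀)
  rw [cost_sub_cost hμ hK.Q_nonneg hK.R_nonneg hK.stab hK'.stab, policyGrad, real_inner_smul_left,
    real_inner_comm, Gain.inner_eq, Gain.toMat_ofMat]
  set D := (K' - K).toMat
  set E := S.gradFactor K
  set V := S.stateCov X₀ K
  set V' := S.stateCov X₀ K'
  have e1 : (Eᵀ * D * V').trace = (Dᵀ * E * V').trace := by
    rw [← Matrix.trace_transpose]
    simp only [Matrix.transpose_mul, Matrix.transpose_transpose, hVt]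
    rw [Matrix.trace_mul_comm]
  have e2 : ((Dᵀ * E + Eᵀ * D + Dᵀ * S.curvMat K * D) * V').trace - 2 * (Dᵀ * (E * V)).trace =
      2 * (Dᵀ * E * (V' - V)).trace + (Dᵀ * S.curvMat K * D * V').trace := by
    simp only [Matrix.add_mul, Matrix.trace_add, Matrix.mul_sub, Matrix.trace_sub, e1]
    rw [← Matrix.mul_assoc Dᵀ E V]
    ring
  rw [e2]
  have b1 : |(Dᵀ * E * (V' - V)).trace| ≤ nx * ((‖K' - K‖ * p) * (q * ‖K' - K‖)) := by
    refine (abs_trace_mul_le _ _).trans ?_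
    gcongr
    refine (Matrix.l2_opNorm_mul _ _).trans ?_
    rw [norm_transpose]
    gcongr
  have b2 : |(Dᵀ * S.curvMat K * D * V').trace| ≤ nx * ((‖K' - K‖ * s * ‖K' - K‖) * q) := by
    refine (abs_trace_mul_le _ _).trans ?_
    gcongr
    refine (norm_mul_mul_le _ _ _).trans ?_
    rw [norm_transpose]
    gcongr
  have b3 := abs_add_le (2 * (Dᵀ * E * (V' - V)).trace) (Dᵀ * S.curvMat K * D * V').trace
  rw [abs_mul, abs_two] at b3
  nlinarith [sq_nonneg ‖K' - K‖]

end Lipschitz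

/-! ### Gradient dominance and minimum singular values. -/

section GradientDominance

variable {nx nu : ℕ} {κ : ℝ} {S : LQRSystem nx nu} {X₀ : Measure (Fin nx → ℝ)}
  {K Kopt : Gain nx nu}

/-- Squaring is not operator monotone in general, but a scalar matrix commutes with everything: with
X = c + Y the square is c² + 2cY + Y². -/
lemma sq_smul_one_le_mul_self {n : ℕ} {X : Matrix (Fin n) (Fin n) ℝ} {c : ℝ} (hc : 0 ≤ c)
    (h : c • 1 ≤ X) : c ^ 2 • 1 ≤ X * X := by
  obtain ⟨Y, rfl⟩ : ∃ Y, X = c • 1 + Y := ⟨X - c • 1, by abel⟩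
  have hY : 0 ≤ Y := by simpa using h
  have hYY : 0 ≤ Y * Y := by
    have := transpose_mul_self_nonneg Y
    rwa [transpose_of_nonneg hY] at this
  have e : (c • (1 : Matrix (Fin n) (Fin n) ℝ) + Y) * (c • 1 + Y) =
      c ^ 2 • 1 + ((2 * c) • Y + Y * Y) := by
    simp only [Matrix.add_mul, Matrix.mul_add, Matrix.smul_mul, Matrix.mul_smul, Matrix.one_mul,
      Matrix.mul_one, smul_add, smul_smul, two_mul, add_smul, sq]
    abel
  rw [e]
  exact le_add_of_nonneg_right (add_nonneg (smul_nonneg (by positivity) hY) hYY)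

/-- Gradient dominance. -/
lemma Params.gradient_dominance (h : Params κ S X₀) {μ σ : ℝ} (hμ : 0 < μ) (hσ : 0 < σ)
    (hμX : μ • 1 ≤ secondMoment X₀) (hσR : σ • 1 ≤ S.R) (hK : K ∈ S.stabilizing)
    (hopt : Kopt ∈ S.stabilizing) :
    4 * μ ^ 2 * σ * (S.cost X₀ K - S.cost X₀ Kopt) ≤
      ‖S.stateCov X₀ Kopt‖ * ‖S.policyGrad X₀ K‖ ^ 2 := by
  obtain ⟨_, hinit⟩ := h.init
  have hgap := cost_sub_cost hinit h.Q_nonneg h.R_nonneg hK hopt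
  rw [policyGrad, norm_smul, mul_pow, Real.norm_ofNat, Gain.norm_sq_eq, Gain.toMat_ofMat]
  set D := (Kopt - K).toMat
  set E := S.gradFactor K
  set V := S.stateCov X₀ K with hV
  set V' := S.stateCov X₀ Kopt with hV'
  have hV0 : 0 ≤ V := h.stateCov_nonneg hK
  have hV'0 : 0 ≤ V' := h.stateCov_nonneg hopt
  have hcurv : σ • 1 ≤ S.curvMat K :=
    hσR.trans (le_add_of_nonneg_right
      (conj_nonneg' (valueMat_nonneg h.Q_nonneg h.R_nonneg hK) _))
  -- Completing the square with curvature at least σ: the bound no longer involves the displacement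
  -- D.
  have hsq : -(σ⁻¹ • (Eᵀ * E)) ≤ Dᵀ * E + Eᵀ * D + Dᵀ * S.curvMat K * D := by
    have h1 := conj_mono' hcurv D
    have h2 := smul_nonneg (inv_nonneg.mpr hσ.le) (transpose_mul_self_nonneg (σ • D + E))
    have e : σ⁻¹ • ((σ • D + E)ᵀ * (σ • D + E)) =
        Dᵀ * E + Eᵀ * D + Dᵀ * (σ • (1 : Matrix (Fin nu) (Fin nu) ℝ)) * D + σ⁻¹ • (Eᵀ * E) := by
      simp only [Matrix.transpose_add, Matrix.transpose_smul, Matrix.add_mul, Matrix.mul_add,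
        Matrix.smul_mul, Matrix.mul_smul, smul_add, smul_smul, Matrix.mul_one]
      rw [inv_mul_cancel₀ hσ.ne', inv_mul_cancel_left₀ hσ.ne', one_smul, one_smul]
      abel
    rw [e] at h2
    rw [neg_le_iff_add_nonneg]
    refine h2.trans ?_
    gcongr
  have t1 := trace_mul_mono_left hsq hV'0
  rw [← hgap, Matrix.neg_mul, Matrix.smul_mul, Matrix.trace_neg, Matrix.trace_smul,
    smul_eq_mul] at t1
  have t2 := trace_mul_mono_right (le_norm_smul_one (transpose_of_nonneg hV'0))
    (transpose_mul_self_nonneg E)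
  rw [Matrix.trace_mul_comm _ (‖V'‖ • 1), smul_one_mul_trace] at t2
  -- The gradient is 2EΣ_K, and ‖EΣ_K‖² = tr(Σ_K² EᵀE) ≥ μ² tr(EᵀE).
  have t3 := trace_mul_mono_left
    (sq_smul_one_le_mul_self hμ.le (hμX.trans (h.cov_le_stateCov hK)))
    (transpose_mul_self_nonneg E)
  rw [smul_one_mul_trace, ← hV] at t3
  have e3 : ((E * V)ᵀ * (E * V)).trace = (V * V * (Eᵀ * E)).trace := by
    rw [Matrix.transpose_mul, transpose_of_nonneg hV0, Matrix.mul_assoc V V,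
      Matrix.trace_mul_comm V (V * _)]
    simp only [Matrix.mul_assoc]
  rw [e3]
  have t4 : σ * (S.cost X₀ K - S.cost X₀ Kopt) ≤ ‖V'‖ * (Eᵀ * E).trace := by
    refine le_trans ?_ t2
    rw [← mul_le_mul_iff_right₀ (inv_pos.mpr hσ), inv_mul_cancel_left₀ hσ.ne']
    linarith
  calc _ = 4 * μ ^ 2 * (σ * (S.cost X₀ K - S.cost X₀ Kopt)) := by ring
    _ ≤ 4 * μ ^ 2 * (‖V'‖ * (Eᵀ * E).trace) := by gcongr
    _ = ‖V'‖ * (2 ^ 2 * (μ ^ 2 * (Eᵀ * E).trace)) := by ring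
    _ ≤ _ := by gcongr

end GradientDominance

end LQRSystem

/-- The minimum singular value of a positive definite matrix bounds it from below. -/
lemma sigmaMin_smul_one_le {n : ℕ} {T : Matrix (Fin n) (Fin n) ℝ} (hT : T.PosDef) :
    sigmaMin T • 1 ≤ T := by
  have hH := hT.isHermitian
  -- Test the infimum at a unit eigenvector; positive definiteness removes the absolute value of the
  -- eigenvalue.
  have key (i : Fin n) : sigmaMin T ≤ hH.eigenvalues i := by
    have hv : hH.eigenvectorBasis i ∈ Metric.sphere (0 : EuclideanSpace ℝ (Fin n)) 1 := by
      simp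
    refine (ciInf_le ⟨0, ?_⟩ ⟨_, hv⟩).trans ?_
    · rintro _ ⟨v, rfl⟩
      exact norm_nonneg _
    · have : Matrix.toEuclideanCLM (𝕜 := ℝ) T (hH.eigenvectorBasis i) =
          hH.eigenvalues i • hH.eigenvectorBasis i := by
        ext j
        have := congrFun (hH.mulVec_eigenvectorBasis i) j
        simpa [Matrix.ofLp_toEuclideanCLM] using this
      simp only [this, norm_smul]
      rw [Real.norm_of_nonneg (hT.eigenvalues_pos i).le]
      simp
  have hTt := transpose_of_nonneg (Matrix.nonneg_iff_posSemidef.mpr hT.posSemidef)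
  rw [le_iff_quadForm (by simp) hTt]
  intro x
  let y : EuclideanSpace ℝ (Fin n) := WithLp.toLp 2 x
  have e1 : x ⬝ᵥ (T *ᵥ x) = ∑ i, hH.eigenvalues i * inner ℝ (hH.eigenvectorBasis i) y ^ 2 := by
    have h1 : x ⬝ᵥ (T *ᵥ x) = inner ℝ y (Matrix.toEuclideanCLM (𝕜 := ℝ) T y) := by
      rw [Matrix.inner_toEuclideanCLM]
    rw [h1, ← hH.eigenvectorBasis.sum_inner_mul_inner]
    refine Finset.sum_congr rfl fun i _ => ?_
    have h2 : inner ℝ (hH.eigenvectorBasis i) (Matrix.toEuclideanCLM (𝕜 := ℝ) T y) =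
        hH.eigenvalues i * inner ℝ (hH.eigenvectorBasis i) y := by
      rw [Matrix.inner_toEuclideanCLM, Matrix.dotProduct_mulVec, ← Matrix.mulVec_transpose, hTt,
        hH.mulVec_eigenvectorBasis, smul_dotProduct, dotProduct_eq_inner, smul_eq_mul]
    rw [h2, real_inner_comm]
    ring
  have e2 : x ⬝ᵥ x = ∑ i, inner ℝ (hH.eigenvectorBasis i) y ^ 2 := by
    rw [dotProduct_eq_inner, ← hH.eigenvectorBasis.sum_inner_mul_inner]
    refine Finset.sum_congr rfl fun i _ => ?_
    rw [real_inner_comm, sq]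
  rw [Matrix.smul_mulVec, Matrix.one_mulVec, dotProduct_smul, e1, e2, smul_eq_mul, Finset.mul_sum]
  exact Finset.sum_le_sum fun i _ => mul_le_mul_of_nonneg_right (key i) (sq_nonneg _)

end AsyncLQR

namespace AsyncLQR

/-! ### Second moments of the uniform distribution on the sphere. -/

section Sphere

open scoped Pointwise

variable {nx nu : ℕ}

lemma uniformSphere_apply {B : Set (Gain nx nu)} (hB : MeasurableSet B) :
    uniformSphere nx nu B = ((volume : Measure (Gain nx nu)).toSphere Set.univ)⁻¹ *
      (Module.finrank ℝ (Gain nx nu) *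
        volume (Set.Ioo (0 : ℝ) 1 • (B ∩ Metric.sphere (0 : Gain nx nu) 1))) := by
  rw [uniformSphere, Measure.map_apply measurable_subtype_coe hB, Measure.smul_apply, smul_eq_mul,
    Measure.toSphere_apply' _ (measurable_subtype_coe hB), Subtype.image_preimage_coe,
    Set.inter_comm]

/-- Sphere measure is the volume of the cone over a set, and linear isometries preserve both cones
and volume. -/
lemma map_uniformSphere (e : Gain nx nu ≃ₗᵢ[ℝ] Gain nx nu) :
    (uniformSphere nx nu).map e = uniformSphere nx nu := by
  ext B hB
  have he : Measurable e := e.continuous.measurable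
  rw [Measure.map_apply he hB, uniformSphere_apply (he hB), uniformSphere_apply hB]
  congr 2
  rw [← e.measurePreserving.measure_preimage_equiv (f := e.toHomeomorph.toMeasurableEquiv)
    (Set.Ioo (0 : ℝ) 1 • (B ∩ Metric.sphere (0 : Gain nx nu) 1))]
  congr 1
  ext x
  simp only [Set.mem_smul, Set.mem_inter_iff, Set.mem_preimage, mem_sphere_zero_iff_norm]
  constructor
  · rintro ⟨t, ht, y, ⟨hy, hy1⟩, rfl⟩
    exact ⟨t, ht, e y, ⟨hy, by simpa using hy1⟩, (e.map_smul t y).symm⟩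
  · rintro ⟨t, ht, y, ⟨hy, hy1⟩, h⟩
    refine ⟨t, ht, e.symm y, ⟨by simpa using hy, by simpa using hy1⟩, ?_⟩
    apply e.injective
    rw [e.map_smul, e.apply_symm_apply]
    exact h

lemma ae_uniformSphere : ∀ᵐ x ∂uniformSphere nx nu, ‖x‖ = 1 := by
  rw [uniformSphere, ae_map_iff measurable_subtype_coe.aemeasurable
    (measurableSet_eq_fun measurable_norm measurable_const)]
  exact Filter.Eventually.of_forall fun x => by simp

variable [IsProbabilityMeasure (uniformSphere nx nu)]

lemma integrable_uniformSphere (a b : Fin nu × Fin nx) :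
    Integrable (fun x : Gain nx nu => x a * x b) (uniformSphere nx nu) := by
  refine Integrable.of_bound (C := 1) (by fun_prop) ?_
  filter_upwards [ae_uniformSphere] with x hx
  rw [norm_mul]
  have h1 := PiLp.norm_apply_le x a
  have h2 := PiLp.norm_apply_le x b
  rw [hx] at h1 h2
  exact mul_le_one₀ h1 (norm_nonneg _) h2

/-- Swapping coordinates shows that all diagonal moments agree, and they sum to 1; flipping the sign
of one coordinate kills the off-diagonal ones. -/
lemma integral_uniformSphere (a b : Fin nu × Fin nx) :
    ∫ x : Gain nx nu, x a * x b ∂uniformSphere nx nu =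
      if a = b then ((nx : ℝ) * nu)⁻¹ else 0 := by
  have hmap (e : Gain nx nu ≃ₗᵢ[ℝ] Gain nx nu) (a b : Fin nu × Fin nx) :
      ∫ x : Gain nx nu, e x a * e x b ∂uniformSphere nx nu =
        ∫ x : Gain nx nu, x a * x b ∂uniformSphere nx nu := by
    conv_rhs => rw [← map_uniformSphere e]
    rw [integral_map e.continuous.measurable.aemeasurable (by fun_prop)]
  split_ifs with hab
  · subst hab
    have hsq (c : Fin nu × Fin nx) : ∫ x : Gain nx nu, x c * x c ∂uniformSphere nx nu =
        ∫ x : Gain nx nu, x a * x a ∂uniformSphere nx nu := by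
      rw [← hmap (LinearIsometryEquiv.piLpCongrLeft 2 ℝ ℝ (Equiv.swap a c)) c c]
      simp [LinearIsometryEquiv.piLpCongrLeft_apply]
    have hsum : ∑ c, ∫ x : Gain nx nu, x c * x c ∂uniformSphere nx nu = 1 := by
      rw [← integral_finsetSum _ fun c _ => integrable_uniformSphere c c]
      rw [integral_congr_ae (g := fun _ => (1 : ℝ))]
      · simp
      · filter_upwards [ae_uniformSphere] with x hx
        have := EuclideanSpace.norm_sq_eq x
        rw [hx] at this
        simpa [sq] using this.symm
    simp only [hsq] at hsum
    rw [Finset.sum_const, Finset.card_univ, Fintype.card_prod, Fintype.card_fin, Fintype.card_fin,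
      nsmul_eq_mul, Nat.cast_mul, mul_comm (nu : ℝ)] at hsum
    exact eq_inv_of_mul_eq_one_right hsum
  · let e : Gain nx nu ≃ₗᵢ[ℝ] Gain nx nu := LinearIsometryEquiv.piLpCongrRight 2 fun i =>
      if i = a then LinearIsometryEquiv.neg ℝ else LinearIsometryEquiv.refl ℝ ℝ
    have h := hmap e a b
    have h1 (x : Gain nx nu) : e x a = -x a := by simp [e]
    have h2 (x : Gain nx nu) : e x b = x b := by simp [e, Ne.symm hab]
    simp only [h1, h2, neg_mul, integral_neg] at h
    linarith

end Sphere

end AsyncLQR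

namespace AsyncLQR

/-! ### A linear recursion perturbed by sliding window sums. -/

section Recursion

/-- Double counting: an index k lies only in the windows of n = k, …, k + w. -/
lemma sum_window_le {f : ℕ → ℝ} (hf : ∀ k, 0 ≤ f k) (w N : ℕ) :
    ∑ n ∈ Finset.range N, ∑ k ∈ Finset.Icc (n - w) n, f k ≤
      (w + 1) * ∑ k ∈ Finset.range N, f k := by
  have h : ∑ n ∈ Finset.range N, ∑ k ∈ Finset.Icc (n - w) n, f k =
      ∑ k ∈ Finset.range N,
        ∑ _n ∈ (Finset.range N).filter (fun n => k ∈ Finset.Icc (n - w) n), f k := by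
    refine Finset.sum_comm' fun n k => ?_
    simp only [Finset.mem_range, Finset.mem_Icc, Finset.mem_filter]
    omega
  rw [h, Finset.mul_sum]
  refine Finset.sum_le_sum fun k _ => ?_
  rw [Finset.sum_const, nsmul_eq_mul]
  refine mul_le_mul_of_nonneg_right ?_ (hf k)
  have hsub : (Finset.range N).filter (fun n => k ∈ Finset.Icc (n - w) n) ⊆
      Finset.Icc k (k + w) := by
    intro n
    simp only [Finset.mem_range, Finset.mem_Icc, Finset.mem_filter]
    omega
  have := Finset.card_le_card hsub
  rw [Nat.card_Icc] at this
  have h2 : ((Finset.range N).filter (fun n => k ∈ Finset.Icc (n - w) n)).card ≤ w + 1 := by omega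
  exact_mod_cast h2

/-- Linear convergence of a recursion whose perturbation is a sliding window sum that is dominated
by the decrease. -/
lemma le_of_window_recursion {b X : ℕ → ℝ} {ρ a c ζ : ℝ} {w : ℕ} (hρ0 : 0 < ρ) (hρ1 : ρ < 1)
    (hw : 1 / 2 ≤ ρ ^ w) (hX : ∀ k, 0 ≤ X k) (hc : 0 ≤ c) (hζ : 0 ≤ ζ)
    (ha : ζ * (w + 1) * 2 ≤ a)
    (h : ∀ n, b (n + 1) ≤ ρ * b n - a * X n + c + ζ * ∑ k ∈ Finset.Icc (n - w) n, X k) (N : ℕ) :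
    b N ≤ ρ ^ N * b 0 + c / (1 - ρ) := by
  have h1ρ : 0 < 1 - ρ := sub_pos.mpr hρ1
  set d := c / (1 - ρ) with hd
  have hd0 : 0 ≤ d := by positivity
  have hcd : c = d - ρ * d := by rw [hd]; field_simp
  have hv : 0 < ρ⁻¹ := inv_pos.mpr hρ0
  -- Centring at the fixed point d of x ↦ ρx + c and multiplying by ρ⁻ⁿ makes the recursion
  -- telescope.
  have key (N : ℕ) : ρ⁻¹ ^ N * (b N - d) ≤ b 0 - d +
      ∑ n ∈ Finset.range N, ρ⁻¹ ^ (n + 1) *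
        (-(a * X n) + ζ * ∑ k ∈ Finset.Icc (n - w) n, X k) := by
    induction N with
    | zero => simp
    | succ n ih =>
      rw [Finset.sum_range_succ, ← add_assoc]
      refine le_trans ?_ (add_le_add_left ih _)
      have e : ρ⁻¹ ^ n * (b n - d) = ρ⁻¹ ^ (n + 1) * (ρ * (b n - d)) := by
        rw [pow_succ, mul_assoc, inv_mul_cancel_left₀ hρ0.ne']
      rw [e, ← mul_add]
      refine mul_le_mul_of_nonneg_left ?_ (by positivity)
      linarith [h n]
  have hsum : ∑ n ∈ Finset.range N, ρ⁻¹ ^ (n + 1) *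
      (-(a * X n) + ζ * ∑ k ∈ Finset.Icc (n - w) n, X k) ≤ 0 := by
    -- Within a window the weights ρ⁻ⁿ and ρ⁻ᵏ differ by a factor at most 2, since ρ^w ≥ 1/2.
    have h1 : ∑ n ∈ Finset.range N, ρ⁻¹ ^ (n + 1) * ∑ k ∈ Finset.Icc (n - w) n, X k ≤
        2 * ((w + 1) * ∑ k ∈ Finset.range N, ρ⁻¹ ^ (k + 1) * X k) := by
      refine le_trans ?_ (mul_le_mul_of_nonneg_left
        (sum_window_le (fun k => mul_nonneg (by positivity) (hX k)) w N) (by norm_num))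
      rw [Finset.mul_sum]
      refine Finset.sum_le_sum fun n _ => ?_
      rw [Finset.mul_sum, Finset.mul_sum]
      refine Finset.sum_le_sum fun k hk => ?_
      rw [← mul_assoc]
      refine mul_le_mul_of_nonneg_right ?_ (hX k)
      obtain ⟨hk1, hk2⟩ := Finset.mem_Icc.mp hk
      obtain ⟨j, rfl⟩ := Nat.exists_eq_add_of_le hk2
      have hj : ρ⁻¹ ^ j ≤ 2 := by
        rw [inv_pow]
        have : 1 / 2 ≤ ρ ^ j := hw.trans (pow_le_pow_of_le_one hρ0.le hρ1.le (by omega))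
        calc (ρ ^ j)⁻¹ ≤ (1 / 2)⁻¹ := by gcongr
          _ = 2 := by norm_num
      calc ρ⁻¹ ^ (k + j + 1) = ρ⁻¹ ^ j * ρ⁻¹ ^ (k + 1) := by ring
        _ ≤ _ := mul_le_mul_of_nonneg_right hj (by positivity)
    have h0 : 0 ≤ ∑ k ∈ Finset.range N, ρ⁻¹ ^ (k + 1) * X k :=
      Finset.sum_nonneg fun k _ => mul_nonneg (by positivity) (hX k)
    have h2 : ∑ n ∈ Finset.range N, ρ⁻¹ ^ (n + 1) *
        (-(a * X n) + ζ * ∑ k ∈ Finset.Icc (n - w) n, X k) =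
        -(a * ∑ k ∈ Finset.range N, ρ⁻¹ ^ (k + 1) * X k) +
          ζ * ∑ n ∈ Finset.range N, ρ⁻¹ ^ (n + 1) * ∑ k ∈ Finset.Icc (n - w) n, X k := by
      rw [Finset.mul_sum, Finset.mul_sum, ← Finset.sum_neg_distrib, ← Finset.sum_add_distrib]
      refine Finset.sum_congr rfl fun n _ => by ring
    rw [h2]
    have h3 := mul_le_mul_of_nonneg_left h1 hζ
    have h4 := mul_le_mul_of_nonneg_right ha h0
    linarith
  have h5 : ρ⁻¹ ^ N * (b N - d) ≤ b 0 - d := (key N).trans (by linarith)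
  rw [inv_pow, inv_mul_le_iff₀ (by positivity)] at h5
  nlinarith [pow_pos hρ0 N]

end Recursion

/-! ### Pathwise descent with stale zeroth-order estimates. -/

section Descent

variable {nx nu M : ℕ}

/-- Costs `J s` with gradients `g s` on a set `C` of gains: second order expansion up to distance
`δ` of `C`, and gradients that are bounded, Lipschitz, and close to one another. -/
structure SmoothFamily (J : Fin M → Gain nx nu → ℝ) (g : Fin M → Gain nx nu → Gain nx nu)
    (C : Set (Gain nx nu)) (L G δ ε : ℝ) : Prop where
  L_pos : 0 < L
  G_nonneg : 0 ≤ G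
  δ_pos : 0 < δ
  ε_nonneg : 0 ≤ ε
  measurable_cost : ∀ s, Measurable (J s)
  measurable_grad : ∀ s, Measurable (g s)
  measurableSet : MeasurableSet C
  expansion : ∀ s, ∀ K ∈ C, ∀ K', ‖K' - K‖ ≤ δ →
    |J s K' - J s K - inner ℝ (g s K) (K' - K)| ≤ L * ‖K' - K‖ ^ 2
  norm_grad_le : ∀ s, ∀ K ∈ C, ‖g s K‖ ≤ G
  grad_close : ∀ s t, ∀ K ∈ C, ∀ K' ∈ C, ‖g s K - g t K'‖ ≤ L * ‖K - K'‖ + ε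

variable {J : Fin M → Gain nx nu → ℝ} {g : Fin M → Gain nx nu → Gain nx nu}
  {C : Set (Gain nx nu)} {L G δ ε : ℝ} {m : ℕ}

/-- The leading part of the zeroth-order estimate. -/
noncomputable def zoLinear (v : Gain nx nu) (u : Fin m → Gain nx nu) : Gain nx nu :=
  ((nx * nu : ℝ) / m) • ∑ l, (inner ℝ v (u l) : ℝ) • u l

/-- Subtracting the expansions at K ± r u cancels J(K) and leaves 2r ⟨g, u⟩ with error at most 2Lr²;
the prefactor nx nu / (2r) turns this into order r. -/
lemma SmoothFamily.norm_zoEstimate_sub_le (h : SmoothFamily J g C L G δ ε) (hm : 1 ≤ m) {r : ℝ}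
    (hr : 0 < r) (hrδ : r ≤ δ) (s : Fin M) {K : Gain nx nu} (hK : K ∈ C)
    {u : Fin m → Gain nx nu} (hu : ∀ l, ‖u l‖ = 1) :
    ‖zoEstimate (J s) r K u - zoLinear (g s K) u‖ ≤ (nx * nu) * L * r := by
  have hm' : (0 : ℝ) < m := by exact_mod_cast hm
  have hexp (l : Fin m) : |J s (K + r • u l) - J s (K - r • u l) -
      2 * r * inner ℝ (g s K) (u l)| ≤ 2 * L * r ^ 2 := by
    have hn : ‖r • u l‖ = r := by rw [norm_smul, hu l, mul_one, Real.norm_of_nonneg hr.le]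
    have h1 := h.expansion s K hK (K + r • u l) (by simpa [hn] using hrδ)
    have h2 := h.expansion s K hK (K - r • u l) (by simpa [hn] using hrδ)
    rw [add_sub_cancel_left, hn, real_inner_smul_right] at h1
    rw [sub_sub_cancel_left, norm_neg, hn, inner_neg_right, real_inner_smul_right] at h2
    rw [abs_le] at *
    constructor <;> linarith [h1.1, h1.2, h2.1, h2.2]
  have e : zoEstimate (J s) r K u - zoLinear (g s K) u =
      ((nx * nu : ℝ) / (2 * r * m)) • ∑ l, (J s (K + r • u l) - J s (K - r • u l) -
        2 * r * inner ℝ (g s K) (u l)) • u l := by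
    rw [zoEstimate, zoLinear, Finset.smul_sum, Finset.smul_sum, Finset.smul_sum,
      ← Finset.sum_sub_distrib]
    refine Finset.sum_congr rfl fun l _ => ?_
    simp only [smul_smul]
    rw [← sub_smul]
    congr 1
    field_simp
  rw [e, norm_smul, Real.norm_of_nonneg (by positivity)]
  calc _ ≤ ((nx * nu : ℝ) / (2 * r * m)) * ∑ _l : Fin m, 2 * L * r ^ 2 := by
        gcongr
        refine (norm_sum_le _ _).trans (Finset.sum_le_sum fun l _ => ?_)
        rw [norm_smul, hu l, mul_one]
        exact hexp l
    _ = _ := by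
        rw [Finset.sum_const, Finset.card_univ, Fintype.card_fin, nsmul_eq_mul]
        field_simp

lemma norm_zoLinear_le (hm : 1 ≤ m) (v : Gain nx nu) {u : Fin m → Gain nx nu}
    (hu : ∀ l, ‖u l‖ = 1) : ‖zoLinear v u‖ ≤ (nx * nu) * ‖v‖ := by
  have hm' : (0 : ℝ) < m := by exact_mod_cast hm
  rw [zoLinear, norm_smul, Real.norm_of_nonneg (by positivity)]
  calc _ ≤ ((nx * nu : ℝ) / m) * ∑ _l : Fin m, ‖v‖ := by
        gcongr
        refine (norm_sum_le _ _).trans (Finset.sum_le_sum fun l _ => ?_)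
        rw [norm_smul, hu l, mul_one]
        simpa [hu l] using norm_inner_le_norm (𝕜 := ℝ) v (u l)
    _ = _ := by
        rw [Finset.sum_const, Finset.card_univ, Fintype.card_fin, nsmul_eq_mul]
        field_simp

lemma SmoothFamily.norm_zoEstimate_le (h : SmoothFamily J g C L G δ ε) (hm : 1 ≤ m) {r : ℝ}
    (hr : 0 < r) (hrδ : r ≤ δ) (s : Fin M) {K : Gain nx nu} (hK : K ∈ C)
    {u : Fin m → Gain nx nu} (hu : ∀ l, ‖u l‖ = 1) :
    ‖zoEstimate (J s) r K u‖ ≤ (nx * nu) * (‖g s K‖ + L * r) := by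
  have h1 := h.norm_zoEstimate_sub_le hm hr hrδ s hK hu
  have h2 := norm_zoLinear_le hm (g s K) hu
  have h3 := norm_le_norm_add_norm_sub' (zoEstimate (J s) r K u) (zoLinear (g s K) u)
  linarith

lemma norm_average_le {ι E : Type*} [NormedAddCommGroup E] [NormedSpace ℝ E] {T : Finset ι}
    {bs : ℕ} (hT : T.card = bs) (hbs : 1 ≤ bs) {v : ι → E} {c : ℝ} (h : ∀ s ∈ T, ‖v s‖ ≤ c) :
    ‖(bs : ℝ)⁻¹ • ∑ s ∈ T, v s‖ ≤ c := by
  have hbs' : (0 : ℝ) < bs := by exact_mod_cast hbs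
  rw [norm_smul, Real.norm_of_nonneg (by positivity), inv_mul_le_iff₀ hbs']
  calc _ ≤ ∑ _s ∈ T, c := (norm_sum_le _ _).trans (Finset.sum_le_sum h)
    _ = _ := by rw [Finset.sum_const, hT, nsmul_eq_mul]

section Pathwise

variable {bs τ : ℕ} {τmax η r : ℝ} {sched : Schedule M bs τmax}
  {u : ℕ → Fin M → Fin m → Gain nx nu} {K : ℕ → Gain nx nu}

/-- The aggregated estimate. -/
noncomputable def aggEstimate (J : Fin M → Gain nx nu → ℝ) (r : ℝ) (sched : Schedule M bs τmax)
    (u : ℕ → Fin M → Fin m → Gain nx nu) (K : ℕ → Gain nx nu) (n : ℕ) : Gain nx nu :=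
  (bs : ℝ)⁻¹ • ∑ s ∈ sched.batch n, zoEstimate (J s) r (K (n - sched.delay s n)) (u n s)

/-- The leading part of the aggregated estimate. -/
noncomputable def aggLinear (g : Fin M → Gain nx nu → Gain nx nu) (sched : Schedule M bs τmax)
    (u : ℕ → Fin M → Fin m → Gain nx nu) (K : ℕ → Gain nx nu) (n : ℕ) : Gain nx nu :=
  (bs : ℝ)⁻¹ • ∑ s ∈ sched.batch n, zoLinear (g s (K (n - sched.delay s n))) (u n s)

/-- The aggregated stale gradient. -/
noncomputable def aggGrad (g : Fin M → Gain nx nu → Gain nx nu) (sched : Schedule M bs τmax)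
    (K : ℕ → Gain nx nu) (n : ℕ) : Gain nx nu :=
  (bs : ℝ)⁻¹ • ∑ s ∈ sched.batch n, g s (K (n - sched.delay s n))

lemma SmoothFamily.norm_aggEstimate_sub_le (h : SmoothFamily J g C L G δ ε) (hm : 1 ≤ m)
    (hbs : 1 ≤ bs) (hr : 0 < r) (hrδ : r ≤ δ) {n : ℕ} (hK : ∀ k ≤ n, K k ∈ C)
    (hu : ∀ n s l, ‖u n s l‖ = 1) :
    ‖aggEstimate J r sched u K n - aggLinear g sched u K n‖ ≤ (nx * nu) * L * r := by
  rw [aggEstimate, aggLinear, ← smul_sub, ← Finset.sum_sub_distrib]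
  exact norm_average_le (sched.card_batch n) hbs fun s _ =>
    h.norm_zoEstimate_sub_le hm hr hrδ s (hK _ (Nat.sub_le _ _)) (hu n s)

lemma SmoothFamily.norm_aggEstimate_le (h : SmoothFamily J g C L G δ ε) (hm : 1 ≤ m)
    (hbs : 1 ≤ bs) (hr : 0 < r) (hrδ : r ≤ δ) {n : ℕ} (hK : ∀ k ≤ n, K k ∈ C)
    (hu : ∀ n s l, ‖u n s l‖ = 1) :
    ‖aggEstimate J r sched u K n‖ ≤ (nx * nu) * (G + L * δ) := by
  refine norm_average_le (sched.card_batch n) hbs fun s _ => ?_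
  have hk := hK (n - sched.delay s n) (Nat.sub_le _ _)
  refine (h.norm_zoEstimate_le hm hr hrδ s hk (hu n s)).trans ?_
  have := h.L_pos
  gcongr
  exact h.norm_grad_le s _ hk

/-- A pathwise substitute for a variance bound. Every stale gradient is compared, at its own gain,
with that of system i at the price ε; the latter is one term of the window sum. -/
lemma SmoothFamily.norm_aggEstimate_sq_le (h : SmoothFamily J g C L G δ ε) (hm : 1 ≤ m)
    (hbs : 1 ≤ bs) (hr : 0 < r) (hrδ : r ≤ δ) (hτ : ∀ s n, sched.delay s n ≤ τ) {n : ℕ}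
    (hK : ∀ k ≤ n, K k ∈ C) (hu : ∀ n s l, ‖u n s l‖ = 1) (i : Fin M) :
    ‖aggEstimate J r sched u K n‖ ^ 2 ≤ 3 * (nx * nu) ^ 2 *
      (∑ k ∈ Finset.Icc (n - τ) n, ‖g i (K k)‖ ^ 2 + (ε ^ 2 + L ^ 2 * r ^ 2)) := by
  set Z := ∑ k ∈ Finset.Icc (n - τ) n, ‖g i (K k)‖ ^ 2 with hZ
  have hZ0 : 0 ≤ Z := Finset.sum_nonneg fun _ _ => sq_nonneg _
  have hL := h.L_pos
  have hε := h.ε_nonneg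
  have h1 : ‖aggEstimate J r sched u K n‖ ≤ (nx * nu) * (√Z + ε + L * r) := by
    refine norm_average_le (sched.card_batch n) hbs fun s _ => ?_
    have hk := hK (n - sched.delay s n) (Nat.sub_le _ _)
    refine (h.norm_zoEstimate_le hm hr hrδ s hk (hu n s)).trans ?_
    gcongr
    have h2 := h.grad_close s i _ hk _ hk
    rw [sub_self, norm_zero, mul_zero, zero_add] at h2
    have h3 : ‖g i (K (n - sched.delay s n))‖ ≤ √Z := by
      refine Real.le_sqrt_of_sq_le ?_
      refine Finset.single_le_sum (f := fun k => ‖g i (K k)‖ ^ 2) (fun _ _ => sq_nonneg _) ?_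
      rw [Finset.mem_Icc]
      have := hτ s n
      omega
    have h4 := norm_le_norm_add_norm_sub' (g s (K (n - sched.delay s n)))
      (g i (K (n - sched.delay s n)))
    linarith
  calc _ ≤ ((nx * nu) * (√Z + ε + L * r)) ^ 2 := by gcongr
    _ = (nx * nu) ^ 2 * (√Z + ε + L * r) ^ 2 := by ring
    _ ≤ (nx * nu) ^ 2 * (3 * (√Z ^ 2 + ε ^ 2 + (L * r) ^ 2)) := by
        gcongr
        nlinarith [sq_nonneg (√Z - ε), sq_nonneg (√Z - L * r), sq_nonneg (ε - L * r)]
    _ = _ := by rw [Real.sq_sqrt hZ0]; ring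

lemma norm_sub_le_of_steps {η c : ℝ} {v : ℕ → Gain nx nu} (hη : 0 ≤ η)
    (hrun : ∀ n, K (n + 1) = K n - η • v n) {n d : ℕ} (hd : d ≤ n)
    (hv : ∀ j, n - d ≤ j → j < n → ‖v j‖ ≤ c) : ‖K (n - d) - K n‖ ≤ d * (η * c) := by
  induction d with
  | zero => simp
  | succ d ih =>
    have h1 := ih (by omega) fun j hj hjn => hv j (by omega) hjn
    have e : n - d = (n - (d + 1)) + 1 := by omega
    have h2 := hrun (n - (d + 1))
    rw [← e] at h2
    have h3 : K (n - (d + 1)) - K n = (K (n - d) - K n) + η • v (n - (d + 1)) := by rw [h2]; abel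
    rw [h3]
    refine (norm_add_le _ _).trans ?_
    rw [norm_smul, Real.norm_of_nonneg hη]
    have h4 := hv (n - (d + 1)) le_rfl (by omega)
    have h5 := mul_le_mul_of_nonneg_left h4 hη
    push_cast
    linarith

lemma SmoothFamily.norm_aggGrad_sub_le (h : SmoothFamily J g C L G δ ε) (hbs : 1 ≤ bs)
    (hη : 0 ≤ η) (hτ : ∀ s n, sched.delay s n ≤ τ) {v : ℕ → Gain nx nu}
    (hrun : ∀ n, K (n + 1) = K n - η • v n) {n : ℕ}
    (hK : ∀ k ≤ n, K k ∈ C) {c : ℝ} (hc : 0 ≤ c)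
    (hv : ∀ j, n - τ ≤ j → j ≤ n → ‖v j‖ ≤ c) (i : Fin M) :
    ‖aggGrad g sched K n - g i (K n)‖ ≤ L * (τ * (η * c)) + ε := by
  have hL := h.L_pos
  have e : aggGrad g sched K n - g i (K n) = (bs : ℝ)⁻¹ •
      ∑ s ∈ sched.batch n, (g s (K (n - sched.delay s n)) - g i (K n)) := by
    have hbs' : (bs : ℝ) ≠ 0 := by exact_mod_cast (by omega : bs ≠ 0)
    rw [Finset.sum_sub_distrib, Finset.sum_const, sched.card_batch, smul_sub,
      ← Nat.cast_smul_eq_nsmul ℝ, inv_smul_smul₀ hbs', aggGrad]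
  rw [e]
  refine norm_average_le (sched.card_batch n) hbs fun s _ => ?_
  refine (h.grad_close s i _ (hK _ (Nat.sub_le _ _)) _ (hK n le_rfl)).trans ?_
  gcongr
  have hd := hτ s n
  refine (norm_sub_le_of_steps hη hrun (sched.delay_le s n)
    fun j hj hjn => hv j (by omega) hjn.le).trans ?_
  have : (sched.delay s n : ℝ) ≤ τ := by exact_mod_cast hd
  gcongr

/-- Young's inequality spends x²/4 on the products of x with drift, heterogeneity and bias. Here x
is the gradient norm, y the norm of the aggregated estimate, c a bound on it over the last τ
iterations, Z the window sum; the inner product a of gradient and estimate splits into x², noise ξ,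
staleness s and bias b. -/
lemma descent_arithmetic {D L η t ε r q Z c x y a ξ s b J₀ J₁ : ℝ} (hD : 1 ≤ D) (hL : 0 < L)
    (hη : 0 < η) (hq : q = ε ^ 2 + L ^ 2 * r ^ 2)
    (hc : c ^ 2 = 3 * D ^ 2 * (Z + q)) (hy : y ^ 2 ≤ 3 * D ^ 2 * (Z + q))
    (hexp : J₁ ≤ J₀ - η * a + L * (η ^ 2 * y ^ 2)) (ha : a = x ^ 2 + ξ + s + b)
    (hs : -(x * (L * (t * (η * c)) + ε)) ≤ s) (hb : -(x * (D * L * r)) ≤ b) :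
    J₁ ≤ J₀ - η * ξ - 3 / 4 * η * x ^ 2 + 3 * η * D ^ 2 * q +
      (9 * L ^ 2 * D ^ 2 * η ^ 3 * t ^ 2 + 3 * D ^ 2 * L * η ^ 2) * (Z + q) := by
  have i5 : x * (L * (t * (η * c)) + ε) + x * (D * L * r) ≤
      1 / 4 * x ^ 2 + 3 * ((L * (t * (η * c))) ^ 2 + ε ^ 2 + (D * L * r) ^ 2) := by
    generalize L * (t * (η * c)) = p
    generalize D * L * r = w
    nlinarith [sq_nonneg (x / 2 - (p + ε + w)), sq_nonneg (p - ε), sq_nonneg (p - w),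
      sq_nonneg (ε - w)]
  have i6 : ε ^ 2 + (D * L * r) ^ 2 ≤ D ^ 2 * q := by
    have : 0 ≤ (D ^ 2 - 1) * ε ^ 2 := mul_nonneg (by nlinarith) (sq_nonneg _)
    rw [hq]
    linarith
  have i7 : (L * (t * (η * c))) ^ 2 = 3 * L ^ 2 * D ^ 2 * η ^ 2 * t ^ 2 * (Z + q) := by
    have : (L * (t * (η * c))) ^ 2 = L ^ 2 * t ^ 2 * η ^ 2 * c ^ 2 := by ring
    rw [this, hc]
    ring
  have i8 : L * (η ^ 2 * y ^ 2) ≤ L * (η ^ 2 * (3 * D ^ 2 * (Z + q))) := by gcongr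
  have i9 : -a ≤ -ξ - 3 / 4 * x ^ 2 + 3 * D ^ 2 * q +
      9 * L ^ 2 * D ^ 2 * η ^ 2 * t ^ 2 * (Z + q) := by
    linarith
  have i10 := mul_le_mul_of_nonneg_left i9 hη.le
  linarith

/-- One step of the method decreases the cost, up to a martingale increment, staleness and bias. -/
lemma SmoothFamily.descent (h : SmoothFamily J g C L G δ ε) (hx : 1 ≤ nx) (hu' : 1 ≤ nu)
    (hm : 1 ≤ m) (hbs : 1 ≤ bs) (hr : 0 < r) (hrδ : r ≤ δ) (hη : 0 < η)
    (hηδ : η * ((nx * nu) * (G + L * δ)) ≤ δ)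
    (hτ : ∀ s n, sched.delay s n ≤ τ)
    (hrun : ∀ n, K (n + 1) = K n - η • aggEstimate J r sched u K n) {n : ℕ}
    (hK : ∀ k ≤ n, K k ∈ C) (hu : ∀ n s l, ‖u n s l‖ = 1) (i : Fin M) :
    ‖K (n + 1) - K n‖ ≤ δ ∧
    J i (K (n + 1)) ≤ J i (K n) - η * inner ℝ (g i (K n))
        (aggLinear g sched u K n - aggGrad g sched K n) -
      3 / 4 * η * ‖g i (K n)‖ ^ 2 + 3 * η * (nx * nu) ^ 2 * (ε ^ 2 + L ^ 2 * r ^ 2) +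
      (9 * L ^ 2 * (nx * nu) ^ 2 * η ^ 3 * τ ^ 2 + 3 * (nx * nu) ^ 2 * L * η ^ 2) *
        (∑ k ∈ Finset.Icc (n - 2 * τ) n, ‖g i (K k)‖ ^ 2 + (ε ^ 2 + L ^ 2 * r ^ 2)) := by
  have hL := h.L_pos
  have hD1 : (1 : ℝ) ≤ nx * nu := by
    have h1 : (1 : ℝ) ≤ nx := by exact_mod_cast hx
    have h2 : (1 : ℝ) ≤ nu := by exact_mod_cast hu'
    nlinarith
  have hstep : K (n + 1) - K n = -(η • aggEstimate J r sched u K n) := by rw [hrun]; abel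
  have hnstep : ‖K (n + 1) - K n‖ = η * ‖aggEstimate J r sched u K n‖ := by
    rw [hstep, norm_neg, norm_smul, Real.norm_of_nonneg hη.le]
  have hstepδ : ‖K (n + 1) - K n‖ ≤ δ := by
    rw [hnstep]
    exact (mul_le_mul_of_nonneg_left (h.norm_aggEstimate_le hm hbs hr hrδ hK hu) hη.le).trans hηδ
  refine ⟨hstepδ, ?_⟩
  -- The window has length 2τ because the drift involves the steps since n - τ, each of which uses
  -- gradients up to τ iterations older.
  have hagg (j : ℕ) (h1 : n - τ ≤ j) (h2 : j ≤ n) :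
      ‖aggEstimate J r sched u K j‖ ^ 2 ≤ 3 * (nx * nu) ^ 2 *
        (∑ k ∈ Finset.Icc (n - 2 * τ) n, ‖g i (K k)‖ ^ 2 + (ε ^ 2 + L ^ 2 * r ^ 2)) := by
    refine (h.norm_aggEstimate_sq_le hm hbs hr hrδ hτ (fun k hk => hK k (hk.trans h2)) hu i).trans ?_
    refine mul_le_mul_of_nonneg_left (add_le_add_left ?_ _) (by positivity)
    exact Finset.sum_le_sum_of_subset_of_nonneg (Finset.Icc_subset_Icc (by omega) h2)
      fun k _ _ => sq_nonneg ‖g i (K k)‖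
  have hZ0 : 0 ≤ ∑ k ∈ Finset.Icc (n - 2 * τ) n, ‖g i (K k)‖ ^ 2 :=
    Finset.sum_nonneg fun k _ => sq_nonneg ‖g i (K k)‖
  generalize ∑ k ∈ Finset.Icc (n - 2 * τ) n, ‖g i (K k)‖ ^ 2 = Z at hagg hZ0 ⊢
  have hstale := h.norm_aggGrad_sub_le hbs hη.le hτ hrun hK (Real.sqrt_nonneg _)
    (fun j h1 h2 => Real.le_sqrt_of_sq_le (hagg j h1 h2)) i
  have hexp := (abs_le.mp (h.expansion i (K n) (hK n le_rfl) (K (n + 1)) hstepδ)).2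
  rw [hnstep, hstep, inner_neg_right, real_inner_smul_right, mul_pow] at hexp
  have hbias := h.norm_aggEstimate_sub_le (sched := sched) hm hbs hr hrδ hK hu
  have hsplit : (inner ℝ (g i (K n)) (aggEstimate J r sched u K n) : ℝ) =
      ‖g i (K n)‖ ^ 2 +
      inner ℝ (g i (K n)) (aggLinear g sched u K n - aggGrad g sched K n) +
      inner ℝ (g i (K n)) (aggGrad g sched K n - g i (K n)) +
      inner ℝ (g i (K n)) (aggEstimate J r sched u K n - aggLinear g sched u K n) := by
    rw [← real_inner_self_eq_norm_sq, ← inner_add_right, ← inner_add_right, ← inner_add_right]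
    congr 1
    abel
  have i1 := (abs_le.mp (abs_real_inner_le_norm (g i (K n)) (aggGrad g sched K n - g i (K n)))).1
  have i2 := (abs_le.mp (abs_real_inner_le_norm (g i (K n))
    (aggEstimate J r sched u K n - aggLinear g sched u K n))).1
  have hx0 : 0 ≤ ‖g i (K n)‖ := norm_nonneg _
  have i3 := mul_le_mul_of_nonneg_left hstale hx0
  have i4 := mul_le_mul_of_nonneg_left hbias hx0
  exact descent_arithmetic (c := √(3 * (nx * nu) ^ 2 * (Z + (ε ^ 2 + L ^ 2 * r ^ 2)))) hD1 hL hη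
    rfl (Real.sq_sqrt (by positivity)) (hagg n (Nat.sub_le _ _) le_rfl) (by linarith) hsplit
    (by linarith) (by linarith)

end Pathwise

end Descent

end AsyncLQR

namespace AsyncLQR

/-! ### Filtration, independence and the vanishing noise term. -/

section Stochastic

variable {nx nu M m bs : ℕ} {Ω : Type*}

/-- The information carried by the directions aggregated before iteration `n`. -/
@[reducible] def history (u : ℕ → Fin M → Fin m → Ω → Gain nx nu) (n : ℕ) : MeasurableSpace Ω :=
  ⨆ j ∈ {j : ℕ × Fin M × Fin m | j.1 < n},
    MeasurableSpace.comap (u j.1 j.2.1 j.2.2) inferInstance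

variable {u : ℕ → Fin M → Fin m → Ω → Gain nx nu}

lemma history_mono {k n : ℕ} (h : k ≤ n) : history u k ≤ history u n :=
  biSup_mono fun _ hj => lt_of_lt_of_le hj h

lemma measurable_history {k n : ℕ} (h : k < n) (s : Fin M) (l : Fin m) :
    Measurable[history u n] (u k s l) := by
  rw [measurable_iff_comap_le]
  exact le_biSup (fun j : ℕ × Fin M × Fin m =>
    MeasurableSpace.comap (u j.1 j.2.1 j.2.2) inferInstance)
    (show (k, s, l) ∈ {j : ℕ × Fin M × Fin m | j.1 < n} from h)

lemma measurable_zoEstimate {α : Type*} [MeasurableSpace α] {J : Gain nx nu → ℝ}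
    (hJ : Measurable J) (r : ℝ) {k : α → Gain nx nu} {v : Fin m → α → Gain nx nu}
    (hk : Measurable k) (hv : ∀ l, Measurable (v l)) :
    Measurable fun ω => zoEstimate J r (k ω) (fun l => v l ω) := by
  unfold zoEstimate
  fun_prop

variable {J : Fin M → Gain nx nu → ℝ} {τmax η r : ℝ} {sched : Schedule M bs τmax}
  {K₀ : Gain nx nu} {K : ℕ → Ω → Gain nx nu}

/-- The n-th iterate involves only directions aggregated before n. Delays reach back arbitrarily
far, hence the strong induction. -/
lemma measurable_iterate (hJ : ∀ s, Measurable (J s)) (h0 : ∀ ω, K 0 ω = K₀)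
    (hrun : ∀ n ω, K (n + 1) ω = K n ω - η •
      aggEstimate J r sched (fun n s l => u n s l ω) (fun n => K n ω) n) (n : ℕ) :
    Measurable[history u n] (K n) := by
  induction n using Nat.strong_induction_on with
  | _ n ih =>
  cases n with
  | zero =>
    rw [show K 0 = fun _ => K₀ from funext h0]
    exact measurable_const
  | succ n =>
    have hK (k : ℕ) (hk : k ≤ n) : Measurable[history u (n + 1)] (K k) :=
      (ih k (by omega)).mono (history_mono (by omega)) le_rfl
    rw [show K (n + 1) = _ from funext (hrun n)]
    refine (hK n le_rfl).sub ((measurable_const_smul η).comp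
      ((measurable_const_smul (bs : ℝ)⁻¹).comp (Finset.measurable_sum _ fun s _ => ?_)))
    exact @measurable_zoEstimate _ _ _ _ (history u (n + 1)) _ (hJ s) r _ _
      (hK _ (Nat.sub_le _ _)) fun l => measurable_history (Nat.lt_succ_self n) s l

variable {g : Fin M → Gain nx nu → Gain nx nu} {C : Set (Gain nx nu)} {L G δ ε : ℝ}

/-- The event that the iterates before `n` lie in `C`. -/
def stayEvent (C : Set (Gain nx nu)) (K : ℕ → Ω → Gain nx nu) (n : ℕ) : Set Ω :=
  {ω | ∀ k < n, K k ω ∈ C}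

lemma stayEvent_anti {k n : ℕ} (h : k ≤ n) : stayEvent C K n ⊆ stayEvent C K k :=
  fun _ hω j hj => hω j (hj.trans_le h)

/-- The shift matters: the event for n + 1 constrains only the iterates up to n, so it is known
before the directions of iteration n and independent of them. -/
lemma measurableSet_stayEvent (hC : MeasurableSet C)
    (hK : ∀ n, Measurable[history u n] (K n)) (n : ℕ) :
    MeasurableSet[history u n] (stayEvent C K (n + 1)) := by
  have e : stayEvent C K (n + 1) = ⋂ k ∈ Set.Iio (n + 1), K k ⁻¹' C := by
    ext ω; simp [stayEvent]
  rw [e]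
  refine MeasurableSet.biInter (Set.to_countable _) fun k hk => ?_
  exact (hK k).mono (history_mono (Nat.lt_succ_iff.mp hk)) le_rfl hC

variable [MeasurableSpace Ω] {P : Measure Ω}

lemma IsUniformDirections.history_le (hU : IsUniformDirections P u) (n : ℕ) :
    history u n ≤ ‹MeasurableSpace Ω› :=
  iSup₂_le fun j _ => (hU.measurable j.1 j.2.1 j.2.2).comap_le

lemma IsUniformDirections.indep_history (hU : IsUniformDirections P u) (n : ℕ) (s : Fin M)
    (l : Fin m) :
    Indep (history u n) (MeasurableSpace.comap (u n s l) inferInstance) P := by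
  have h := indep_iSup_of_disjoint
    (m := fun j : ℕ × Fin M × Fin m => MeasurableSpace.comap (u j.1 j.2.1 j.2.2) inferInstance)
    (fun j => (hU.measurable j.1 j.2.1 j.2.2).comap_le) hU.indep
    (S := {j | j.1 < n}) (T := {(n, s, l)}) (by simp)
  simp only [Set.mem_singleton_iff, iSup_iSup_eq_left] at h
  exact h

/-- As the law of a random direction the sphere measure has mass one, so its normalisation need not
be computed. -/
lemma IsUniformDirections.isProbabilityMeasure [IsProbabilityMeasure P]
    (hU : IsUniformDirections P u) (n : ℕ) (s : Fin M)
    (l : Fin m) : IsProbabilityMeasure (uniformSphere nx nu) := by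
  rw [← hU.law n s l]
  exact Measure.isProbabilityMeasure_map (hU.measurable n s l).aemeasurable

lemma IsUniformDirections.ae_norm (hU : IsUniformDirections P u) :
    ∀ᵐ ω ∂P, ∀ n s l, ‖u n s l ω‖ = 1 := by
  simp only [ae_all_iff]
  intro n s l
  have h := ae_uniformSphere (nx := nx) (nu := nu)
  rw [← hU.law n s l] at h
  exact ae_of_ae_map (hU.measurable n s l).aemeasurable h

variable [IsProbabilityMeasure P]

lemma IsUniformDirections.integral_mul_coord (hU : IsUniformDirections P u) {n : ℕ} {Y : Ω → ℝ}
    (hY : Measurable[history u n] Y) (s : Fin M) (l : Fin m) (a b : Fin nu × Fin nx) :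
    ∫ ω, Y ω * (u n s l ω a * u n s l ω b) ∂P =
      (∫ ω, Y ω ∂P) * if a = b then ((nx : ℝ) * nu)⁻¹ else 0 := by
  have := hU.isProbabilityMeasure n s l
  have hφ : Measurable fun x : Gain nx nu => x a * x b := by fun_prop
  have hind : IndepFun Y (fun ω => u n s l ω a * u n s l ω b) P := by
    rw [IndepFun_iff_Indep]
    refine indep_of_indep_of_le_left (indep_of_indep_of_le_right (hU.indep_history n s l) ?_) ?_
    · rw [show (fun ω => u n s l ω a * u n s l ω b) =
        (fun x : Gain nx nu => x a * x b) ∘ u n s l from rfl, ← MeasurableSpace.comap_comp]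
      exact MeasurableSpace.comap_mono hφ.comap_le
    · exact hY.comap_le
  have h1 := hind.integral_mul_eq_mul_integral
    (hY.mono (hU.history_le n) le_rfl).aestronglyMeasurable
    (hφ.comp (hU.measurable n s l)).aestronglyMeasurable
  simp only [Pi.mul_apply] at h1
  rw [h1, ← integral_uniformSphere a b, ← hU.law n s l,
    integral_map (hU.measurable n s l).aemeasurable hφ.aestronglyMeasurable]

/-- The leading part of the estimate is unbiased given the past. -/
lemma IsUniformDirections.integral_inner_zoLinear (hU : IsUniformDirections P u) (hx : 1 ≤ nx)
    (hu : 1 ≤ nu) (hm : 1 ≤ m) {n : ℕ} {V W : Ω → Gain nx nu} (hV : Measurable[history u n] V)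
    (hW : Measurable[history u n] W) {c : ℝ} (hVc : ∀ ω, ‖V ω‖ ≤ c) (hWc : ∀ ω, ‖W ω‖ ≤ c)
    (s : Fin M) :
    Integrable (fun ω => (inner ℝ (V ω) (zoLinear (W ω) (fun l => u n s l ω) - W ω) : ℝ)) P ∧
    ∫ ω, (inner ℝ (V ω) (zoLinear (W ω) (fun l => u n s l ω) - W ω) : ℝ) ∂P = 0 := by
  have hm' : (m : ℝ) ≠ 0 := by exact_mod_cast (by omega : m ≠ 0)
  have hx' : (nx : ℝ) ≠ 0 := by exact_mod_cast (by omega : nx ≠ 0)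
  have hu' : (nu : ℝ) ≠ 0 := by exact_mod_cast (by omega : nu ≠ 0)
  have hVm := hV.mono (hU.history_le n) le_rfl
  have hWm := hW.mono (hU.history_le n) le_rfl
  have hY (a b : Fin nu × Fin nx) : Measurable[history u n] fun ω => V ω a * W ω b := by
    have ha (a : Fin nu × Fin nx) : Measurable fun x : Gain nx nu => x a := by fun_prop
    exact ((ha a).comp hV).mul ((ha b).comp hW)
  have hYb (a b : Fin nu × Fin nx) (ω : Ω) : |V ω a * W ω b| ≤ c * c := by
    rw [abs_mul]
    exact mul_le_mul ((PiLp.norm_apply_le (V ω) a).trans (hVc ω))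
      ((PiLp.norm_apply_le (W ω) b).trans (hWc ω)) (abs_nonneg _) ((norm_nonneg _).trans (hVc ω))
  have hint (l : Fin m) (a b : Fin nu × Fin nx) :
      Integrable (fun ω => V ω a * W ω b * (u n s l ω a * u n s l ω b)) P := by
    have := hU.measurable n s l
    refine Integrable.of_bound (C := c * c) (by fun_prop) ?_
    filter_upwards [hU.ae_norm] with ω hω
    rw [norm_mul, norm_mul (u n s l ω a)]
    have h1 := PiLp.norm_apply_le (u n s l ω) a
    have h2 := PiLp.norm_apply_le (u n s l ω) b
    rw [hω] at h1 h2
    calc _ ≤ c * c * (1 * 1) := mul_le_mul (hYb a b ω)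
          (mul_le_mul h1 h2 (norm_nonneg _) zero_le_one) (by positivity)
          ((abs_nonneg _).trans (hYb a b ω))
      _ = c * c := by ring
  have hint' (a : Fin nu × Fin nx) : Integrable (fun ω => V ω a * W ω a) P :=
    Integrable.of_bound (C := c * c) ((hY a a).mono (hU.history_le n) le_rfl).aestronglyMeasurable
      (Filter.Eventually.of_forall fun ω => hYb a a ω)
  -- In coordinates each term is a factor known from the past times a product of two coordinates of
  -- a fresh direction, to which independence applies.
  have e (ω : Ω) : (inner ℝ (V ω) (zoLinear (W ω) (fun l => u n s l ω) - W ω) : ℝ) =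
      ((nx * nu : ℝ) / m) * ∑ l, ∑ a, ∑ b, V ω a * W ω b * (u n s l ω a * u n s l ω b) -
        ∑ a, V ω a * W ω a := by
    rw [inner_sub_right, zoLinear, real_inner_smul_right, inner_sum]
    congr 1
    · congr 1
      refine Finset.sum_congr rfl fun l _ => ?_
      rw [real_inner_smul_right, PiLp.inner_apply, PiLp.inner_apply, Finset.sum_mul_sum,
        Finset.sum_comm]
      refine Finset.sum_congr rfl fun a _ => Finset.sum_congr rfl fun b _ => ?_
      simp only [RCLike.inner_apply, conj_trivial]
      ring
    · rw [PiLp.inner_apply]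
      refine Finset.sum_congr rfl fun a _ => ?_
      simp only [RCLike.inner_apply, conj_trivial]
      ring
  have I1 : Integrable (fun ω => ∑ l, ∑ a, ∑ b,
      V ω a * W ω b * (u n s l ω a * u n s l ω b)) P :=
    integrable_finsetSum _ fun l _ => integrable_finsetSum _ fun a _ =>
      integrable_finsetSum _ fun b _ => hint l a b
  have I2 : Integrable (fun ω => ∑ a, V ω a * W ω a) P :=
    integrable_finsetSum _ fun a _ => hint' a
  simp only [e]
  refine ⟨(I1.const_mul _).sub I2, ?_⟩
  rw [integral_sub (I1.const_mul _) I2, integral_const_mul,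
    integral_finsetSum _ fun l _ => integrable_finsetSum _ fun a _ =>
      integrable_finsetSum _ fun b _ => hint l a b,
    integral_finsetSum _ fun a _ => hint' a]
  have e2 (l : Fin m) : ∫ ω, ∑ a, ∑ b, V ω a * W ω b * (u n s l ω a * u n s l ω b) ∂P =
      ((nx : ℝ) * nu)⁻¹ * ∑ a, ∫ ω, V ω a * W ω a ∂P := by
    rw [integral_finsetSum Finset.univ
      (f := fun a ω => ∑ b, V ω a * W ω b * (u n s l ω a * u n s l ω b))
      fun a _ => integrable_finsetSum _ fun b _ => hint l a b, Finset.mul_sum]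
    refine Finset.sum_congr rfl fun a _ => ?_
    rw [integral_finsetSum _ fun b _ => hint l a b]
    simp only [hU.integral_mul_coord (hY _ _), mul_ite, mul_zero, Finset.sum_ite_eq,
      Finset.mem_univ, if_true]
    ring
  simp only [e2, Finset.sum_const, Finset.card_univ, Fintype.card_fin, nsmul_eq_mul]
  field_simp
  ring

/-- The noise of the leading part averages out while the iterates stay in `C`. -/
lemma SmoothFamily.setIntegral_noise (h : SmoothFamily J g C L G δ ε)
    (hU : IsUniformDirections P u) (hx : 1 ≤ nx) (hu : 1 ≤ nu) (hm : 1 ≤ m)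
    (hK : ∀ n, Measurable[history u n] (K n)) (i : Fin M) (n : ℕ) :
    IntegrableOn (fun ω => (inner ℝ (g i (K n ω))
      (aggLinear g sched (fun n s l => u n s l ω) (fun n => K n ω) n -
        aggGrad g sched (fun n => K n ω) n) : ℝ)) (stayEvent C K (n + 1)) P ∧
    ∫ ω in stayEvent C K (n + 1), (inner ℝ (g i (K n ω))
      (aggLinear g sched (fun n s l => u n s l ω) (fun n => K n ω) n -
        aggGrad g sched (fun n => K n ω) n) : ℝ) ∂P = 0 := by
  set F := stayEvent C K (n + 1) with hF
  have hFm : MeasurableSet[history u n] F := measurableSet_stayEvent h.measurableSet hK n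
  have hFm' : MeasurableSet F := hU.history_le n _ hFm
  -- Gradients are bounded only on C. Cutting them off outside the event, which is known from the
  -- past, makes them bounded everywhere without changing the integral over it.
  let V (s : Fin M) (k : ℕ) (ω : Ω) : Gain nx nu := F.indicator (fun ω => g s (K k ω)) ω
  have hVm (s : Fin M) {k : ℕ} (hk : k ≤ n) : Measurable[history u n] (V s k) :=
    Measurable.indicator ((h.measurable_grad s).comp ((hK k).mono (history_mono hk) le_rfl)) hFm
  have hVb (s : Fin M) {k : ℕ} (hk : k ≤ n) (ω : Ω) : ‖V s k ω‖ ≤ G := by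
    simp only [V]
    by_cases hω : ω ∈ F
    · rw [Set.indicator_of_mem hω]
      exact h.norm_grad_le s _ (hω k (by omega))
    · rw [Set.indicator_of_notMem hω, norm_zero]
      exact h.G_nonneg
  have key (s : Fin M) := hU.integral_inner_zoLinear hx hu hm (hVm i le_rfl)
    (hVm s (Nat.sub_le n (sched.delay s n))) (hVb i le_rfl)
    (hVb s (Nat.sub_le n (sched.delay s n))) s
  have e : F.indicator (fun ω => (inner ℝ (g i (K n ω))
      (aggLinear g sched (fun n s l => u n s l ω) (fun n => K n ω) n -
        aggGrad g sched (fun n => K n ω) n) : ℝ)) = fun ω => (bs : ℝ)⁻¹ * ∑ s ∈ sched.batch n,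
          (inner ℝ (V i n ω) (zoLinear (V s (n - sched.delay s n) ω) (fun l => u n s l ω) -
            V s (n - sched.delay s n) ω) : ℝ) := by
    funext ω
    simp only [V]
    by_cases hω : ω ∈ F
    · simp only [Set.indicator_of_mem hω]
      rw [aggLinear, aggGrad, ← smul_sub, ← Finset.sum_sub_distrib, real_inner_smul_right,
        inner_sum]
    · simp [Set.indicator_of_notMem hω]
  rw [← integrable_indicator_iff hFm', ← integral_indicator hFm', e]
  refine ⟨(integrable_finsetSum _ fun s _ => (key s).1).const_mul _, ?_⟩
  rw [integral_const_mul, integral_finsetSum _ fun s _ => (key s).1]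
  simp [(key _).2]

end Stochastic

end AsyncLQR

namespace AsyncLQR

/-! ### From pathwise descent to the expected gap. -/

section GapBound

lemma integral_combination {α : Type*} [MeasurableSpace α] {ν : Measure α} [IsFiniteMeasure ν]
    {f₁ f₂ f₃ f₄ : α → ℝ} (h₁ : Integrable f₁ ν) (h₂ : Integrable f₂ ν) (h₃ : Integrable f₃ ν)
    (h₄ : Integrable f₄ ν) (a b c k d : ℝ) :
    Integrable (fun x => a * f₁ x - b * f₂ x - c * f₃ x + k + d * f₄ x) ν ∧
    ∫ x, (a * f₁ x - b * f₂ x - c * f₃ x + k + d * f₄ x) ∂ν =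
      a * ∫ x, f₁ x ∂ν - b * ∫ x, f₂ x ∂ν - c * ∫ x, f₃ x ∂ν + ν.real Set.univ * k +
        d * ∫ x, f₄ x ∂ν := by
  have i₁ : Integrable (fun x => a * f₁ x - b * f₂ x) ν := (h₁.const_mul a).sub (h₂.const_mul b)
  have i₂ : Integrable (fun x => a * f₁ x - b * f₂ x - c * f₃ x) ν := i₁.sub (h₃.const_mul c)
  have i₃ : Integrable (fun x => a * f₁ x - b * f₂ x - c * f₃ x + k) ν :=
    i₂.add (integrable_const k)
  refine ⟨i₃.add (h₄.const_mul d), ?_⟩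
  rw [integral_add i₃ (h₄.const_mul d), integral_add i₂ (integrable_const k),
    integral_sub i₁ (h₃.const_mul c), integral_sub (h₁.const_mul a) (h₂.const_mul b),
    integral_const_mul, integral_const_mul, integral_const_mul, integral_const_mul,
    integral_const, smul_eq_mul]

variable {nx nu M m bs τ : ℕ} {Ω : Type*} [MeasurableSpace Ω] {P : Measure Ω}
  [IsProbabilityMeasure P] {u : ℕ → Fin M → Fin m → Ω → Gain nx nu}
  {J : Fin M → Gain nx nu → ℝ} {g : Fin M → Gain nx nu → Gain nx nu} {C : Set (Gain nx nu)}
  {L G δ ε τmax η r : ℝ} {sched : Schedule M bs τmax} {K₀ : Gain nx nu} {K : ℕ → Ω → Gain nx nu}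

lemma SmoothFamily.abs_cost_sub_le (h : SmoothFamily J g C L G δ ε) {i : Fin M} {B : ℝ}
    (hB : ∀ K ∈ C, |J i K| ≤ B) (c : ℝ) {K₁ K₂ : Gain nx nu} (h₁ : K₁ ∈ C)
    (h₂ : ‖K₂ - K₁‖ ≤ δ) : |J i K₂ - c| ≤ B + G * δ + L * δ ^ 2 + |c| := by
  have hL := h.L_pos
  have h3 := h.expansion i K₁ h₁ K₂ h₂
  have h4 : |(inner ℝ (g i K₁) (K₂ - K₁) : ℝ)| ≤ G * δ :=
    (abs_real_inner_le_norm _ _).trans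
      (mul_le_mul (h.norm_grad_le i K₁ h₁) h₂ (norm_nonneg _) h.G_nonneg)
  have h5 : L * ‖K₂ - K₁‖ ^ 2 ≤ L * δ ^ 2 := by gcongr
  have h6 := hB K₁ h₁
  have h7 := neg_abs_le c
  have h8 := le_abs_self c
  rw [abs_le] at h3 h4 h6 ⊢
  constructor <;> linarith [h3.1, h3.2, h4.1, h4.2, h6.1, h6.2]

/-- Linear convergence of the expected optimality gap, on the event that the iterates stay
in `C`. -/
theorem SmoothFamily.gap_bound (h : SmoothFamily J g C L G δ ε) (hU : IsUniformDirections P u)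
    (hx : 1 ≤ nx) (hu : 1 ≤ nu) (hm : 1 ≤ m) (hbs : 1 ≤ bs) (hr : 0 < r) (hrδ : r ≤ δ)
    (hη : 0 < η) (hηδ : η * ((nx * nu) * (G + L * δ)) ≤ δ)
    (hτ : ∀ s n, sched.delay s n ≤ τ) (h0 : ∀ ω, K 0 ω = K₀) (hK₀ : K₀ ∈ C)
    (hrun : ∀ n ω, K (n + 1) ω = K n ω - η •
      aggEstimate J r sched (fun n s l => u n s l ω) (fun n => K n ω) n)
    {i : Fin M} {B Jopt lam : ℝ} (hB : ∀ K ∈ C, |J i K| ≤ B)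
    (hopt : ∀ K ∈ C, ∀ K', ‖K' - K‖ ≤ δ → Jopt ≤ J i K') (hlam : 0 < lam)
    (hPL : ∀ K ∈ C, lam * (J i K - Jopt) ≤ ‖g i K‖ ^ 2) (hρ : 0 < 1 - η * lam / 4)
    (hw : 1 / 2 ≤ (1 - η * lam / 4) ^ (2 * τ)) {ζ : ℝ}
    (hζ : ζ = 9 * L ^ 2 * (nx * nu) ^ 2 * η ^ 3 * τ ^ 2 + 3 * (nx * nu) ^ 2 * L * η ^ 2)
    (hζη : ζ * ((2 * τ : ℕ) + 1) * 2 ≤ η / 2) (N : ℕ) :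
    (∀ᵐ ω ∂P, ω ∈ stayEvent C K N → ∃ K' ∈ C, ‖K N ω - K'‖ ≤ δ) ∧
    IntegrableOn (fun ω => J i (K N ω) - Jopt) (stayEvent C K N) P ∧
    ∫ ω in stayEvent C K N, (J i (K N ω) - Jopt) ∂P ≤
      (1 - η * lam / 4) ^ N * (J i K₀ - Jopt) +
        (3 * η * (nx * nu) ^ 2 + ζ) * (ε ^ 2 + L ^ 2 * r ^ 2) / (η * lam / 4) := by
  have hL := h.L_pos
  have hζ0 : 0 ≤ ζ := by rw [hζ]; positivity
  have hKm := measurable_iterate h.measurable_cost h0 hrun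
  have hKm' (n : ℕ) : Measurable (K n) := (hKm n).mono (hU.history_le n) le_rfl
  have hE (n : ℕ) : MeasurableSet (stayEvent C K n) := by
    cases n with
    | zero => simp [stayEvent]
    | succ n => exact hU.history_le n _ (measurableSet_stayEvent h.measurableSet hKm n)
  have hdesc : ∀ᵐ ω ∂P, ∀ n, ω ∈ stayEvent C K (n + 1) → ‖K (n + 1) ω - K n ω‖ ≤ δ ∧
      J i (K (n + 1) ω) ≤ J i (K n ω) - η * inner ℝ (g i (K n ω))
        (aggLinear g sched (fun n s l => u n s l ω) (fun n => K n ω) n -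
          aggGrad g sched (fun n => K n ω) n) -
      3 / 4 * η * ‖g i (K n ω)‖ ^ 2 + 3 * η * (nx * nu) ^ 2 * (ε ^ 2 + L ^ 2 * r ^ 2) +
      (9 * L ^ 2 * (nx * nu) ^ 2 * η ^ 3 * τ ^ 2 + 3 * (nx * nu) ^ 2 * L * η ^ 2) *
        (∑ k ∈ Finset.Icc (n - 2 * τ) n, ‖g i (K k ω)‖ ^ 2 + (ε ^ 2 + L ^ 2 * r ^ 2)) := by
    filter_upwards [hU.ae_norm] with ω hω n hn
    exact h.descent (K := fun n => K n ω) (u := fun n s l => u n s l ω) hx hu hm hbs hr hrδ hη hηδ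
      hτ (fun n => hrun n ω) (n := n) (fun k hk => hn k (by omega)) hω i
  -- On the event the n-th iterate itself may have left C, but it is one step away from it; this
  -- still gives integrability and nonnegativity of the gap.
  have hnear : ∀ᵐ ω ∂P, ∀ n, ω ∈ stayEvent C K n → ∃ K' ∈ C, ‖K n ω - K'‖ ≤ δ := by
    filter_upwards [hdesc] with ω hω n hn
    cases n with
    | zero => exact ⟨K₀, hK₀, by simpa [h0 ω] using h.δ_pos.le⟩
    | succ n => exact ⟨K n ω, hn n (Nat.lt_succ_self n), (hω n hn).1⟩
  have hgap_int (n : ℕ) :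
      IntegrableOn (fun ω => J i (K n ω) - Jopt) (stayEvent C K n) P := by
    refine Integrable.of_bound (C := B + G * δ + L * δ ^ 2 + |Jopt|)
      (((h.measurable_cost i).comp (hKm' n)).sub_const _).aestronglyMeasurable ?_
    rw [ae_restrict_iff' (hE n)]
    filter_upwards [hnear] with ω hω hn
    obtain ⟨K', hK', hd⟩ := hω n hn
    exact h.abs_cost_sub_le hB Jopt hK' hd
  have hgap_nonneg (n : ℕ) :
      0 ≤ᵐ[P.restrict (stayEvent C K n)] fun ω => J i (K n ω) - Jopt := by
    rw [Filter.EventuallyLE, ae_restrict_iff' (hE n)]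
    filter_upwards [hnear] with ω hω hn
    obtain ⟨K', hK', hd⟩ := hω n hn
    exact sub_nonneg.mpr (hopt K' hK' _ hd)
  have hX_int (k : ℕ) :
      IntegrableOn (fun ω => ‖g i (K k ω)‖ ^ 2) (stayEvent C K (k + 1)) P := by
    refine Integrable.of_bound (C := G ^ 2)
      (((h.measurable_grad i).comp (hKm' k)).norm.pow_const 2).aestronglyMeasurable ?_
    rw [ae_restrict_iff' (hE (k + 1))]
    refine Filter.Eventually.of_forall fun ω hω => ?_
    rw [Real.norm_of_nonneg (by positivity)]
    have := h.norm_grad_le i _ (hω k (Nat.lt_succ_self k))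
    gcongr
  have hq0 : 0 ≤ ε ^ 2 + L ^ 2 * r ^ 2 := by positivity
  refine ⟨hnear.mono fun ω hω => hω N, hgap_int N, ?_⟩
  have hrec := le_of_window_recursion (b := fun n => ∫ ω in stayEvent C K n, (J i (K n ω) - Jopt) ∂P)
    (X := fun n => ∫ ω in stayEvent C K (n + 1), ‖g i (K n ω)‖ ^ 2 ∂P)
    (ρ := 1 - η * lam / 4) (a := η / 2)
    (c := (3 * η * (nx * nu) ^ 2 + ζ) * (ε ^ 2 + L ^ 2 * r ^ 2)) (ζ := ζ) (w := 2 * τ) hρ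
    (by have := mul_pos hη hlam; linarith) hw (fun k => integral_nonneg fun ω => by positivity)
    (by positivity) hζ0 hζη ?_ N
  · simpa [stayEvent, h0] using hrec
  intro n
  obtain ⟨hξi, hξ⟩ := h.setIntegral_noise (sched := sched) hU hx hu hm hKm i n
  set F := stayEvent C K (n + 1) with hF
  set ξ : Ω → ℝ := fun ω => inner ℝ (g i (K n ω))
      (aggLinear g sched (fun n s l => u n s l ω) (fun n => K n ω) n -
        aggGrad g sched (fun n => K n ω) n) with hξdef
  have hi1 : IntegrableOn (fun ω => J i (K n ω) - Jopt) F P :=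
    (hgap_int n).mono_set (stayEvent_anti n.le_succ)
  have hi2 (k : ℕ) (hk : k ≤ n) : IntegrableOn (fun ω => ‖g i (K k ω)‖ ^ 2) F P :=
    (hX_int k).mono_set (stayEvent_anti (Nat.succ_le_succ hk))
  have hi3 : IntegrableOn (fun ω => ∑ k ∈ Finset.Icc (n - 2 * τ) n, ‖g i (K k ω)‖ ^ 2) F P :=
    integrable_finsetSum _ fun k hk => hi2 k (Finset.mem_Icc.mp hk).2
  -- The coefficient 3/4 is split: 1/4 becomes the contraction by gradient dominance, 1/2 is kept
  -- against the window sum.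
  have hpt : ∀ᵐ ω ∂P.restrict F, J i (K (n + 1) ω) - Jopt ≤
      (1 - η * lam / 4) * (J i (K n ω) - Jopt) - η / 2 * ‖g i (K n ω)‖ ^ 2 - η * ξ ω +
        (3 * η * (nx * nu : ℝ) ^ 2 + ζ) * (ε ^ 2 + L ^ 2 * r ^ 2) +
        ζ * ∑ k ∈ Finset.Icc (n - 2 * τ) n, ‖g i (K k ω)‖ ^ 2 := by
    rw [ae_restrict_iff' (hE (n + 1))]
    filter_upwards [hdesc] with ω hω hn
    have h1 := (hω n hn).2
    have h2 := hPL _ (hn n (Nat.lt_succ_self n))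
    rw [← hζ] at h1
    have h3 := mul_le_mul_of_nonneg_left h2 hη.le
    linarith
  obtain ⟨hint, e⟩ := integral_combination hi1 (hi2 n le_rfl) hξi hi3 (1 - η * lam / 4) (η / 2) η
    ((3 * η * (nx * nu : ℝ) ^ 2 + ζ) * (ε ^ 2 + L ^ 2 * r ^ 2)) ζ
  refine (integral_mono_ae (hgap_int (n + 1)) hint hpt).trans (e.trans_le ?_)
  rw [hξ, integral_finsetSum _ fun k hk => hi2 k (Finset.mem_Icc.mp hk).2]
  -- The descent holds on the smaller event; enlarging it back to the event of iteration n is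
  -- allowed because the gap is nonnegative there.
  have h1 : ∫ ω in F, (J i (K n ω) - Jopt) ∂P ≤
      ∫ ω in stayEvent C K n, (J i (K n ω) - Jopt) ∂P :=
    setIntegral_mono_set (hgap_int n) (hgap_nonneg n)
      (stayEvent_anti n.le_succ).eventuallyLE
  have h2 : ∑ k ∈ Finset.Icc (n - 2 * τ) n, ∫ ω in F, ‖g i (K k ω)‖ ^ 2 ∂P ≤
      ∑ k ∈ Finset.Icc (n - 2 * τ) n, ∫ ω in stayEvent C K (k + 1), ‖g i (K k ω)‖ ^ 2 ∂P :=
    Finset.sum_le_sum fun k hk => setIntegral_mono_set (hX_int k)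
      (Filter.Eventually.of_forall fun ω => by positivity)
      (stayEvent_anti (Nat.succ_le_succ (Finset.mem_Icc.mp hk).2)).eventuallyLE
  have h3 : (P.restrict F).real Set.univ * ((3 * η * (nx * nu : ℝ) ^ 2 + ζ) * (ε ^ 2 + L ^ 2 * r ^ 2)) ≤
      (3 * η * (nx * nu : ℝ) ^ 2 + ζ) * (ε ^ 2 + L ^ 2 * r ^ 2) :=
    mul_le_of_le_one_left (by positivity)
      ((measureReal_restrict_apply_univ F).trans_le measureReal_le_one)
  have h4 := mul_le_mul_of_nonneg_left h1 hρ.le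
  have h5 := mul_le_mul_of_nonneg_left h2 hζ0
  linarith

end GapBound

end AsyncLQR

namespace AsyncLQR

open scoped MatrixOrder

/-! ### The costs as a smooth family on the sublevel set, and the size of λ. -/

section Landscape

variable {nx nu M : ℕ}

lemma hasGradientAt_of_expansion {E : Type*} [NormedAddCommGroup E] [InnerProductSpace ℝ E]
    [CompleteSpace E] {f : E → ℝ} {v x : E} {L δ : ℝ} (hL : 0 < L) (hδ : 0 < δ)
    (h : ∀ y, ‖y - x‖ ≤ δ → |f y - f x - inner ℝ v (y - x)| ≤ L * ‖y - x‖ ^ 2) :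
    HasGradientAt f v x := by
  rw [hasGradientAt_iff_isLittleO, Asymptotics.isLittleO_iff]
  intro c hc
  have hpos : 0 < min δ (c / L) := by positivity
  filter_upwards [Metric.closedBall_mem_nhds x hpos] with y hy
  rw [Metric.mem_closedBall, dist_eq_norm] at hy
  refine (h y (hy.trans (min_le_left _ _))).trans ?_
  have h1 := hy.trans (min_le_right _ _)
  rw [le_div_iff₀ hL] at h1
  nlinarith [norm_nonneg (y - x)]

lemma smul_one_le_imp_le_norm {n : ℕ} (hn : 1 ≤ n) {X : Matrix (Fin n) (Fin n) ℝ} {c : ℝ}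
    (h : c • 1 ≤ X) : c ≤ ‖X‖ := by
  have h1 := trace_mono h
  have h2 := (le_abs_self _).trans (abs_trace_le X)
  rw [Matrix.trace_smul, Matrix.trace_one, Fintype.card_fin, smul_eq_mul] at h1
  have hn' : (0 : ℝ) < n := by exact_mod_cast hn
  refine le_of_mul_le_mul_left ?_ hn'
  linarith

variable {sys : Fin M → LQRSystem nx nu} {X₀ : Measure (Fin nx → ℝ)} {κ μ γ εA εB εQ εR : ℝ}
  {K₀ : Gain nx nu} {Kstar : Fin M → Gain nx nu}

lemma IsInitialDistribution.smul_one_le (h : IsInitialDistribution X₀ μ) :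
    μ • 1 ≤ secondMoment X₀ :=
  Matrix.le_iff.mpr h.cov_pos.posSemidef

lemma ParamBound.params (hκ : 0 < κ) (h : ParamBound κ sys X₀ K₀ γ μ)
    (hQ : ∀ i, (sys i).Q.PosDef) (hR : ∀ i, (sys i).R.PosDef)
    (hX : IsInitialDistribution X₀ μ) (i : Fin M) : (sys i).Params κ X₀ where
  pos := hκ
  norm_A := h.norm_A i
  norm_B := h.norm_B i
  norm_Q := h.norm_Q i
  norm_R := h.norm_R i
  Q_ge := (smul_le_smul_of_nonneg_right (h.sigmaMin_Q i) LQRSystem.zero_le_one_matrix).trans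
    (sigmaMin_smul_one_le (hQ i))
  R_ge := (smul_le_smul_of_nonneg_right (h.sigmaMin_R i) LQRSystem.zero_le_one_matrix).trans
    (sigmaMin_smul_one_le (hR i))
  cov_ge := (smul_le_smul_of_nonneg_right h.init_cov LQRSystem.zero_le_one_matrix).trans
    hX.smul_one_le
  init := ⟨μ, hX⟩

/-- Membership gives J(K) ≤ γ J(K₀) - (γ - 1) J(K*), and the last term has a sign. -/
lemma ParamBound.cost_le (h : ParamBound κ sys X₀ K₀ γ μ) (hγ : 1 ≤ γ) {K : Gain nx nu}
    (hK : K ∈ sublevel sys X₀ Kstar K₀ γ) (i : Fin M) : (sys i).cost X₀ K ≤ κ := by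
  have h1 := (hK i).2
  have h2 := h.init_cost i
  have h3 := LQRSystem.cost_nonneg (sys i) X₀ (Kstar i)
  nlinarith

lemma LQRSystem.Params.isOpen_stabilizing {S : LQRSystem nx nu} (h : S.Params κ X₀) :
    IsOpen S.stabilizing := by
  rw [Metric.isOpen_iff]
  intro K hK
  obtain ⟨δ, c', hδ, hn⟩ := exists_nbhd (nx := nx) (nu := nu) κ (S.cost X₀ K) h.pos
  refine ⟨δ, hδ, fun K' hK' => (hn S X₀ K K' h hK le_rfl ?_).1⟩
  rw [Metric.mem_ball, dist_eq_norm] at hK'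
  exact hK'.le

lemma measurableSet_sublevel [SFinite X₀] (h : ∀ i, (sys i).Params κ X₀) :
    MeasurableSet (sublevel sys X₀ Kstar K₀ γ) := by
  have e : sublevel sys X₀ Kstar K₀ γ = ⋂ i, (sys i).stabilizing ∩
      {K | (sys i).cost X₀ K - (sys i).cost X₀ (Kstar i)
        ≤ γ * ((sys i).cost X₀ K₀ - (sys i).cost X₀ (Kstar i))} := by
    ext K; simp [sublevel]
  rw [e]
  exact MeasurableSet.iInter fun i => (h i).isOpen_stabilizing.measurableSet.inter
    (measurableSet_le ((LQRSystem.measurable_cost _).sub_const _) measurable_const)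

variable (nx nu)

/-- The costs form a smooth family on the sublevel set, with constants that depend on the
dimensions and on `κ` only. -/
lemma exists_smoothFamily (hx : 1 ≤ nx) (hκ : 0 < κ) :
    ∃ L G δ, 0 < L ∧ 0 ≤ G ∧ 0 < δ ∧
    ∀ (M : ℕ) (sys : Fin M → LQRSystem nx nu) (X₀ : Measure (Fin nx → ℝ))
      (μ γ εA εB εQ εR : ℝ) (K₀ : Gain nx nu) (Kstar : Fin M → Gain nx nu),
      (∀ i, (sys i).Params κ X₀) → IsInitialDistribution X₀ μ → 1 ≤ γ →
      0 < εA → 0 < εB → 0 < εQ → 0 < εR → HetBound sys εA εB εQ εR →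
      ParamBound κ sys X₀ K₀ γ μ →
      SmoothFamily (fun i => (sys i).cost X₀) (fun i => gradient ((sys i).cost X₀))
        (sublevel sys X₀ Kstar K₀ γ) L G δ (L * (εA + εB + εQ + εR)) ∧
      (∀ i, ∀ K ∈ sublevel sys X₀ Kstar K₀ γ,
        gradient ((sys i).cost X₀) K = (sys i).policyGrad X₀ K) ∧
      (∀ i, ∀ K ∈ sublevel sys X₀ Kstar K₀ γ, ∀ K' ∈ sublevel sys X₀ Kstar K₀ γ,
        ‖gradient ((sys i).cost X₀) K' - gradient ((sys i).cost X₀) K‖ ≤ L * ‖K' - K‖) ∧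
      ∀ i, ∀ K ∈ sublevel sys X₀ Kstar K₀ γ, ∀ K', ‖K' - K‖ ≤ δ → K' ∈ (sys i).stabilizing := by
  -- On the sublevel set the cost is at most κ. Within δ of it the cost is at most c', and β belongs
  -- to this larger level, so both ends of an expansion are covered.
  obtain ⟨δ, c', hδ, hnbhd⟩ := LQRSystem.exists_nbhd (nx := nx) (nu := nu) κ κ hκ
  obtain ⟨β, hβ, hbdd⟩ := LQRSystem.exists_bdd (nx := nx) (nu := nu) κ c'
  obtain ⟨L₁, hL₁, hlip⟩ := LQRSystem.exists_policyGrad_lipschitz nx nu hx β hβ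
  obtain ⟨L₂, hL₂, hexp⟩ := LQRSystem.exists_cost_expansion nx nu β hβ
  refine ⟨L₁ + L₂, L₁, δ, by positivity, hL₁.le, hδ, ?_⟩
  intro M sys X₀ μ γ εA εB εQ εR K₀ Kstar hpar hX hγ hA hB hQ hR hhet hpb
  have := hX.isProbabilityMeasure
  set C := sublevel sys X₀ Kstar K₀ γ with hC
  have hnear (i : Fin M) (K : Gain nx nu) (hK : K ∈ C) (K' : Gain nx nu) (hd : ‖K' - K‖ ≤ δ) :=
    hnbhd (sys i) X₀ K K' (hpar i) (hK i).1 (hpb.cost_le hγ hK i) hd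
  have hbdd' (i : Fin M) (K : Gain nx nu) (hK : K ∈ C) (K' : Gain nx nu) (hd : ‖K' - K‖ ≤ δ) :
      LQRSystem.Bdd β (sys i) X₀ K' :=
    hbdd (sys i) X₀ K' (hpar i) (hnear i K hK K' hd).1 (hnear i K hK K' hd).2
  have hbdd0 (i : Fin M) (K : Gain nx nu) (hK : K ∈ C) : LQRSystem.Bdd β (sys i) X₀ K :=
    hbdd' i K hK K (by simpa using hδ.le)
  have hexpand (i : Fin M) (K : Gain nx nu) (hK : K ∈ C) (K' : Gain nx nu) (hd : ‖K' - K‖ ≤ δ) :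
      |(sys i).cost X₀ K' - (sys i).cost X₀ K - inner ℝ ((sys i).policyGrad X₀ K) (K' - K)| ≤
        (L₁ + L₂) * ‖K' - K‖ ^ 2 := by
    refine (hexp (sys i) X₀ K K' (hbdd0 i K hK) (hbdd' i K hK K' hd)).trans ?_
    gcongr
    linarith
  have hgrad (i : Fin M) (K : Gain nx nu) (hK : K ∈ C) :
      gradient ((sys i).cost X₀) K = (sys i).policyGrad X₀ K :=
    (hasGradientAt_of_expansion (by positivity) hδ (hexpand i K hK)).gradient
  have hlip_same (i : Fin M) (K : Gain nx nu) (hK : K ∈ C) (K' : Gain nx nu) (hK' : K' ∈ C) :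
      ‖(sys i).policyGrad X₀ K - (sys i).policyGrad X₀ K'‖ ≤ L₁ * ‖K - K'‖ :=
    (hlip ⟨sys i, sys i, K, K', X₀, ‖K - K'‖, hbdd0 i K hK, hbdd0 i K' hK', by simp, by simp,
      by simp, by simp, le_rfl⟩).2
  have hlip_same' (i : Fin M) (K : Gain nx nu) (hK : K ∈ C) (K' : Gain nx nu) (hK' : K' ∈ C) :
      ‖(sys i).policyGrad X₀ K - (sys i).policyGrad X₀ K'‖ ≤ (L₁ + L₂) * ‖K - K'‖ := by
    refine (hlip_same i K hK K' hK').trans ?_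
    gcongr
    linarith
  have hlip_het (i j : Fin M) (hij : i ≠ j) (K : Gain nx nu) (hK : K ∈ C) :
      ‖(sys i).policyGrad X₀ K - (sys j).policyGrad X₀ K‖ ≤ L₁ * (εA + εB + εQ + εR) :=
    (hlip ⟨sys i, sys j, K, K, X₀, εA + εB + εQ + εR, hbdd0 i K hK, hbdd0 j K hK,
      by linarith [hhet.A i j hij], by linarith [hhet.B i j hij], by linarith [hhet.Q i j hij],
      by linarith [hhet.R i j hij], by rw [sub_self, norm_zero]; positivity⟩).2
  refine ⟨?_, hgrad, fun i K hK K' hK' => ?_, fun i K hK K' hd => (hnear i K hK K' hd).1⟩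
  swap
  · rw [hgrad i K hK, hgrad i K' hK']
    exact hlip_same' i K' hK' K hK
  refine
    { L_pos := by positivity
      G_nonneg := hL₁.le
      δ_pos := hδ
      ε_nonneg := by positivity
      measurable_cost := fun i => LQRSystem.measurable_cost (sys i)
      measurable_grad := fun i =>
        (InnerProductSpace.toDual ℝ (Gain nx nu)).symm.continuous.measurable.comp
          (measurable_fderiv ℝ _)
      measurableSet := measurableSet_sublevel hpar
      expansion := fun i K hK K' hd => ?_
      norm_grad_le := fun i K hK => ?_
      grad_close := fun i j K hK K' hK' => ?_ }
  · rw [hgrad i K hK]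
    exact hexpand i K hK K' hd
  · rw [hgrad i K hK]
    exact (hlip ⟨sys i, sys i, K, K, X₀, 0, hbdd0 i K hK, hbdd0 i K hK, by simp, by simp,
      by simp, by simp, by simp⟩).1
  · rw [hgrad i K hK, hgrad j K' hK']
    have hsum : 0 < εA + εB + εQ + εR := by positivity
    have h1 : ‖(sys i).policyGrad X₀ K - (sys j).policyGrad X₀ K‖ ≤
        (L₁ + L₂) * (εA + εB + εQ + εR) := by
      by_cases hij : i = j
      · subst hij
        rw [sub_self, norm_zero]
        positivity
      · refine (hlip_het i j hij K hK).trans ?_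
        gcongr
        linarith
    have h2 := hlip_same' j K hK K' hK'
    have h3 := norm_sub_le_norm_sub_add_norm_sub ((sys i).policyGrad X₀ K)
      ((sys j).policyGrad X₀ K) ((sys j).policyGrad X₀ K')
    linarith

variable {nx nu}

lemma norm_stateCov_ge (hx : 1 ≤ nx) (hpar : ∀ i, (sys i).Params κ X₀)
    (hX : IsInitialDistribution X₀ μ) (i : Fin M) {K : Gain nx nu} (hK : K ∈ (sys i).stabilizing) :
    μ ≤ ‖(sys i).stateCov X₀ K‖ :=
  smul_one_le_imp_le_norm hx (hX.smul_one_le.trans ((hpar i).cov_le_stateCov hK))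

lemma gradDom_le (sys : Fin M → LQRSystem nx nu) (X₀ : Measure (Fin nx → ℝ))
    (Kstar : Fin M → Gain nx nu) (μ : ℝ) (i : Fin M) :
    gradDom sys X₀ Kstar μ ≤
      4 * μ ^ 2 * (sigmaMin (sys i).R / ‖(sys i).stateCov X₀ (Kstar i)‖) :=
  mul_le_mul_of_nonneg_left (ciInf_le (Set.finite_range _).bddBelow i) (by positivity)

lemma gradDom_pos [Nonempty (Fin M)] (hx : 1 ≤ nx) (hκ : 0 < κ) (hμ : 0 < μ)
    (hpar : ∀ i, (sys i).Params κ X₀) (hX : IsInitialDistribution X₀ μ)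
    (hpb : ParamBound κ sys X₀ K₀ γ μ) (hstab : ∀ i, Kstar i ∈ (sys i).stabilizing) :
    0 < gradDom sys X₀ Kstar μ := by
  obtain ⟨i, hi⟩ := exists_eq_ciInf_of_finite
    (f := fun i => sigmaMin (sys i).R / ‖(sys i).stateCov X₀ (Kstar i)‖)
  rw [gradDom, ← hi]
  have h1 := hμ.trans_le (norm_stateCov_ge hx hpar hX i (hstab i))
  have h2 := (inv_pos.mpr hκ).trans_le (hpb.sigmaMin_R i)
  positivity

/-- This lets `h` control λ. One factor μ cancels against ‖Σ_{K*}‖ ≥ μ; the other is at most tr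
Σ_{K₀} ≤ κ J(K₀) ≤ κ². -/
lemma gradDom_le_cube (hx : 1 ≤ nx) (hu : 1 ≤ nu) (hκ : 0 < κ) (hμ : 0 < μ) (hγ : 1 ≤ γ)
    (hR : ∀ i, (sys i).R.PosDef) (hpar : ∀ i, (sys i).Params κ X₀)
    (hX : IsInitialDistribution X₀ μ) (hpb : ParamBound κ sys X₀ K₀ γ μ)
    (hstab : ∀ i, Kstar i ∈ (sys i).stabilizing) (hK₀ : K₀ ∈ sublevel sys X₀ Kstar K₀ γ)
    (i : Fin M) : gradDom sys X₀ Kstar μ ≤ 4 * κ ^ 3 := by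
  have h1 := norm_stateCov_ge hx hpar hX i (hstab i)
  have h2 : sigmaMin (sys i).R ≤ κ :=
    (smul_one_le_imp_le_norm hu (sigmaMin_smul_one_le (hR i))).trans (hpb.norm_R i)
  have h3 : μ ≤ κ ^ 2 := by
    have h4 := norm_stateCov_ge hx hpar hX i (hK₀ i).1
    have h5 := norm_le_trace ((hpar i).stateCov_nonneg (hK₀ i).1)
    have h6 := (hpar i).trace_stateCov_le (hK₀ i).1
    have h7 := hpb.cost_le hγ hK₀ i
    nlinarith
  refine (gradDom_le sys X₀ Kstar μ i).trans ?_
  calc 4 * μ ^ 2 * (sigmaMin (sys i).R / ‖(sys i).stateCov X₀ (Kstar i)‖)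
      ≤ 4 * μ ^ 2 * (κ / μ) := by gcongr
    _ = 4 * μ * κ := by field_simp
    _ ≤ 4 * κ ^ 2 * κ := by gcongr
    _ = _ := by ring

/-- Optimality enters only through the sign of the gap, which permits replacing the minimum in λ by
the term of system i. -/
lemma gradDom_mul_gap_le (hx : 1 ≤ nx) (hκ : 0 < κ) (hμ : 0 < μ)
    (hR : ∀ i, (sys i).R.PosDef) (hpar : ∀ i, (sys i).Params κ X₀)
    (hX : IsInitialDistribution X₀ μ) (hpb : ParamBound κ sys X₀ K₀ γ μ)
    (hopt : ∀ i, (sys i).IsOptimal X₀ (Kstar i)) (i : Fin M) {K : Gain nx nu}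
    (hK : K ∈ (sys i).stabilizing) :
    gradDom sys X₀ Kstar μ * ((sys i).cost X₀ K - (sys i).cost X₀ (Kstar i)) ≤
      ‖(sys i).policyGrad X₀ K‖ ^ 2 := by
  have h1 := hμ.trans_le (norm_stateCov_ge hx hpar hX i (hopt i).1)
  have h2 := (inv_pos.mpr hκ).trans_le (hpb.sigmaMin_R i)
  have h3 := (hpar i).gradient_dominance hμ h2 hX.smul_one_le (sigmaMin_smul_one_le (hR i)) hK
    (hopt i).1
  have h4 := mul_le_mul_of_nonneg_right (gradDom_le sys X₀ Kstar μ i)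
    (sub_nonneg.mpr ((hopt i).2 K hK))
  refine h4.trans (le_of_mul_le_mul_left ?_ h1)
  refine le_trans (le_of_eq ?_) h3
  field_simp

end Landscape

/-! ### Consequences of the step size condition. -/

section StepSize

variable {bs : ℕ} {τmax h cstep cbias η : ℝ}

lemma le_of_le_etaGap (hh : 0 < h) (hτ : 1 ≤ τmax) (hη : 0 < η)
    (hle : η ≤ etaGap bs τmax h cstep cbias) :
    8 * (η * h) ≤ 1 ∧ 8 * (η * h * τmax) ≤ 1 ∧ 2 * (η ^ 2 * h ^ 2 * τmax ^ 3) ≤ 1 := by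
  have hτ0 : 0 < τmax := one_pos.trans_le hτ
  have h1 : η ≤ 1 / 8 / h := (hle.trans (min_le_left _ _)).trans
    (div_le_div_of_nonneg_right (min_le_left _ _) hh.le)
  have h2 := hle.trans ((min_le_right _ _).trans (min_le_left _ _))
  have hpos : 0 < h * max (8 * τmax) (√2 * τmax ^ (3 / 2 : ℝ)) :=
    mul_pos hh (lt_max_of_lt_left (by positivity))
  rw [le_div_iff₀ hpos, ← mul_assoc] at h2
  rw [le_div_iff₀ hh] at h1
  have hηh : 0 < η * h := mul_pos hη hh
  have h3 : η * h * (8 * τmax) ≤ 1 := (mul_le_mul_of_nonneg_left (le_max_left _ _) hηh.le).trans h2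
  have h4 : (η * h * (√2 * τmax ^ (3 / 2 : ℝ))) ^ 2 ≤ 1 :=
    pow_le_one₀ (by positivity) ((mul_le_mul_of_nonneg_left (le_max_right _ _) hηh.le).trans h2)
  have h5 : (τmax ^ (3 / 2 : ℝ)) ^ 2 = τmax ^ 3 := by
    rw [← Real.rpow_natCast, ← Real.rpow_mul hτ0.le]
    norm_num
  rw [mul_pow, mul_pow, mul_pow, h5, Real.sq_sqrt (by norm_num)] at h4
  clear hle hpos h2 h5
  exact ⟨by linarith, by linarith, by linarith⟩

end StepSize

end AsyncLQR

namespace AsyncLQR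

section Constants

/-- Bernoulli's inequality, with ηλ/4 ≤ ηh and 2τ·ηh ≤ 1/4. -/
lemma half_le_one_sub_pow {η lam h κ τmax : ℝ} {τ : ℕ} (hη : 0 < η) (hlam : 0 < lam)
    (hlam' : lam ≤ 4 * κ ^ 3) (hκh : κ ^ 3 ≤ h) (hτ : (τ : ℝ) ≤ τmax)
    (h1 : 8 * (η * h) ≤ 1) (h2 : 8 * (η * h * τmax) ≤ 1) :
    0 < 1 - η * lam / 4 ∧ 1 / 2 ≤ (1 - η * lam / 4) ^ (2 * τ) := by
  have h3 : η * lam ≤ 4 * (η * h) := by nlinarith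
  have h4 : η * h * τ ≤ η * h * τmax := by
    have : 0 < η * h := by nlinarith [mul_pos hη hlam]
    gcongr
  refine ⟨by linarith, ?_⟩
  have h5 := one_add_mul_le_pow (a := -(η * lam / 4)) (by linarith) (2 * τ)
  rw [← sub_eq_add_neg] at h5
  refine le_trans ?_ h5
  have h6 : η * lam * τ ≤ 4 * (η * h) * τ := by gcongr
  push_cast
  linarith

/-- Since 2τ + 1 ≤ 3τ it suffices to bound 6ζτ. The staleness part of ζ is controlled by η²h²τ³ ≤
1/2, the second order part by ηhτ ≤ 1/8, and 11 is large enough for 54/242 + 18/88 ≤ 1/2. -/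
lemma window_coeff_le {η h τmax D L ζ : ℝ} {τ : ℕ} (hη : 0 < η) (hh : 0 < h) (hL : 0 < L)
    (hD : 1 ≤ D) (hDh : 11 * D ^ 2 * L ≤ h) (hτ : (τ : ℝ) ≤ τmax) (hτ1 : 1 ≤ τ)
    (h2 : 8 * (η * h * τmax) ≤ 1) (h3 : 2 * (η ^ 2 * h ^ 2 * τmax ^ 3) ≤ 1)
    (hζ : ζ = 9 * L ^ 2 * D ^ 2 * η ^ 3 * τ ^ 2 + 3 * D ^ 2 * L * η ^ 2) :
    ζ * ((2 * τ : ℕ) + 1) * 2 ≤ η / 2 := by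
  have ht : (1 : ℝ) ≤ τ := by exact_mod_cast hτ1
  have hζ0 : 0 ≤ ζ := by rw [hζ]; positivity
  have e1 : ζ * ((2 * τ : ℕ) + 1) * 2 ≤ 6 * (ζ * τ) := by
    push_cast
    nlinarith
  have a1 : η * h * τ ≤ 1 / 8 := by
    have : η * h * τ ≤ η * h * τmax := by gcongr
    linarith
  have a2 : η ^ 2 * h ^ 2 * (τ : ℝ) ^ 3 ≤ 1 / 2 := by
    have : η ^ 2 * h ^ 2 * (τ : ℝ) ^ 3 ≤ η ^ 2 * h ^ 2 * τmax ^ 3 := by gcongr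
    linarith
  have b1 : 11 * (D ^ 2 * L * (η * τ)) ≤ 1 / 8 := by
    calc 11 * (D ^ 2 * L * (η * τ)) = 11 * D ^ 2 * L * (η * τ) := by ring
      _ ≤ h * (η * τ) := by gcongr
      _ = η * h * τ := by ring
      _ ≤ _ := a1
  have hDh' : 11 * (D * L) ≤ h := by
    refine le_trans ?_ hDh
    have : D * L ≤ D ^ 2 * L := by gcongr; nlinarith
    linarith
  have b2 : 121 * (L ^ 2 * D ^ 2 * (η ^ 2 * (τ : ℝ) ^ 3)) ≤ 1 / 2 := by
    calc 121 * (L ^ 2 * D ^ 2 * (η ^ 2 * (τ : ℝ) ^ 3)) =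
        (11 * (D * L)) ^ 2 * (η ^ 2 * (τ : ℝ) ^ 3) := by ring
      _ ≤ h ^ 2 * (η ^ 2 * (τ : ℝ) ^ 3) := by gcongr
      _ = η ^ 2 * h ^ 2 * (τ : ℝ) ^ 3 := by ring
      _ ≤ _ := a2
  have e2 : 6 * (ζ * τ) = η * (54 * (L ^ 2 * D ^ 2 * (η ^ 2 * (τ : ℝ) ^ 3)) +
      18 * (D ^ 2 * L * (η * τ))) := by rw [hζ]; ring
  rw [e2] at e1
  refine e1.trans ?_
  have : 54 * (L ^ 2 * D ^ 2 * (η ^ 2 * (τ : ℝ) ^ 3)) + 18 * (D ^ 2 * L * (η * τ)) ≤ 1 / 2 := by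
    linarith
  calc _ ≤ η * (1 / 2) := by gcongr
    _ = η / 2 := by ring

/-- Since ζ ≤ η the coefficient is at most 4ηD², and dividing by ηλ/4 leaves 16D²/λ. This factor
goes into C_het for the heterogeneity part and into h² for the bias part. -/
lemma residual_le {η h D L ζ lam r σ : ℝ} {w nx : ℕ} (hη : 0 < η) (hlam : 0 < lam) (hL : 0 < L)
    (hD : 1 ≤ D) (hDh : 11 * D ^ 2 * L ≤ h) (hx : 1 ≤ nx) (hζ0 : 0 ≤ ζ)
    (hζ : ζ * (w + 1) * 2 ≤ η / 2) :
    (3 * η * D ^ 2 + ζ) * ((L * σ) ^ 2 + L ^ 2 * r ^ 2) / (η * lam / 4) ≤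
      lam⁻¹ * (1 * nx ^ 2 * (16 * D ^ 2 * L ^ 2 * σ ^ 2) + 1 * h ^ 2 * r ^ 2) := by
  have hζη : ζ ≤ η := by nlinarith [mul_nonneg hζ0 (Nat.cast_nonneg (α := ℝ) w)]
  have hD2 : 1 ≤ D ^ 2 := one_le_pow₀ hD
  have hx' : (1 : ℝ) ≤ nx ^ 2 := one_le_pow₀ (by exact_mod_cast hx)
  have h1 : 3 * η * D ^ 2 + ζ ≤ 4 * η * D ^ 2 := by nlinarith
  have h2 : 16 * D ^ 2 * L ^ 2 ≤ h ^ 2 := by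
    calc 16 * D ^ 2 * L ^ 2 ≤ 121 * (D ^ 2 * D ^ 2) * L ^ 2 := by
          gcongr
          · norm_num
          · exact le_mul_of_one_le_left (by positivity) hD2
      _ = (11 * D ^ 2 * L) ^ 2 := by ring
      _ ≤ _ := by gcongr
  rw [div_le_iff₀ (by positivity)]
  calc (3 * η * D ^ 2 + ζ) * ((L * σ) ^ 2 + L ^ 2 * r ^ 2)
      ≤ 4 * η * D ^ 2 * ((L * σ) ^ 2 + L ^ 2 * r ^ 2) := by gcongr
    _ = η / 4 * (1 * (16 * D ^ 2 * L ^ 2 * σ ^ 2) + 16 * D ^ 2 * L ^ 2 * r ^ 2) := by ring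
    _ ≤ η / 4 * (nx ^ 2 * (16 * D ^ 2 * L ^ 2 * σ ^ 2) + h ^ 2 * r ^ 2) := by gcongr
    _ = _ := by field_simp

end Constants

end AsyncLQR

/-! ### Choice of the constants and assembly. -/

theorem theorem2 :
    -- absolute constants
    ∃ c₁ c₂ c₃ : ℝ, 0 < c₁ ∧ 0 < c₂ ∧ 0 < c₃ ∧
    -- constants that depend on the dimensions and on a bound `κ` of the problem parameters only
    ∀ (nx nu : ℕ), 1 ≤ nx → 1 ≤ nu → ∀ κ : ℝ, 0 < κ →
    ∃ h Chet r₀ : ℝ, 0 < h ∧ 0 < Chet ∧ 0 < r₀ ∧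
    ∀ (M : ℕ) (sys : Fin M → AsyncLQR.LQRSystem nx nu) (X₀ : Measure (Fin nx → ℝ))
      (μ γ εA εB εQ εR : ℝ) (K₀ : AsyncLQR.Gain nx nu) (Kstar : Fin M → AsyncLQR.Gain nx nu),
    (∀ i, (sys i).Q.PosDef) → (∀ i, (sys i).R.PosDef) →
    0 < μ → AsyncLQR.IsInitialDistribution X₀ μ →
    (∀ i, (sys i).IsOptimal X₀ (Kstar i)) →
    1 ≤ γ → K₀ ∈ AsyncLQR.sublevel sys X₀ Kstar K₀ γ →
    0 < εA → 0 < εB → 0 < εQ → 0 < εR → AsyncLQR.HetBound sys εA εB εQ εR →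
    AsyncLQR.ParamBound κ sys X₀ K₀ γ μ →
    -- `h` is a Lipschitz constant of the gradients on the sublevel set
    (∀ i, ∀ K ∈ AsyncLQR.sublevel sys X₀ Kstar K₀ γ, ∀ K' ∈ AsyncLQR.sublevel sys X₀ Kstar K₀ γ,
      ‖gradient ((sys i).cost X₀) K' - gradient ((sys i).cost X₀) K‖ ≤ h * ‖K' - K‖) ∧
    -- `ε_het = Chet (εA + εB + εQ + εR)²` bounds the gradient heterogeneity there
    (∀ i j, i ≠ j → ∀ K ∈ AsyncLQR.sublevel sys X₀ Kstar K₀ γ,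
      ‖gradient ((sys i).cost X₀) K - gradient ((sys j).cost X₀) K‖ ^ 2
        ≤ Chet * (εA + εB + εQ + εR) ^ 2) ∧
    -- the optimality gap, for every run of the asynchronous method
    ∀ (bs m N : ℕ) (τmax η r : ℝ) (sched : AsyncLQR.Schedule M bs τmax)
      {Ω : Type*} [MeasurableSpace Ω] (P : Measure Ω) [IsProbabilityMeasure P]
      (u : ℕ → Fin M → Fin m → Ω → AsyncLQR.Gain nx nu) (K : ℕ → Ω → AsyncLQR.Gain nx nu),
    1 ≤ bs → 1 ≤ m → 1 ≤ τmax → 0 < r → r ≤ r₀ → 0 < η →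
    η ≤ AsyncLQR.etaGap bs τmax h (c₁ * (nx ^ 2 + nx ^ 2 / bs)) (c₃ * h ^ 2 * r ^ 2) →
    AsyncLQR.IsUniformDirections P u →
    AsyncLQR.IsRun sys X₀ sched η r K₀ u K →
    -- contraction rate in `(0, 1)`
    (0 < 1 - η * AsyncLQR.gradDom sys X₀ Kstar μ / 4 ∧
      1 - η * AsyncLQR.gradDom sys X₀ Kstar μ / 4 < 1) ∧
    ∀ i,
      -- while the iterates stay in the sublevel set, the next one is stabilizing
      (∀ᵐ ω ∂P, (∀ n < N, K n ω ∈ AsyncLQR.sublevel sys X₀ Kstar K₀ γ) →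
        K N ω ∈ (sys i).stabilizing) ∧
      -- the bound in expectation on the event that the iterates stay in the sublevel set
      IntegrableOn (fun ω => (sys i).cost X₀ (K N ω) - (sys i).cost X₀ (Kstar i))
        {ω | ∀ n < N, K n ω ∈ AsyncLQR.sublevel sys X₀ Kstar K₀ γ} P ∧
      ∫ ω in {ω | ∀ n < N, K n ω ∈ AsyncLQR.sublevel sys X₀ Kstar K₀ γ},
          ((sys i).cost X₀ (K N ω) - (sys i).cost X₀ (Kstar i)) ∂P
        ≤ (1 - η * AsyncLQR.gradDom sys X₀ Kstar μ / 4) ^ N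
              * ((sys i).cost X₀ K₀ - (sys i).cost X₀ (Kstar i))
          + (AsyncLQR.gradDom sys X₀ Kstar μ)⁻¹
              * (c₂ * nx ^ 2 * (Chet * (εA + εB + εQ + εR) ^ 2) + c₃ * h ^ 2 * r ^ 2) ∧
      -- the bound for the full expectation when they stay in it almost surely
      ((∀ᵐ ω ∂P, ∀ n < N, K n ω ∈ AsyncLQR.sublevel sys X₀ Kstar K₀ γ) →
        Integrable (fun ω => (sys i).cost X₀ (K N ω) - (sys i).cost X₀ (Kstar i)) P ∧
        ∫ ω, ((sys i).cost X₀ (K N ω) - (sys i).cost X₀ (Kstar i)) ∂P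
          ≤ (1 - η * AsyncLQR.gradDom sys X₀ Kstar μ / 4) ^ N
                * ((sys i).cost X₀ K₀ - (sys i).cost X₀ (Kstar i))
            + (AsyncLQR.gradDom sys X₀ Kstar μ)⁻¹
                * (c₂ * nx ^ 2 * (Chet * (εA + εB + εQ + εR) ^ 2) + c₃ * h ^ 2 * r ^ 2)) := by
  refine ⟨1, 1, 1, one_pos, one_pos, one_pos, fun nx nu hx hu κ hκ => ?_⟩
  obtain ⟨L, G, δ, hL, hG, hδ, hfam⟩ := AsyncLQR.exists_smoothFamily nx nu hx hκ
  have hx1 : (1 : ℝ) ≤ nx := by exact_mod_cast hx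
  have hu1 : (1 : ℝ) ≤ nu := by exact_mod_cast hu
  have hD : (1 : ℝ) ≤ nx * nu := by nlinarith
  have hD2 : (1 : ℝ) ≤ (nx * nu : ℝ) ^ 2 := one_le_pow₀ hD
  have p1 : 0 < 11 * (nx * nu : ℝ) ^ 2 * L := by positivity
  have p2 : 0 ≤ (nx * nu : ℝ) * (G + L * δ) / δ := by positivity
  have p3 : 0 < κ ^ 3 := by positivity
  -- The three summands dominate, in turn, the window coefficient, the step length relative to δ,
  -- and λ/4.
  obtain ⟨h, hh⟩ : ∃ h, h = 11 * (nx * nu : ℝ) ^ 2 * L + (nx * nu) * (G + L * δ) / δ + κ ^ 3 :=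
    ⟨_, rfl⟩
  have hh0 : 0 < h := by linarith
  have hLh : L ≤ h := by nlinarith
  have hDh : 11 * (nx * nu : ℝ) ^ 2 * L ≤ h := by linarith
  have hκh : κ ^ 3 ≤ h := by linarith
  have hGh : (nx * nu : ℝ) * (G + L * δ) ≤ h * δ := by
    rw [← div_le_iff₀ hδ]
    linarith
  -- L² would suffice for the heterogeneity bound; the factor 16 (nx nu)² is there for the residual
  -- of the recursion.
  refine ⟨h, 16 * (nx * nu) ^ 2 * L ^ 2, δ, hh0, by positivity, hδ, ?_⟩
  intro M sys X₀ μ γ εA εB εQ εR K₀ Kstar hQ hR hμ hX hopt hγ hK₀ hA hB hεQ hεR hhet hpb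
  have hpar := hpb.params hκ hQ hR hX
  obtain ⟨hsm, hgrad, hlip, hstab⟩ := hfam M sys X₀ μ γ εA εB εQ εR K₀ Kstar hpar hX hγ hA hB hεQ hεR
    hhet hpb
  have hσ : 0 < εA + εB + εQ + εR := by positivity
  refine ⟨fun i K hK K' hK' => ?_, fun i j _ K hK => ?_, ?_⟩
  · refine (hlip i K hK K' hK').trans ?_
    gcongr
  · have h1 := hsm.grad_close i j K hK K hK
    rw [sub_self, norm_zero, mul_zero, zero_add] at h1
    calc _ ≤ (L * (εA + εB + εQ + εR)) ^ 2 := by gcongr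
      _ = L ^ 2 * (εA + εB + εQ + εR) ^ 2 := mul_pow _ _ _
      _ ≤ 16 * (nx * nu : ℝ) ^ 2 * L ^ 2 * (εA + εB + εQ + εR) ^ 2 := by
        gcongr
        nlinarith [sq_nonneg L]
  intro bs m N τmax η r sched Ω _ P _ u K hbs hm hτmax hr hrδ hη hηle hU hrun
  obtain ⟨s1, s2, s3⟩ := AsyncLQR.le_of_le_etaGap hh0 hτmax hη hηle
  have hne : Nonempty (Fin M) := by
    have h1 : (sched.batch 0).Nonempty := by
      rw [← Finset.card_pos, sched.card_batch]
      omega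
    exact h1.to_type
  have hlam := AsyncLQR.gradDom_pos hx hκ hμ hpar hX hpb fun i => (hopt i).1
  have hlam' := AsyncLQR.gradDom_le_cube hx hu hκ hμ hγ hR hpar hX hpb (fun i => (hopt i).1) hK₀
    hne.some
  -- Delays are integers, so ⌊τmax⌋ bounds them and serves as the window parameter τ.
  have hτ1 : 1 ≤ ⌊τmax⌋₊ := Nat.le_floor (by simpa using hτmax)
  have hτle : ((⌊τmax⌋₊ : ℕ) : ℝ) ≤ τmax := Nat.floor_le (by linarith)
  obtain ⟨hρ, hw⟩ := AsyncLQR.half_le_one_sub_pow hη hlam hlam' hκh hτle s1 s2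
  have hηlam := mul_pos hη hlam
  refine ⟨⟨hρ, by linarith⟩, fun i => ?_⟩
  have hζη := AsyncLQR.window_coeff_le hη hh0 hL hD hDh hτle hτ1 s2 s3 rfl
  have hηδ : η * ((nx * nu) * (G + L * δ)) ≤ δ := by
    calc η * ((nx * nu) * (G + L * δ)) ≤ η * (h * δ) := by gcongr
      _ = η * h * δ := by ring
      _ ≤ 1 * δ := by gcongr; linarith
      _ = δ := one_mul δ
  obtain ⟨c1, c2, c3⟩ := hsm.gap_bound (sched := sched) (K := K) (i := i) (B := κ)
    (Jopt := (sys i).cost X₀ (Kstar i)) hU hx hu hm hbs hr hrδ hη hηδ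
    (fun s n => Nat.le_floor (sched.delay_le_max s n)) hrun.1 hK₀
    (fun n ω => by
      rw [hrun.2, AsyncLQR.aggEstimate, smul_smul, div_eq_mul_inv])
    (fun K' hK' => by
      rw [abs_of_nonneg ((sys i).cost_nonneg X₀ K')]
      exact hpb.cost_le hγ hK' i)
    (fun K' hK' K'' hd => (hopt i).2 K'' (hstab i K' hK' K'' hd)) hlam
    (fun K' hK' => by
      rw [hgrad i K' hK']
      exact AsyncLQR.gradDom_mul_gap_le hx hκ hμ hR hpar hX hpb hopt i (hK' i).1)
    hρ hw rfl hζη N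
  have hres := AsyncLQR.residual_le (r := r) (σ := εA + εB + εQ + εR) (w := 2 * ⌊τmax⌋₊) hη hlam hL
    hD hDh hx (by positivity) hζη
  have hfin := c3.trans (add_le_add_right hres _)
  refine ⟨?_, c2, hfin, fun hall => ?_⟩
  · filter_upwards [c1] with ω hω hn
    obtain ⟨K', hK', hd⟩ := hω hn
    exact hstab i K' hK' _ hd
  · have huniv : P.restrict (AsyncLQR.stayEvent (AsyncLQR.sublevel sys X₀ Kstar K₀ γ) K N) = P :=
      Measure.restrict_eq_self_of_ae_mem hall
    rw [IntegrableOn, huniv] at c2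
    rw [huniv] at hfin
    exact ⟨c2, hfin⟩
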